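/- Let $X$ be a cyclic oriented orbifold of dimension $2n$ (Hausdorff and second countable, all isotropy groups cyclic, each acting on its oriented charts linearly and preserving orientation), and assume that the orders $m(x)$ of the isotropy groups have a finite least common multiple $m(X)$ (automatic if $X$ is compact). Let $(\omega,J,g)$ be an almost Kähler structure on $X$: $\omega$ is a closed orbifold $2$-form with $\omega^n>0$, $J$ is an orbifold almost complex structure, and $g(u,v)=\omega(u,Jv)$ is an orbifold Riemannian metric. Let $\pi:M\to X$ be a Seifert bundle: $M$ is an oriented smooth $(2n+1)$-manifold (Hausdorff and second countable) with a smooth $S^1$-action, $\pi$ is continuous, and every $x\in X$ has an orbifold chart $\tilde U\to \tilde U/\Gamma\cong U$ centred at $x$, with $\Gamma\cong\mathbb Z_m$ the isotropy group of $x$, for which there is an orientation-preserving $S^1$-equivariant diffeomorphism $(S^1\times\tilde U)/\mathbb Z_m\cong\pi^{-1}(U)$ over $\tilde U/\mathbb Z_m\cong U$, where a generator of $\mathbb Z_m$ acts on $S^1$ as multiplication by $e^{2\pi i/m}$. Let $\mu\subset S^1$ be the group of $m(X)$-th roots of unity. Then $M/\mu\to X$ is a principal bundle with group $S^1/\mu\cong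 S^1$ (via $s\mapsto s^{m(X)}$), and we put $$c_1(M/X)=\frac{1}{m(X)}\,c_1(M/\mu)\in H^2(X;\mathbb Q).$$ Here the sign of $c_1$ is the one for which, if $\eta$ is a connection $1$-form on $M$ taking the value $1$ on the generator of the $S^1=\mathbb R/\mathbb Z$-action, $c_1(M/X)$ is the class of the curvature form $F$ on $X$, $\pi^*F=d\eta$. Suppose that $[\omega]\in H^2(X;\mathbb R)$ is rational, that is, comes from $H^2(X;\mathbb Q)$, and that $c_1(M/X)=[\omega]$. Then $M$ admits a K-contact structure $(\xi,\eta,\Phi,\tilde g)$ with $$d\eta=\pi^*\omega .$$ That is, there are a smooth $1$-form $\eta$ on $M$ with $\eta\wedge(d\eta)^n>0$, its Reeb vector field $\xi$ ($\eta(\xi)=1$, $i_\xi d\eta=0$), a smooth endomorphism $\Phi$ of $TM$ with $\Phi^2=-\mathrm{id}+\xi\otimes\eta$, $d\eta(\Phi u,\Phi v)=d\eta(u,v)$ for all $u,v$, and $d\eta(\Phi u,u)>0$ for all nonzero $u\in\ker\eta$, and a Riemannian metric $\tilde g(u,v)=d\eta(\Phi u,v)+\eta(u)\eta(v)$ for which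 $\xi$ is a Killing field, such that $d\eta=\pi^*\omega$. -/

import Mathlib

open Set Filter Topology
open scoped Manifold ContDiff

noncomputable section

/-! ## Čech cohomology of a topological space with constant coefficients

Open covers are indexed by the points of the space, the set with index `x` being a neighbourhood
of `x`. Every open cover is refined by such a cover, and between two of them refinement is
inclusion index by index, so that the colimit over all open covers is the colimit over these. -/

/-- An open cover of `X` of the form `(U x)`, `x ∈ X`, with `x ∈ U x`. -/
structure PointedCover (X : Type*) [TopologicalSpace X] where
  U : X → Set X
  isOpen : ∀ x, IsOpen (U x)
  mem : ∀ x, x ∈ U x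

namespace PointedCover

variable {X : Type*} [TopologicalSpace X]

/-- `𝒰 ≤ 𝒱` means that `𝒱` is finer than `𝒰`. -/
instance : Preorder (PointedCover X) where
  le 𝒰 𝒱 := ∀ x, 𝒱.U x ⊆ 𝒰.U x
  le_refl _ _ := Subset.rfl
  le_trans _ _ _ h h' x := (h' x).trans (h x)

instance : IsDirectedOrder (PointedCover X) where
  directed 𝒰 𝒱 :=
    ⟨⟨fun x => 𝒰.U x ∩ 𝒱.U x, fun x => (𝒰.isOpen x).inter (𝒱.isOpen x),
      fun x => ⟨𝒰.mem x, 𝒱.mem x⟩⟩, fun _ => inter_subset_left, fun _ => inter_subset_right⟩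

instance : Nonempty (PointedCover X) :=
  ⟨⟨fun _ => univ, fun _ => isOpen_univ, fun x => mem_univ x⟩⟩

/-- The intersection of the members of the cover with indices `σ 0, …, σ (k - 1)`. -/
def inter (𝒰 : PointedCover X) {k : ℕ} (σ : Fin k → X) : Set X :=
  {p | ∀ i, p ∈ 𝒰.U (σ i)}

/-- Restriction of locally constant functions to a smaller subspace. -/
def restrict (A : Type*) [AddCommGroup A] {S T : Set X} (h : S ⊆ T) :
    LocallyConstant T A →+ LocallyConstant S A :=
  LocallyConstant.comapAddMonoidHom ⟨Set.inclusion h, continuous_inclusion h⟩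

/-- Čech `k`-cochains: a locally constant function on each `(k + 1)`-fold intersection. -/
abbrev Cochain (𝒰 : PointedCover X) (k : ℕ) (A : Type*) [AddCommGroup A] : Type _ :=
  ∀ σ : Fin (k + 1) → X, LocallyConstant (𝒰.inter σ) A

/-- The Čech coboundary `(δ c)(x₀, …, x_{k+1}) = ∑ i, (-1)ⁱ c(x₀, …, x̂ᵢ, …, x_{k+1})`. -/
def coboundary (𝒰 : PointedCover X) (k : ℕ) (A : Type*) [AddCommGroup A] :
    𝒰.Cochain k A →+ 𝒰.Cochain (k + 1) A :=
  AddMonoidHom.mk'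
    (fun c σ => ∑ i : Fin (k + 2), ((-1 : ℤ) ^ (i : ℕ)) •
      restrict A (S := 𝒰.inter σ) (T := 𝒰.inter (σ ∘ i.succAbove))
        (fun _ hp j => hp (i.succAbove j)) (c (σ ∘ i.succAbove)))
    (fun c c' => by
      funext σ
      simp only [Pi.add_apply, map_add, smul_add, Finset.sum_add_distrib])

/-- Čech `2`-cocycles of the cover. -/
abbrev Cocycle (𝒰 : PointedCover X) (A : Type*) [AddCommGroup A] : AddSubgroup (𝒰.Cochain 2 A) :=
  (𝒰.coboundary 2 A).ker

/-- The second Čech cohomology of the cover: cocycles modulo coboundaries. -/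
abbrev H2 (𝒰 : PointedCover X) (A : Type*) [AddCommGroup A] : Type _ :=
  𝒰.Cocycle A ⧸ (𝒰.coboundary 1 A).range.addSubgroupOf (𝒰.Cocycle A)

/-- Restriction of cochains to a finer cover. -/
def refine (A : Type*) [AddCommGroup A] {𝒰 𝒱 : PointedCover X} (h : 𝒰 ≤ 𝒱) (k : ℕ) :
    𝒰.Cochain k A →+ 𝒱.Cochain k A :=
  AddMonoidHom.mk'
    (fun c σ => restrict A (S := 𝒱.inter σ) (T := 𝒰.inter σ) (fun _ hp i => h _ (hp i)) (c σ))
    (fun c c' => by funext σ; simp only [Pi.add_apply, map_add])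

/-- Change of coefficients of cochains along a homomorphism. -/
def coeff (𝒰 : PointedCover X) {A B : Type*} [AddCommGroup A] [AddCommGroup B] (f : A →+ B)
    (k : ℕ) : 𝒰.Cochain k A →+ 𝒰.Cochain k B :=
  AddMonoidHom.mk' (fun c σ => (c σ).map f)
    (fun c c' => by funext σ; ext p; simp)

theorem coboundary_apply (𝒰 : PointedCover X) {k : ℕ} {A : Type*} [AddCommGroup A]
    (c : 𝒰.Cochain k A) (σ : Fin (k + 2) → X) (p : 𝒰.inter σ) :
    𝒰.coboundary k A c σ p = ∑ i : Fin (k + 2), ((-1 : ℤ) ^ (i : ℕ)) •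
      c (σ ∘ i.succAbove) ⟨p.1, fun j => p.2 (i.succAbove j)⟩ := by
  have h : ∀ (s : Finset (Fin (k + 2))) (g : Fin (k + 2) → LocallyConstant (𝒰.inter σ) A),
      (∑ i ∈ s, g i) p = ∑ i ∈ s, g i p := fun s g =>
    map_sum (LocallyConstant.evalAddMonoidHom p) g s
  change (∑ i : Fin (k + 2), _ : LocallyConstant (𝒰.inter σ) A) p = _
  rw [h]
  rfl

theorem coboundary_refine (A : Type*) [AddCommGroup A] {𝒰 𝒱 : PointedCover X} (h : 𝒰 ≤ 𝒱)
    (k : ℕ) (c : 𝒰.Cochain k A) :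
    𝒱.coboundary k A (refine A h k c) = refine A h (k + 1) (𝒰.coboundary k A c) := by
  funext σ
  ext p
  have h₂ : refine A h (k + 1) (𝒰.coboundary k A c) σ p
      = 𝒰.coboundary k A c σ ⟨p.1, fun i => h _ (p.2 i)⟩ := rfl
  rw [coboundary_apply, h₂, coboundary_apply]
  rfl

theorem coboundary_coeff (𝒰 : PointedCover X) {A B : Type*} [AddCommGroup A] [AddCommGroup B]
    (f : A →+ B) (k : ℕ) (c : 𝒰.Cochain k A) :
    𝒰.coboundary k B (𝒰.coeff f k c) = 𝒰.coeff f (k + 1) (𝒰.coboundary k A c) := by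
  funext σ
  ext p
  have h₂ : 𝒰.coeff f (k + 1) (𝒰.coboundary k A c) σ p = f (𝒰.coboundary k A c σ p) := rfl
  rw [coboundary_apply, h₂, coboundary_apply, map_sum]
  simp only [map_zsmul]
  rfl

/-- A homomorphism of cochains that commutes with the coboundary induces a homomorphism of
second cohomology groups. -/
def mapH2 {𝒰 𝒱 : PointedCover X} {A B : Type*} [AddCommGroup A] [AddCommGroup B]
    (F : ∀ k, 𝒰.Cochain k A →+ 𝒱.Cochain k B)
    (hF : ∀ k c, 𝒱.coboundary k B (F k c) = F (k + 1) (𝒰.coboundary k A c)) :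
    𝒰.H2 A →+ 𝒱.H2 B :=
  QuotientAddGroup.map _ _
    (((F 2).comp (𝒰.Cocycle A).subtype).codRestrict (𝒱.Cocycle B) (fun z => by
      rw [AddMonoidHom.mem_ker]
      change 𝒱.coboundary 2 B (F 2 z.1) = 0
      rw [hF, AddMonoidHom.mem_ker.mp z.2, map_zero]))
    (by
      rintro ⟨z, hz⟩ ⟨b, hb⟩
      exact ⟨F 1 b, (hF 1 b).trans (congrArg (F 2) hb)⟩)

/-- The restriction of second cohomology to a finer cover. -/
def refineH2 (A : Type*) [AddCommGroup A] (𝒰 𝒱 : PointedCover X) (h : 𝒰 ≤ 𝒱) :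
    𝒰.H2 A →+ 𝒱.H2 A :=
  mapH2 (refine A h) (coboundary_refine A h)

instance (A : Type*) [AddCommGroup A] :
    DirectedSystem (fun 𝒰 : PointedCover X => 𝒰.H2 A) (fun 𝒰 𝒱 h => refineH2 A 𝒰 𝒱 h) where
  map_self 𝒰 z := by
    obtain ⟨z, rfl⟩ := QuotientAddGroup.mk_surjective z
    rfl
  map_map 𝒰 𝒱 𝒲 _ _ z := by
    obtain ⟨z, rfl⟩ := QuotientAddGroup.mk_surjective z
    rfl

end PointedCover

open Classical in
/-- The second Čech cohomology group `H²(X; A)`, the colimit over the open covers of `X`. -/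
abbrev CechH2 (X : Type*) [TopologicalSpace X] (A : Type*) [AddCommGroup A] : Type _ :=
  AddCommGroup.DirectLimit (fun 𝒰 : PointedCover X => 𝒰.H2 A) (PointedCover.refineH2 A)

namespace CechH2

variable {X : Type*} [TopologicalSpace X]

open Classical in
/-- The class in `H²(X; A)` of a Čech cocycle of a cover. -/
def mk {A : Type*} [AddCommGroup A] (𝒰 : PointedCover X) (z : 𝒰.Cocycle A) : CechH2 X A :=
  AddCommGroup.DirectLimit.of (fun 𝒰 : PointedCover X => 𝒰.H2 A) (PointedCover.refineH2 A) 𝒰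
    (QuotientAddGroup.mk z)

open Classical in
/-- The homomorphism `H²(X; A) → H²(X; B)` induced by a homomorphism of coefficients `A → B`. -/
def coeff {A B : Type*} [AddCommGroup A] [AddCommGroup B] (f : A →+ B) :
    CechH2 X A →+ CechH2 X B :=
  AddCommGroup.DirectLimit.map
    (fun 𝒰 => PointedCover.mapH2 (𝒰.coeff f) (𝒰.coboundary_coeff f))
    (fun 𝒰 𝒱 h => by
      ext z
      rfl)

end CechH2

/-! ## Oriented orbifolds -/

/-- The Euclidean space `ℝᵈ`. -/
abbrev Euc (d : ℕ) : Type := EuclideanSpace ℝ (Fin d)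

/-- A `d`-dimensional orbifold chart `(Ũ, φ, Γ)` on `X`: a finite group `Γ` of orientation
preserving linear automorphisms of `ℝᵈ` that preserves the open set `Ũ ⊆ ℝᵈ`, and a map
`φ : Ũ → X` which induces a homeomorphism of `Ũ / Γ` with an open subset of `X`.
The values of `toFun` off `Ũ` are irrelevant. -/
structure OrbifoldChart (X : Type*) [TopologicalSpace X] (d : ℕ) where
  dom : Set (Euc d)
  isOpen_dom : IsOpen dom
  group : Subgroup (Euc d ≃L[ℝ] Euc d)
  finite_group : Finite group
  det_pos : ∀ γ ∈ group, 0 < (γ : Euc d →L[ℝ] Euc d).det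
  group_dom : ∀ γ ∈ group, ∀ z ∈ dom, γ z ∈ dom
  toFun : Euc d → X
  continuousOn : ContinuousOn toFun dom
  isOpen_image : ∀ V ⊆ dom, IsOpen V → IsOpen (toFun '' V)
  eq_iff : ∀ z ∈ dom, ∀ w ∈ dom, toFun z = toFun w ↔ ∃ γ ∈ group, γ z = w

namespace OrbifoldChart

variable {X : Type*} [TopologicalSpace X] {d : ℕ}

/-- The open subset `U = φ(Ũ)` of `X` covered by the chart. -/
def target (c : OrbifoldChart X d) : Set X := c.toFun '' c.dom

/-- The isotropy group of a point `z ∈ Ũ`. -/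
def isotropy (c : OrbifoldChart X d) (z : Euc d) : Subgroup (Euc d ≃L[ℝ] Euc d) where
  carrier := {γ | γ ∈ c.group ∧ γ z = z}
  mul_mem' {a b} ha hb := ⟨c.group.mul_mem ha.1 hb.1, by
    change a (b z) = z
    rw [hb.2, ha.2]⟩
  one_mem' := ⟨c.group.one_mem, rfl⟩
  inv_mem' {a} ha := ⟨c.group.inv_mem ha.1, by
    change a.symm z = z
    rw [ContinuousLinearEquiv.symm_apply_eq, ha.2]⟩

end OrbifoldChart

/-- A change of charts: an orientation preserving smooth open embedding `f : Ũ → Ũ'` over `X`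
which is equivariant with respect to a monomorphism `ι : Γ → Γ'`. -/
structure ChartEmbedding {X : Type*} [TopologicalSpace X] {d : ℕ} (c c' : OrbifoldChart X d) where
  hom : c.group →* c'.group
  hom_injective : Function.Injective hom
  toFun : Euc d → Euc d
  contDiffOn : ContDiffOn ℝ ∞ toFun c.dom
  mapsTo : MapsTo toFun c.dom c'.dom
  injOn : InjOn toFun c.dom
  det_pos : ∀ z ∈ c.dom, 0 < (fderiv ℝ toFun z).det
  equivariant : ∀ (γ : c.group), ∀ z ∈ c.dom, toFun (γ.1 z) = (hom γ).1 (toFun z)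
  comm : ∀ z ∈ c.dom, c'.toFun (toFun z) = c.toFun z

/-- An oriented orbifold structure of dimension `d` on the space `X`: an atlas of orbifold charts,
any two of which are related near every common point by changes of charts. -/
structure OrientedOrbifold (X : Type*) [TopologicalSpace X] (d : ℕ) where
  atlas : Set (OrbifoldChart X d)
  cover : ∀ x : X, ∃ c ∈ atlas, x ∈ c.target
  compatible : ∀ c ∈ atlas, ∀ c' ∈ atlas, ∀ x ∈ c.target ∩ c'.target,
    ∃ c'' ∈ atlas, x ∈ c''.target ∧ c''.target ⊆ c.target ∩ c'.target ∧
      Nonempty (ChartEmbedding c'' c) ∧ Nonempty (ChartEmbedding c'' c')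

namespace OrientedOrbifold

variable {X : Type*} [TopologicalSpace X] {d : ℕ}

/-- An orbifold is cyclic if all its isotropy groups are cyclic. -/
def IsCyclicOrbifold (O : OrientedOrbifold X d) : Prop :=
  ∀ c ∈ O.atlas, ∀ z ∈ c.dom, IsCyclic (c.isotropy z)

/-- `N` is a common multiple of the orders `m(x)` of the isotropy groups of all points. -/
def IsIsotropyMultiple (O : OrientedOrbifold X d) (N : ℕ) : Prop :=
  ∀ c ∈ O.atlas, ∀ z ∈ c.dom, Nat.card (c.isotropy z) ∣ N

/-- The number `m(X)`, the least common multiple of the orders of the isotropy groups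
(and the junk value `0` when they have no positive common multiple). -/
def isotropyLcm (O : OrientedOrbifold X d) : ℕ :=
  sInf {N : ℕ | 0 < N ∧ O.IsIsotropyMultiple N}

/-- `c` is a chart of the orbifold, not necessarily one of the atlas:
it embeds into a chart of the atlas. -/
def IsChart (O : OrientedOrbifold X d) (c : OrbifoldChart X d) : Prop :=
  ∃ c' ∈ O.atlas, Nonempty (ChartEmbedding c c')

end OrientedOrbifold

/-! ## Orbifold differential forms, and their classes -/

/-- An orbifold `k`-form on the open subset `U` of an orbifold: an invariant smooth `k`-form on
(the preimage of `U` in) each chart of the atlas, in agreement under changes of charts.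
Only the values on these sets matter. -/
structure OrbiForm {X : Type*} [TopologicalSpace X] {d : ℕ} (O : OrientedOrbifold X d)
    (U : Set X) (k : ℕ) where
  form : OrbifoldChart X d → Euc d → (Euc d) [⋀^Fin k]→L[ℝ] ℝ
  smooth : ∀ c ∈ O.atlas, ContDiffOn ℝ ∞ (form c) (c.dom ∩ c.toFun ⁻¹' U)
  invariant : ∀ c ∈ O.atlas, ∀ γ ∈ c.group, ∀ z ∈ c.dom, c.toFun z ∈ U →
    (form c (γ z)).compContinuousLinearMap (γ : Euc d →L[ℝ] Euc d) = form c z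
  agree : ∀ c ∈ O.atlas, ∀ c' ∈ O.atlas, ∀ e : ChartEmbedding c c', ∀ z ∈ c.dom, c.toFun z ∈ U →
    (form c' (e.toFun z)).compContinuousLinearMap (fderiv ℝ e.toFun z) = form c z

namespace OrbiForm

variable {X : Type*} [TopologicalSpace X] {d : ℕ} {O : OrientedOrbifold X d}

/-- The form on `X` is closed. -/
def IsClosedForm {k : ℕ} (Ω : OrbiForm O univ k) : Prop :=
  ∀ c ∈ O.atlas, ∀ z ∈ c.dom, extDeriv (Ω.form c) z = 0

/-- The de Rham class `[Ω] ∈ H²(X; ℝ)` of an orbifold `2`-form `Ω` is `w`. By the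
Čech–de Rham isomorphism, it is represented by the Čech cocycle `h y z - h x z + h x y`, where on
the members of a fine enough cover `Ω = d (β x)` for orbifold `1`-forms `β x`, and on the twofold
intersections `β y - β x = d (h x y)` for smooth orbifold functions `h x y`. -/
def HasClass (Ω : OrbiForm O univ 2) (w : CechH2 X ℝ) : Prop :=
  ∃ (𝒰 : PointedCover X) (β : ∀ x, OrbiForm O (𝒰.U x) 1) (h : X → X → X → ℝ)
    (ζ : 𝒰.Cocycle ℝ),
    (∀ x, ∀ c ∈ O.atlas, ∀ p ∈ c.dom, c.toFun p ∈ 𝒰.U x →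
      extDeriv ((β x).form c) p = Ω.form c p) ∧
    (∀ x y, ∀ c ∈ O.atlas,
      ContDiffOn ℝ ∞ (h x y ∘ c.toFun) (c.dom ∩ c.toFun ⁻¹' (𝒰.U x ∩ 𝒰.U y))) ∧
    (∀ x y, ∀ c ∈ O.atlas, ∀ p ∈ c.dom, c.toFun p ∈ 𝒰.U x ∩ 𝒰.U y → ∀ v : Euc d,
      fderiv ℝ (h x y ∘ c.toFun) p v = (β y).form c p ![v] - (β x).form c p ![v]) ∧
    (∀ (σ : Fin 3 → X) (p : 𝒰.inter σ),
      ζ.1 σ p = h (σ 1) (σ 2) p - h (σ 0) (σ 2) p + h (σ 0) (σ 1) p) ∧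
    CechH2.mk 𝒰 ζ = w

end OrbiForm

/-- Up to a positive factor, the value on `v` of the `n`-th exterior power of a `2`-form `Ω`. -/
def wedgePow {V : Type*} {n : ℕ} (Ω : V → V → ℝ) (v : Fin (2 * n) → V) : ℝ :=
  ∑ σ : Equiv.Perm (Fin (2 * n)), ((Equiv.Perm.sign σ : ℤ) : ℝ) *
    ∏ i : Fin n, Ω (v (σ ⟨2 * i, by omega⟩)) (v (σ ⟨2 * i + 1, by omega⟩))

/-- Up to a positive factor, the value on `v` of `η ∧ Ωⁿ`, for a `1`-form `η` and a `2`-form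
`Ω`. -/
def wedgeContact {V : Type*} {n : ℕ} (η : V → ℝ) (Ω : V → V → ℝ) (v : Fin (2 * n + 1) → V) : ℝ :=
  ∑ σ : Equiv.Perm (Fin (2 * n + 1)), ((Equiv.Perm.sign σ : ℤ) : ℝ) *
    (η (v (σ 0)) *
      ∏ i : Fin n, Ω (v (σ ⟨2 * i + 1, by omega⟩)) (v (σ ⟨2 * i + 2, by omega⟩)))

/-- An almost Kähler structure `(Ω, J, g)` on an oriented orbifold of dimension `2n`: a symplectic
orbifold form `Ω` (closed, with `Ωⁿ > 0`), an orbifold almost complex structure `J` and an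
orbifold Riemannian metric `g` with `g(u, v) = Ω(u, J v)`. -/
structure AlmostKahler {X : Type*} [TopologicalSpace X] {n : ℕ}
    (O : OrientedOrbifold X (2 * n)) where
  Ω : OrbiForm O univ 2
  closed : Ω.IsClosedForm
  positive : ∀ c ∈ O.atlas, ∀ z ∈ c.dom,
    0 < wedgePow (fun u v => Ω.form c z ![u, v]) (fun i => EuclideanSpace.basisFun (Fin (2 * n)) ℝ i)
  J : OrbifoldChart X (2 * n) → Euc (2 * n) → (Euc (2 * n) →L[ℝ] Euc (2 * n))
  J_smooth : ∀ c ∈ O.atlas, ContDiffOn ℝ ∞ (J c) c.dom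
  J_invariant : ∀ c ∈ O.atlas, ∀ γ ∈ c.group, ∀ z ∈ c.dom, ∀ u, J c (γ z) (γ u) = γ (J c z u)
  J_agree : ∀ c ∈ O.atlas, ∀ c' ∈ O.atlas, ∀ e : ChartEmbedding c c', ∀ z ∈ c.dom, ∀ u,
    J c' (e.toFun z) (fderiv ℝ e.toFun z u) = fderiv ℝ e.toFun z (J c z u)
  J_sq : ∀ c ∈ O.atlas, ∀ z ∈ c.dom, ∀ u, J c z (J c z u) = -u
  g : OrbifoldChart X (2 * n) → Euc (2 * n) → (Euc (2 * n) →L[ℝ] Euc (2 * n) →L[ℝ] ℝ)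
  g_smooth : ∀ c ∈ O.atlas, ContDiffOn ℝ ∞ (g c) c.dom
  g_invariant : ∀ c ∈ O.atlas, ∀ γ ∈ c.group, ∀ z ∈ c.dom, ∀ u v,
    g c (γ z) (γ u) (γ v) = g c z u v
  g_agree : ∀ c ∈ O.atlas, ∀ c' ∈ O.atlas, ∀ e : ChartEmbedding c c', ∀ z ∈ c.dom, ∀ u v,
    g c' (e.toFun z) (fderiv ℝ e.toFun z u) (fderiv ℝ e.toFun z v) = g c z u v
  g_symm : ∀ c ∈ O.atlas, ∀ z ∈ c.dom, ∀ u v, g c z u v = g c z v u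
  g_pos : ∀ c ∈ O.atlas, ∀ z ∈ c.dom, ∀ u, u ≠ 0 → 0 < g c z u u
  g_eq : ∀ c ∈ O.atlas, ∀ z ∈ c.dom, ∀ u v, g c z u v = Ω.form c z ![u, J c z v]

/-! ## Oriented manifolds and Seifert bundles -/

/-- An orientation of a manifold of dimension `N`: an orientation of every tangent space, locally
constant in charts. (`TangentSpace (𝓡 N) p` is `ℝᴺ`, identified through the preferred chart
at `p`.) -/
structure ManifoldOrientation (N : ℕ) (M : Type*) [TopologicalSpace M] [ChartedSpace (Euc N) M]
    where
  orient : ∀ p : M, Orientation ℝ (TangentSpace (𝓡 N) p) (Fin N)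
  locally_constant : ∀ p : M, ∀ᶠ q in 𝓝 p,
    ∀ (b : Module.Basis (Fin N) ℝ (TangentSpace (𝓡 N) q))
      (b' : Module.Basis (Fin N) ℝ (TangentSpace (𝓡 N) p)),
      (∀ i, b' i = mfderiv (𝓡 N) 𝓘(ℝ, Euc N) (extChartAt (𝓡 N) p) q (b i)) →
      (b.orientation = orient q ↔ b'.orientation = orient p)

/-- The group `μ` of `m`-th roots of unity in the circle. -/
def circleRoots (m : ℕ) : Subgroup Circle := (powMonoidHom m : Circle →* Circle).ker

/-- An equivariant parametrisation of the preimage of `U = φ(Ũ)` under `π : M → X` by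
`(S¹ × Ũ) / Γ`, for an orbifold chart `(Ũ, φ, Γ)`. The group `Γ` acts on `S¹` by multiplication
through a faithful character `χ`, that is, some generator of `Γ ≅ ℤ/m` acts as `exp (2πi / m)`.
The diffeomorphism `(S¹ × Ũ) / Γ ≅ π⁻¹(U)` is given by its composite `Ψ` with the quotient map,
a local diffeomorphism whose fibres are the `Γ`-orbits. -/
structure SeifertModel {X : Type*} [TopologicalSpace X] {d : ℕ} {M : Type*} [TopologicalSpace M]
    [ChartedSpace (Euc (d + 1)) M] [MulAction Circle M] (o : ManifoldOrientation (d + 1) M)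
    (π : M → X) (c : OrbifoldChart X d) where
  χ : c.group →* Circle
  χ_injective : Function.Injective χ
  Ψ : Circle × Euc d → M
  localDiffeo : IsLocalDiffeomorphOn ((𝓡 1).prod (𝓡 d)) (𝓡 (d + 1)) ∞ Ψ (univ ×ˢ c.dom)
  image : Ψ '' (univ ×ˢ c.dom) = π ⁻¹' c.target
  eq_iff : ∀ u u' : Circle, ∀ z ∈ c.dom, ∀ z' ∈ c.dom,
    Ψ (u, z) = Ψ (u', z') ↔ ∃ γ : c.group, u' = χ γ * u ∧ z' = γ.1 z
  equivariant : ∀ s u : Circle, ∀ z ∈ c.dom, Ψ (s * u, z) = s • Ψ (u, z)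
  proj : ∀ u : Circle, ∀ z ∈ c.dom, π (Ψ (u, z)) = c.toFun z
  /-- `Ψ` preserves orientations: the direction of the circle, followed by the standard
  basis of `ℝᵈ`, is mapped to a positive basis. -/
  oriented : ∀ u : Circle, ∀ z ∈ c.dom,
    ∀ b : Module.Basis (Fin (d + 1)) ℝ (TangentSpace (𝓡 (d + 1)) (Ψ (u, z))),
      b 0 = mfderiv 𝓘(ℝ, ℝ × Euc d) (𝓡 (d + 1))
        (fun q : ℝ × Euc d => Ψ (Circle.exp q.1 * u, q.2)) (0, z) ((1, 0) : ℝ × Euc d) →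
      (∀ i : Fin d, b i.succ = mfderiv 𝓘(ℝ, ℝ × Euc d) (𝓡 (d + 1))
        (fun q : ℝ × Euc d => Ψ (Circle.exp q.1 * u, q.2)) (0, z)
        ((0, EuclideanSpace.basisFun (Fin d) ℝ i) : ℝ × Euc d)) →
      b.orientation = o.orient (Ψ (u, z))

/-- A Seifert bundle `π : M → X` over a cyclic oriented orbifold of dimension `d`, for an oriented
manifold `M` of dimension `d + 1` with a smooth `S¹`-action (`o` is the orientation). Every
`x ∈ X` has an orbifold chart `(Ũ, φ, Γ)` with `φ(0) = x`, so that `Γ` is the isotropy group of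
`x`, over which `M` is the model `(S¹ × Ũ) / Γ`. -/
structure SeifertBundle {X : Type*} [TopologicalSpace X] {d : ℕ} (O : OrientedOrbifold X d)
    {M : Type*} [TopologicalSpace M] [ChartedSpace (Euc (d + 1)) M] [MulAction Circle M]
    [ContMDiffSMul (𝓡 1) (𝓡 (d + 1)) ∞ Circle M] (o : ManifoldOrientation (d + 1) M) where
  π : M → X
  continuous_π : Continuous π
  model : ∀ x : X, ∃ c : OrbifoldChart X d, O.IsChart c ∧ (0 : Euc d) ∈ c.dom ∧ c.toFun 0 = x ∧
    Nonempty (SeifertModel o π c)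

namespace SeifertBundle

variable {X : Type*} [TopologicalSpace X] {d : ℕ} {O : OrientedOrbifold X d}
  {M : Type*} [TopologicalSpace M] [ChartedSpace (Euc (d + 1)) M] [MulAction Circle M]
  [ContMDiffSMul (𝓡 1) (𝓡 (d + 1)) ∞ Circle M] {o : ManifoldOrientation (d + 1) M}

theorem π_smul (S : SeifertBundle O o) (s : Circle) (p : M) : S.π (s • p) = S.π p := by
  obtain ⟨c, -, h0, hx, ⟨m⟩⟩ := S.model (S.π p)
  have hp : p ∈ S.π ⁻¹' c.target := ⟨0, h0, hx⟩
  rw [← m.image] at hp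
  obtain ⟨⟨u, z⟩, ⟨-, hz⟩, rfl⟩ := hp
  rw [← m.equivariant s u z hz, m.proj _ z hz, m.proj _ z hz]

/-- The quotient `M / μ`, where `μ` is the group of `m(X)`-th roots of unity. -/
abbrev ModMu (_S : SeifertBundle O o) : Type _ :=
  Quotient (MulAction.orbitRel (circleRoots O.isotropyLcm) M)

/-- The projection `M / μ → X`. -/
def πMu (S : SeifertBundle O o) : S.ModMu → X :=
  Quotient.lift S.π (by
    rintro _ b ⟨s, rfl⟩
    exact S.π_smul s.1 b)

/-- `τ` is the fibre coordinate of a (continuous) local trivialisation over `U` of the principal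
circle bundle `M / μ → X`. The structure group `S¹ / μ` is identified with `S¹` by the `m(X)`-th
power map, so that `s ∈ S¹` acts on the fibre coordinate as `s ^ m(X)`. -/
def IsFibreCoordinate (S : SeifertBundle O o) (U : Set X) (τ : S.ModMu → Circle) : Prop :=
  ContinuousOn τ (S.πMu ⁻¹' U) ∧
    ∀ p : M, S.π p ∈ U → ∀ s : Circle,
      τ (Quotient.mk _ (s • p)) = s ^ O.isotropyLcm * τ (Quotient.mk _ p)

/-- The Chern class `c₁(M / μ) ∈ H²(X; ℤ)` of the circle bundle `M / μ → X` is `a`. It is the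
image of the cocycle of transition functions under the connecting homomorphism of the exponential
sequence: for fibre coordinates `τ x` over the members of a fine enough cover, with transition
functions `τ x / τ y = exp (2πi f x y)`, it is represented by `f y z - f x z + f x y`. -/
def HasChernClassModMu (S : SeifertBundle O o) (a : CechH2 X ℤ) : Prop :=
  ∃ (𝒰 : PointedCover X) (τ : X → S.ModMu → Circle) (f : X → X → X → ℝ) (ζ : 𝒰.Cocycle ℤ),
    (∀ x, S.IsFibreCoordinate (𝒰.U x) (τ x)) ∧
    (∀ x y, ContinuousOn (f x y) (𝒰.U x ∩ 𝒰.U y)) ∧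
    (∀ x y, ∀ q : S.ModMu, S.πMu q ∈ 𝒰.U x ∩ 𝒰.U y →
      τ x q = Circle.exp (2 * Real.pi * f x y (S.πMu q)) * τ y q) ∧
    (∀ (σ : Fin 3 → X) (p : 𝒰.inter σ),
      ((ζ.1 σ p : ℤ) : ℝ) = f (σ 1) (σ 2) p - f (σ 0) (σ 2) p + f (σ 0) (σ 1) p) ∧
    CechH2.mk 𝒰 ζ = a

/-- The Chern class `c₁(M/X) = (1 / m(X)) c₁(M / μ) ∈ H²(X; ℚ)` of the Seifert bundle is `a`. -/
def HasChernClass (S : SeifertBundle O o) (a : CechH2 X ℚ) : Prop :=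
  ∃ b : CechH2 X ℤ, S.HasChernClassModMu b ∧
    a = CechH2.coeff (AddMonoidHom.mulLeft ((O.isotropyLcm : ℚ)⁻¹))
      (CechH2.coeff (Int.castAddHom ℚ) b)

end SeifertBundle

/-! ## K-contact structures -/

section KContact

variable {N : ℕ} {M : Type*} [TopologicalSpace M] [ChartedSpace (Euc N) M]

/-- The exterior derivative `dη` of a `1`-form `η` on a manifold, computed at `p` in the preferred
chart at `p` (through which `TangentSpace (𝓡 N) p` is identified with `ℝᴺ`). -/
def oneFormDeriv (η : ∀ p : M, TangentSpace (𝓡 N) p →L[ℝ] ℝ) (p : M)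
    (u v : TangentSpace (𝓡 N) p) : ℝ :=
  extDeriv (fun x : Euc N => ContinuousAlternatingMap.ofSubsingleton ℝ (Euc N) ℝ (0 : Fin 1)
      ((η ((extChartAt (𝓡 N) p).symm x)).comp
        (mfderiv 𝓘(ℝ, Euc N) (𝓡 N) (extChartAt (𝓡 N) p).symm x)))
    (extChartAt (𝓡 N) p p) ![u, v]

variable [IsManifold (𝓡 N) ∞ M]

/-- The vector field `ξ` is smooth. -/
def IsSmoothField (ξ : ∀ p : M, TangentSpace (𝓡 N) p) : Prop :=
  ContMDiff (𝓡 N) (𝓡 N).tangent ∞ (fun p => (⟨p, ξ p⟩ : TangentBundle (𝓡 N) M))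

/-- The vector field `ξ` is Killing for `g`, that is, `(L_ξ g)(Y, Z) = 0` for all smooth vector
fields `Y`, `Z`. -/
def IsKillingField
    (g : Bundle.ContMDiffRiemannianMetric (𝓡 N) ∞ (Euc N) (fun p : M => TangentSpace (𝓡 N) p))
    (ξ : ∀ p : M, TangentSpace (𝓡 N) p) : Prop :=
  ∀ Y Z : (∀ p : M, TangentSpace (𝓡 N) p), IsSmoothField Y → IsSmoothField Z → ∀ p : M,
    mfderiv (𝓡 N) 𝓘(ℝ, ℝ) (fun q => g.inner q (Y q) (Z q)) p (ξ p) =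
      g.inner p (VectorField.mlieBracket (𝓡 N) ξ Y p) (Z p) +
        g.inner p (Y p) (VectorField.mlieBracket (𝓡 N) ξ Z p)

end KContact

/-- A K-contact structure `(ξ, η, Φ, g)` on an oriented manifold of dimension `2n + 1`:
`η` is a contact form with `η ∧ (dη)ⁿ > 0`, `ξ` is its Reeb field, `Φ` is an endomorphism of the
tangent bundle with `Φ² = -id + ξ ⊗ η`, `dη(Φu, Φv) = dη(u, v)`, and `dη(Φu, u) > 0` for nonzero
`u ∈ ker η`, and `ξ` is Killing for the Riemannian metric `g(u, v) = dη(Φu, v) + η(u) η(v)`. -/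
structure KContactStructure {n : ℕ} {M : Type*} [TopologicalSpace M]
    [ChartedSpace (Euc (2 * n + 1)) M] [IsManifold (𝓡 (2 * n + 1)) ∞ M]
    (o : ManifoldOrientation (2 * n + 1) M) where
  η : ∀ p : M, TangentSpace (𝓡 (2 * n + 1)) p →L[ℝ] ℝ
  η_smooth : ContMDiff (𝓡 (2 * n + 1))
    ((𝓡 (2 * n + 1)).prod 𝓘(ℝ, Euc (2 * n + 1) →L[ℝ] ℝ)) ∞
    (fun p => Bundle.TotalSpace.mk' (Euc (2 * n + 1) →L[ℝ] ℝ)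
      (E := fun p : M => TangentSpace (𝓡 (2 * n + 1)) p →L[ℝ] Bundle.Trivial M ℝ p) p (η p))
  contact : ∀ p : M, ∀ b : Module.Basis (Fin (2 * n + 1)) ℝ (TangentSpace (𝓡 (2 * n + 1)) p),
    b.orientation = o.orient p → 0 < wedgeContact (η p) (oneFormDeriv η p) b
  ξ : ∀ p : M, TangentSpace (𝓡 (2 * n + 1)) p
  ξ_smooth : IsSmoothField ξ
  reeb : ∀ p, η p (ξ p) = 1
  reeb_deriv : ∀ p v, oneFormDeriv η p (ξ p) v = 0
  Φ : ∀ p : M, TangentSpace (𝓡 (2 * n + 1)) p →L[ℝ] TangentSpace (𝓡 (2 * n + 1)) p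
  Φ_smooth : ContMDiff (𝓡 (2 * n + 1))
    ((𝓡 (2 * n + 1)).prod 𝓘(ℝ, Euc (2 * n + 1) →L[ℝ] Euc (2 * n + 1))) ∞
    (fun p => Bundle.TotalSpace.mk' (Euc (2 * n + 1) →L[ℝ] Euc (2 * n + 1))
      (E := fun p : M => TangentSpace (𝓡 (2 * n + 1)) p →L[ℝ] TangentSpace (𝓡 (2 * n + 1)) p)
      p (Φ p))
  Φ_sq : ∀ p u, Φ p (Φ p u) = -u + η p u • ξ p
  Φ_compatible : ∀ p u v, oneFormDeriv η p (Φ p u) (Φ p v) = oneFormDeriv η p u v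
  Φ_positive : ∀ p u, u ≠ 0 → η p u = 0 → 0 < oneFormDeriv η p (Φ p u) u
  g : Bundle.ContMDiffRiemannianMetric (𝓡 (2 * n + 1)) ∞ (Euc (2 * n + 1))
    (fun p : M => TangentSpace (𝓡 (2 * n + 1)) p)
  g_eq : ∀ p u v, g.inner p u v = oneFormDeriv η p (Φ p u) v + η p u * η p v
  killing : IsKillingField g ξ

/-- The form `θ` on `M` is the pull-back `π^*Ω` of the orbifold form `Ω`: for every smooth local
lift `f : W → Ũ` of `π` to an orbifold chart, `θ = f^*Ω` on `W`. -/
def IsPullbackForm {X : Type*} [TopologicalSpace X] {d : ℕ} {O : OrientedOrbifold X d}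
    {N : ℕ} {M : Type*} [TopologicalSpace M] [ChartedSpace (Euc N) M] (π : M → X)
    (Ω : OrbiForm O univ 2)
    (θ : ∀ p : M, TangentSpace (𝓡 N) p → TangentSpace (𝓡 N) p → ℝ) : Prop :=
  ∀ c ∈ O.atlas, ∀ (W : Set M) (f : M → Euc d), IsOpen W → ContMDiffOn (𝓡 N) (𝓡 d) ∞ f W →
    (∀ q ∈ W, f q ∈ c.dom ∧ c.toFun (f q) = π q) →
    ∀ q ∈ W, ∀ u v : TangentSpace (𝓡 N) q,
      θ q u v = Ω.form c (f q) ![mfderiv (𝓡 N) (𝓡 d) f q u, mfderiv (𝓡 N) (𝓡 d) f q v]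

end

/-!
A connection form `η` on `M` with `dη = π^*Ω` is built from local data, and every tensor of the
K-contact structure is then read off in coordinates in which `η` is `ds + β`.

**Local data.** The class of `Ω` is computed by local primitives `β x` with
`β y - β x = d (h x y)`, and the Chern class by fibre coordinates `τ x` of `M / μ` with transition
functions `exp (2πi f x y)`. Equality of the two classes means that the real cocycles of `h` and
`m⁻¹ f`, with `m = m(X)`, are cohomologous on a common refinement. The locally constant cochain that
bounds their difference is absorbed into `h`, after which the cocycles are equal
(`exists_cechData`). The coordinates `τ x` are only continuous. In a model `(S¹ × Ũ) / Γ` the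
function `u ^ m` is a smooth fibre coordinate, because `m` kills `Γ`
(`SeifertBundle.exists_smooth_fibre_coordinate`), and comparing it with `τ x` leaves a smooth
additive cocycle on the base. A smooth partition of unity (`SeifertBundle.exists_partition`) splits
it, so the fibre coordinates can be taken smooth with transition functions `exp (2πi m h x y)`
(`CechData.exists_connectionData`).

**The connection form.** Near a point of `M` let `a` be a real function with `exp (2πi m a) = τ x`
up to a constant, and `f` a lift of `π` to an orbifold chart. Then `η = da + f^*β x`. The choice of
`a` and `x` does not matter since `a` changes by `h x y ∘ π` plus a constant when `β` changes by
`-dh`. The choice of `f` does not matter since two lifts of `π` to orbifold charts agree, together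
with their derivatives, up to chart symmetries and changes of charts, all of which preserve orbifold
tensors: among the finitely many symmetries one works on an open set close to any given point, and
derivatives are continuous (`exists_eq_and_fderiv_eq_of_finite`, `liftRel_of_lifts`). This gives
`AdaptedChart.η_eq`, and `dη = f^*dβ = π^*Ω` (`AdaptedChart.oneFormDeriv_eq_pullback`).

**The K-contact structure.** In the coordinates `(a, f)` with values in `ℝ × ℝ²ⁿ` the form `η` is
`ds + β`, the Reeb field `ξ` is `∂/∂s`, the endomorphism `Φ` takes values in `ker η` and lifts `-J`,
and the metric is `g + (ds + β)²`. The sign of `J` is the one for which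
`dη (Φ u, v) = Ω (-J u, v) = g (u, v)`. Nothing depends on `s`, so `ξ` is a Killing field
(`AdaptedChart.mvfderiv_metric_ξ`). Since `ξ` is in the kernel of `dη`, the sign of `η ∧ (dη)ⁿ` is
the product of those of `η ξ` and `Ωⁿ`, both positive in the oriented model
(`AdaptedChart.wedgeContact_pos`).
-/

noncomputable section

/-! ### Local lifts to orbifold charts -/

section Lifts

/-- If finitely many relatively closed sets cover a nonempty open set, then one of them contains a
nonempty open set. -/
theorem exists_isOpen_subset_of_finite_cover {α β : Type*} [TopologicalSpace α] {s : Set β}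
    (hs : s.Finite) {A : β → Set α} : ∀ U : Set α, IsOpen U → U.Nonempty →
    (∀ b ∈ s, IsOpen (U \ A b)) → (∀ q ∈ U, ∃ b ∈ s, q ∈ A b) →
    ∃ b ∈ s, ∃ V ⊆ U, IsOpen V ∧ V.Nonempty ∧ V ⊆ A b := by
  induction s, hs using Set.Finite.induction_on with
  | empty =>
    rintro U - ⟨q, hq⟩ - h
    obtain ⟨b, hb, -⟩ := h q hq
    exact hb.elim
  | @insert b₀ s _ _ ih =>
    intro U hU hne ho hc
    by_cases h : (U \ A b₀).Nonempty
    · obtain ⟨b, hb, V, hVU, hV, hVne, hVA⟩ := ih (U \ A b₀) (ho b₀ (mem_insert _ _)) h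
        (fun b hb => by
          have : (U \ A b₀) \ A b = (U \ A b) ∩ (U \ A b₀) := by ext; simp; tauto
          rw [this]
          exact (ho b (mem_insert_of_mem _ hb)).inter (ho b₀ (mem_insert _ _)))
        (fun q hq => by
          obtain ⟨b, hb, hqb⟩ := hc q hq.1
          rcases hb with rfl | hb
          · exact (hq.2 hqb).elim
          · exact ⟨b, hb, hqb⟩)
      exact ⟨b, mem_insert_of_mem _ hb, V, hVU.trans sdiff_subset, hV, hVne, hVA⟩
    · refine ⟨b₀, mem_insert _ _, U, Subset.rfl, hU, hne, fun q hq => ?_⟩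
      by_contra hqA
      exact h ⟨q, hq, hqA⟩

/-- Two `C¹` maps that agree pointwise up to a finite group have, at every point, values and
derivatives that agree up to one and the same element of the group: near a point where all elements
fail, one element would work on a nonempty open set. -/
theorem exists_eq_and_fderiv_eq_of_finite {P E : Type*} [NormedAddCommGroup P] [NormedSpace ℝ P]
    [NormedAddCommGroup E] [NormedSpace ℝ E] {Γ : Set (E →L[ℝ] E)} (hΓ : Γ.Finite) {f g : P → E}
    {q : P} (hf : ContDiffAt ℝ 1 f q) (hg : ContDiffAt ℝ 1 g q)
    (h : ∀ᶠ q' in 𝓝 q, ∃ γ ∈ Γ, γ (f q') = g q') :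
    ∃ γ ∈ Γ, γ (f q) = g q ∧ γ ∘L fderiv ℝ f q = fderiv ℝ g q := by
  by_contra! hcon
  have hf' : ContinuousAt (fderiv ℝ f) q := (hf.fderiv_right (m := 0) le_rfl).continuousAt
  have hg' : ContinuousAt (fderiv ℝ g) q := (hg.fderiv_right (m := 0) le_rfl).continuousAt
  have key : ∀ᶠ q' in 𝓝 q, ∀ γ ∈ Γ, γ (f q') = g q' →
      γ ∘L fderiv ℝ f q' ≠ fderiv ℝ g q' := by
    refine (hΓ.eventually_all).2 fun γ hγ => ?_
    by_cases h0 : γ (f q) = g q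
    · have h1 := hcon γ hγ h0
      have h2 : ContinuousAt (fun q' => γ ∘L fderiv ℝ f q') q :=
        ((ContinuousLinearMap.compL ℝ P E E γ).continuous.continuousAt).comp hf'
      filter_upwards [(h2.ne_iff_eventually_ne hg').1 h1] with q' hq' _
      exact hq'
    · have h2 : ContinuousAt (fun q' => γ (f q')) q := γ.continuous.continuousAt.comp hf.continuousAt
      filter_upwards [(h2.ne_iff_eventually_ne hg.continuousAt).1 h0] with q' hq' hq''
      exact (hq' hq'').elim
  have hall := ((hf.eventually (by simp)).and (hg.eventually (by simp))).and (h.and key)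
  obtain ⟨U, hUsub, hU, hqU⟩ := mem_nhds_iff.1 hall
  obtain ⟨γ, hγ, V, hVU, hV, ⟨p, hp⟩, hVA⟩ := exists_isOpen_subset_of_finite_cover hΓ
    (A := fun γ => {q' | γ (f q') = g q'}) U hU ⟨q, hqU⟩
    (fun γ _ => by
      refine isOpen_iff_mem_nhds.2 fun p hp => ?_
      have h1 := (hUsub hp.1).1
      have h2 : ContinuousAt (fun q' => γ (f q')) p :=
        γ.continuous.continuousAt.comp h1.1.continuousAt
      filter_upwards [hU.mem_nhds hp.1,
        (h2.ne_iff_eventually_ne h1.2.continuousAt).1 hp.2] with q' h3 h4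
      exact ⟨h3, h4⟩)
    (fun p hp => (hUsub hp).2.1)
  refine (hUsub (hVU hp)).2.2 γ hγ (hVA hp) ?_
  have heq : (fun q' => γ (f q')) =ᶠ[𝓝 p] g := by
    filter_upwards [hV.mem_nhds hp] with q' hq' using hVA hq'
  rw [← heq.fderiv_eq]
  have hd : DifferentiableAt ℝ f p := (hUsub (hVU hp)).1.1.differentiableAt (by simp)
  exact ((γ.hasFDerivAt.comp p hd.hasFDerivAt).fderiv).symm

variable {X : Type*} [TopologicalSpace X] {d : ℕ}

/-- Two infinitesimal lifts of the same object over `y ∈ X`: `D : V → ℝᵈ` at the point `z` of the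
chart `c`, and `D'` at the point `z'` of `c'`, are related if a chain of chart symmetries and of
changes of charts (and their inverses) takes one to the other. -/
inductive LiftRel (O : OrientedOrbifold X d) {V : Type*} (y : X) :
    OrbifoldChart X d → Euc d → (V → Euc d) → OrbifoldChart X d → Euc d → (V → Euc d) → Prop
  | group (c : OrbifoldChart X d) (hc : c ∈ O.atlas) (γ : Euc d ≃L[ℝ] Euc d) (hγ : γ ∈ c.group)
      (z : Euc d) (hz : z ∈ c.dom) (hy : c.toFun z = y) (D : V → Euc d) :
      LiftRel O y c z D c (γ z) (γ ∘ D)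
  | embed (c c' : OrbifoldChart X d) (hc : c ∈ O.atlas) (hc' : c' ∈ O.atlas)
      (e : ChartEmbedding c c') (z : Euc d) (hz : z ∈ c.dom) (hy : c.toFun z = y) (D : V → Euc d) :
      LiftRel O y c z D c' (e.toFun z) (fderiv ℝ e.toFun z ∘ D)
  | symm {c z D c' z' D'} : LiftRel O y c z D c' z' D' → LiftRel O y c' z' D' c z D
  | trans {c z D c' z' D' c'' z'' D''} : LiftRel O y c z D c' z' D' →
      LiftRel O y c' z' D' c'' z'' D'' → LiftRel O y c z D c'' z'' D''

namespace LiftRel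

variable {O : OrientedOrbifold X d} {V : Type*} {y : X} {c c' : OrbifoldChart X d}
  {z z' : Euc d} {D D' : V → Euc d}

/-- Orbifold forms take the same value on related lifts. -/
theorem form_eq {U : Set X} {k : ℕ} (β : OrbiForm O U k) (hy : y ∈ U)
    (h : LiftRel O y c z D c' z' D') (v : Fin k → V) :
    β.form c z (D ∘ v) = β.form c' z' (D' ∘ v) := by
  induction h with
  | group c hc γ hγ z hz hy' D =>
    rw [← β.invariant c hc γ hγ z hz (hy' ▸ hy)]
    rfl
  | embed c c' hc hc' e z hz hy' D =>
    rw [← β.agree c hc c' hc' e z hz (hy' ▸ hy)]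
    rfl
  | symm _ ih => exact ih.symm
  | trans _ _ ih ih' => exact ih.trans ih'

end LiftRel

namespace LiftRel

variable {n : ℕ} {O : OrientedOrbifold X (2 * n)} {V : Type*} {y : X}
  {c c' : OrbifoldChart X (2 * n)} {z z' : Euc (2 * n)} {D D' : V → Euc (2 * n)}

/-- The orbifold metric takes the same value on related lifts. -/
theorem metric_eq (K : AlmostKahler O) (h : LiftRel O y c z D c' z' D') (u v : V) :
    K.g c z (D u) (D v) = K.g c' z' (D' u) (D' v) := by
  induction h with
  | group c hc γ hγ z hz hy D => exact (K.g_invariant c hc γ hγ z hz _ _).symm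
  | embed c c' hc hc' e z hz hy D => exact (K.g_agree c hc c' hc' e z hz _ _).symm
  | symm _ ih => exact ih.symm
  | trans _ _ ih ih' => exact ih.trans ih'

theorem fderiv_injective {c c' : OrbifoldChart X d} (e : ChartEmbedding c c') {z : Euc d}
    (hz : z ∈ c.dom) : Function.Injective (fderiv ℝ e.toFun z) := by
  intro u v h
  rw [← ContinuousLinearMap.toContinuousLinearEquivOfDetNeZero_apply _ (e.det_pos z hz).ne',
    ← ContinuousLinearMap.toContinuousLinearEquivOfDetNeZero_apply _ (e.det_pos z hz).ne'] at h
  exact ContinuousLinearEquiv.injective _ h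

/-- The relation `-J u = v` is the same for related lifts, so that it makes sense upstairs. -/
theorem eq_neg_complex_iff (K : AlmostKahler O) (h : LiftRel O y c z D c' z' D') (u v : V) :
    D v = -K.J c z (D u) ↔ D' v = -K.J c' z' (D' u) := by
  induction h with
  | group c hc γ hγ z hz hy D =>
    simp only [Function.comp_apply]
    rw [K.J_invariant c hc γ hγ z hz, ← map_neg γ, γ.injective.eq_iff]
  | embed c c' hc hc' e z hz hy D =>
    simp only [Function.comp_apply]
    rw [K.J_agree c hc c' hc' e z hz, ← map_neg (fderiv ℝ e.toFun z), (fderiv_injective e hz).eq_iff]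
  | symm _ ih => exact ih.symm
  | trans _ _ ih ih' => exact ih.trans ih'

end LiftRel

namespace LiftRel

/-- Related lifts have the same kernel; stated for pairs of vectors since `V` carries no algebra. -/
theorem eq_iff {O : OrientedOrbifold X d} {V : Type*} {y : X} {c c' : OrbifoldChart X d}
    {z z' : Euc d} {D D' : V → Euc d} (h : LiftRel O y c z D c' z' D') (u v : V) :
    D v = D u ↔ D' v = D' u := by
  induction h with
  | group c hc γ hγ z hz hy D => exact (γ.injective.eq_iff).symm
  | embed c c' hc hc' e z hz hy D => exact ((fderiv_injective e hz).eq_iff).symm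
  | symm _ ih => exact ih.symm
  | trans _ _ ih ih' => exact ih.trans ih'

end LiftRel

/-- The local inverse of a change of charts. -/
theorem ChartEmbedding.exists_local_inverse {c c' : OrbifoldChart X d} (e : ChartEmbedding c c')
    {w : Euc d} (hw : w ∈ c.dom) :
    ∃ g : Euc d → Euc d, ContDiffAt ℝ ∞ g (e.toFun w) ∧ g (e.toFun w) = w ∧
      ∀ᶠ z in 𝓝 (e.toFun w), e.toFun (g z) = z := by
  have hc : ContDiffAt ℝ ∞ e.toFun w := e.contDiffOn.contDiffAt (c.isOpen_dom.mem_nhds hw)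
  have hd : HasFDerivAt e.toFun (((fderiv ℝ e.toFun w).toContinuousLinearEquivOfDetNeZero
      (e.det_pos w hw).ne' : Euc d ≃L[ℝ] Euc d) : Euc d →L[ℝ] Euc d) w := by
    rw [ContinuousLinearMap.coe_toContinuousLinearEquivOfDetNeZero]
    exact (hc.differentiableAt (by simp)).hasFDerivAt
  have hn : (∞ : WithTop ℕ∞) ≠ 0 := by simp
  refine ⟨hc.localInverse hd hn, hc.to_localInverse hd hn, hc.localInverse_apply_image hd hn, ?_⟩
  exact (hc.hasStrictFDerivAt' hd hn).eventually_right_inverse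

/-- Any two smooth lifts of the same map to orbifold charts are infinitesimally related. -/
theorem liftRel_of_lifts (O : OrientedOrbifold X d) {P : Type*} [NormedAddCommGroup P]
    [NormedSpace ℝ P] {ϖ : P → X} {q : P} {c₁ c₂ : OrbifoldChart X d} (hc₁ : c₁ ∈ O.atlas)
    (hc₂ : c₂ ∈ O.atlas) {f₁ f₂ : P → Euc d} (hf₁ : ContDiffAt ℝ 1 f₁ q)
    (hf₂ : ContDiffAt ℝ 1 f₂ q) (h₁ : ∀ᶠ p in 𝓝 q, f₁ p ∈ c₁.dom ∧ c₁.toFun (f₁ p) = ϖ p)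
    (h₂ : ∀ᶠ p in 𝓝 q, f₂ p ∈ c₂.dom ∧ c₂.toFun (f₂ p) = ϖ p) :
    LiftRel O (ϖ q) c₁ (f₁ q) (fderiv ℝ f₁ q) c₂ (f₂ q) (fderiv ℝ f₂ q) := by
  obtain ⟨hz₁, hy₁⟩ := h₁.self_of_nhds
  obtain ⟨hz₂, hy₂⟩ := h₂.self_of_nhds
  obtain ⟨c, hc, ⟨w, hw, hwy⟩, -, ⟨e₁⟩, ⟨e₂⟩⟩ := O.compatible c₁ hc₁ c₂ hc₂ (ϖ q)
    ⟨⟨_, hz₁, hy₁⟩, ⟨_, hz₂, hy₂⟩⟩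
  -- each lift is moved into the common chart `c`
  have key : ∀ (c₁ : OrbifoldChart X d) (_ : c₁ ∈ O.atlas) (e₁ : ChartEmbedding c c₁) (f₁ : P → Euc d)
      (_ : ContDiffAt ℝ 1 f₁ q) (_ : ∀ᶠ p in 𝓝 q, f₁ p ∈ c₁.dom ∧ c₁.toFun (f₁ p) = ϖ p),
      ∃ f : P → Euc d, ContDiffAt ℝ 1 f q ∧ f q = w ∧
        (∀ᶠ p in 𝓝 q, f p ∈ c.dom ∧ c.toFun (f p) = ϖ p) ∧
        LiftRel O (ϖ q) c₁ (f₁ q) (fderiv ℝ f₁ q) c w (fderiv ℝ f q) := by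
    intro c₁ hc₁ e₁ f₁ hf₁ h₁
    obtain ⟨hz₁, hy₁⟩ := h₁.self_of_nhds
    obtain ⟨γ, hγ, hγz⟩ := (c₁.eq_iff _ hz₁ _ (e₁.mapsTo hw)).1
      (by rw [hy₁, e₁.comm w hw, hwy])
    obtain ⟨g, hg, hgw, hge⟩ := e₁.exists_local_inverse hw
    have hγf : ContDiffAt ℝ 1 (fun p => γ (f₁ p)) q := γ.contDiff.contDiffAt.comp q hf₁
    have hg1 : ContDiffAt ℝ 1 g (γ (f₁ q)) := by rw [hγz]; exact hg.of_le (by norm_num)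
    have hgf : ContDiffAt ℝ 1 (fun p => g (γ (f₁ p))) q := hg1.comp q hγf
    have hgq : g (γ (f₁ q)) = w := by rw [hγz, hgw]
    have hgdom : ∀ᶠ p in 𝓝 q, g (γ (f₁ p)) ∈ c.dom :=
      hgf.continuousAt.eventually_mem (by rw [hgq]; exact c.isOpen_dom.mem_nhds hw)
    have hinv : ∀ᶠ p in 𝓝 q, e₁.toFun (g (γ (f₁ p))) = γ (f₁ p) := by
      have h3 : Tendsto (fun p => γ (f₁ p)) (𝓝 q) (𝓝 (e₁.toFun w)) := by
        rw [← hγz]; exact hγf.continuousAt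
      exact h3.eventually hge
    refine ⟨fun p => g (γ (f₁ p)), hgf, hgq, ?_, ?_⟩
    · filter_upwards [hgdom, hinv, h₁] with p hp1 hp2 hp3
      refine ⟨hp1, ?_⟩
      rw [← e₁.comm _ hp1, hp2, ← hp3.2]
      exact ((c₁.eq_iff _ hp3.1 _ (c₁.group_dom γ hγ _ hp3.1)).2 ⟨γ, hγ, rfl⟩).symm
    · have r1 := LiftRel.group c₁ hc₁ γ hγ (f₁ q) hz₁ hy₁ (fderiv ℝ f₁ q)
      have r2 := LiftRel.embed c c₁ hc hc₁ e₁ w hw hwy (fderiv ℝ (fun p => g (γ (f₁ p))) q)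
      have hder : (γ : Euc d → Euc d) ∘ (fderiv ℝ f₁ q)
          = fderiv ℝ e₁.toFun w ∘ fderiv ℝ (fun p => g (γ (f₁ p))) q := by
        have a1 : fderiv ℝ (fun p => e₁.toFun (g (γ (f₁ p)))) q
            = fderiv ℝ (fun p => γ (f₁ p)) q := Filter.EventuallyEq.fderiv_eq hinv
        have a2 : HasFDerivAt (fun p => γ (f₁ p)) ((γ : Euc d →L[ℝ] Euc d) ∘L fderiv ℝ f₁ q) q :=
          γ.hasFDerivAt.comp q (hf₁.differentiableAt (by simp)).hasFDerivAt
        have hde : HasFDerivAt e₁.toFun (fderiv ℝ e₁.toFun w) (g (γ (f₁ q))) := by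
          rw [hgq]
          exact ((e₁.contDiffOn.contDiffAt (c.isOpen_dom.mem_nhds hw)).differentiableAt
            (by simp)).hasFDerivAt
        have a3 := hde.comp q (hgf.differentiableAt (by simp)).hasFDerivAt
        have a4 := (a2.fderiv.symm.trans a1.symm).trans a3.fderiv
        exact congrArg (fun L : P →L[ℝ] Euc d => (L : P → Euc d)) a4
      rw [hγz, hder] at r1
      exact r1.trans r2.symm
  -- in `c` the two lifts differ by the finite group, including their derivatives
  obtain ⟨g₁, hg₁, hg₁q, hl₁, r₁⟩ := key c₁ hc₁ e₁ f₁ hf₁ h₁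
  obtain ⟨g₂, hg₂, hg₂q, hl₂, r₂⟩ := key c₂ hc₂ e₂ f₂ hf₂ h₂
  have hfin : Set.Finite ((fun γ : Euc d ≃L[ℝ] Euc d => (γ : Euc d →L[ℝ] Euc d)) ''
      (c.group : Set (Euc d ≃L[ℝ] Euc d))) :=
    (@Set.toFinite _ (c.group : Set (Euc d ≃L[ℝ] Euc d)) c.finite_group).image _
  obtain ⟨_, ⟨γ, hγ, rfl⟩, hγ1, hγ2⟩ := exists_eq_and_fderiv_eq_of_finite hfin hg₁ hg₂ (by
    filter_upwards [hl₁, hl₂] with p hp1 hp2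
    obtain ⟨γ, hγ, hγp⟩ := (c.eq_iff _ hp1.1 _ hp2.1).1 (hp1.2.trans hp2.2.symm)
    exact ⟨_, ⟨γ, hγ, rfl⟩, hγp⟩)
  have r := LiftRel.group (y := ϖ q) c hc γ hγ w hw hwy (fderiv ℝ g₁ q)
  have h1 : γ w = w := by
    rw [hg₁q, hg₂q] at hγ1
    exact hγ1
  have h2 : (γ : Euc d → Euc d) ∘ fderiv ℝ g₁ q = fderiv ℝ g₂ q :=
    congrArg (fun L : P →L[ℝ] Euc d => (L : P → Euc d)) hγ2
  rw [h1, h2] at r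
  exact r₁.trans (r.trans r₂.symm)

variable {N : ℕ} {M : Type*} [TopologicalSpace M] [ChartedSpace (Euc N) M]

/-- In the preferred chart at `q`, the derivative of a map at `q` is the ordinary derivative. -/
theorem mfderiv_eq_fderiv_extChartAt {F : Type*} [NormedAddCommGroup F] [NormedSpace ℝ F]
    {f : M → F} {q : M} (hf : MDifferentiableAt (𝓡 N) 𝓘(ℝ, F) f q) :
    (mfderiv (𝓡 N) 𝓘(ℝ, F) f q : Euc N →L[ℝ] F)
      = fderiv ℝ (f ∘ (extChartAt (𝓡 N) q).symm) (extChartAt (𝓡 N) q q) := by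
  rw [hf.mfderiv]
  simp only [writtenInExtChartAt, extChartAt_model_space_eq_id, modelWithCornersSelf_coe, range_id,
    fderivWithin_univ, Function.comp_def, PartialEquiv.refl_coe, id]
  rfl

theorem contDiffAt_comp_extChartAt_symm {F : Type*} [NormedAddCommGroup F] [NormedSpace ℝ F]
    {f : M → F} {q : M} {k : WithTop ℕ∞} (hf : ContMDiffAt (𝓡 N) 𝓘(ℝ, F) k f q) :
    ContDiffAt ℝ k (f ∘ (extChartAt (𝓡 N) q).symm) (extChartAt (𝓡 N) q q) := by
  have h := (contMDiffAt_iff.1 hf).2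
  simpa only [extChartAt_model_space_eq_id, modelWithCornersSelf_coe, range_id,
    contDiffWithinAt_univ, PartialEquiv.refl_coe, Function.comp_def, id] using h

theorem eventually_extChartAt_symm {q : M} {P : M → Prop} (h : ∀ᶠ p in 𝓝 q, P p) :
    ∀ᶠ y in 𝓝 (extChartAt (𝓡 N) q q), P ((extChartAt (𝓡 N) q).symm y) := by
  have h1 : Tendsto (extChartAt (𝓡 N) q).symm (𝓝 (extChartAt (𝓡 N) q q)) (𝓝 q) := by
    have := continuousAt_extChartAt_symm (I := 𝓡 N) q
    rwa [ContinuousAt, extChartAt_to_inv] at this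
  exact h1.eventually h

/-- Any two smooth lifts on a manifold of the same map to orbifold charts are infinitesimally
related. -/
theorem liftRel_of_manifold_lifts (O : OrientedOrbifold X d) {ϖ : M → X} {q : M}
    {c₁ c₂ : OrbifoldChart X d} (hc₁ : c₁ ∈ O.atlas) (hc₂ : c₂ ∈ O.atlas) {f₁ f₂ : M → Euc d}
    (hf₁ : ContMDiffAt (𝓡 N) (𝓡 d) ∞ f₁ q) (hf₂ : ContMDiffAt (𝓡 N) (𝓡 d) ∞ f₂ q)
    (h₁ : ∀ᶠ p in 𝓝 q, f₁ p ∈ c₁.dom ∧ c₁.toFun (f₁ p) = ϖ p)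
    (h₂ : ∀ᶠ p in 𝓝 q, f₂ p ∈ c₂.dom ∧ c₂.toFun (f₂ p) = ϖ p) :
    LiftRel O (ϖ q) c₁ (f₁ q) (mfderiv (𝓡 N) (𝓡 d) f₁ q : Euc N → Euc d)
      c₂ (f₂ q) (mfderiv (𝓡 N) (𝓡 d) f₂ q : Euc N → Euc d) := by
  have h := liftRel_of_lifts O (ϖ := ϖ ∘ (extChartAt (𝓡 N) q).symm)
    (q := extChartAt (𝓡 N) q q) hc₁ hc₂
    ((contDiffAt_comp_extChartAt_symm hf₁).of_le (by norm_num))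
    ((contDiffAt_comp_extChartAt_symm hf₂).of_le (by norm_num))
    (eventually_extChartAt_symm h₁) (eventually_extChartAt_symm h₂)
  rw [← mfderiv_eq_fderiv_extChartAt (hf₁.mdifferentiableAt (by simp)),
    ← mfderiv_eq_fderiv_extChartAt (hf₂.mdifferentiableAt (by simp))] at h
  simp only [Function.comp_apply, extChartAt_to_inv] at h
  exact h

end Lifts

/-! ### Comparison of the two Čech cocycles -/

section Cech

variable {X : Type*} [TopologicalSpace X]

namespace CechH2

/-- Two cocycles with the same class in the direct limit differ by a coboundary on a common
refinement of their covers. -/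
theorem exists_coboundary_of_mk_eq {A : Type*} [AddCommGroup A] {𝒰 𝒱 : PointedCover X}
    {z : 𝒰.Cocycle A} {z' : 𝒱.Cocycle A} (h : mk 𝒰 z = mk 𝒱 z') :
    ∃ (𝒲 : PointedCover X) (h₁ : 𝒰 ≤ 𝒲) (h₂ : 𝒱 ≤ 𝒲) (k : 𝒲.Cochain 1 A),
      𝒲.coboundary 1 A k =
        PointedCover.refine A h₁ 2 z.1 - PointedCover.refine A h₂ 2 z'.1 := by
  classical
  obtain ⟨𝒲₀, a₁, a₂⟩ := exists_ge_ge 𝒰 𝒱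
  unfold mk at h
  rw [← AddCommGroup.DirectLimit.of_f (G := fun 𝒰 : PointedCover X => 𝒰.H2 A)
      (f := PointedCover.refineH2 A) a₁,
    ← AddCommGroup.DirectLimit.of_f (G := fun 𝒰 : PointedCover X => 𝒰.H2 A)
      (f := PointedCover.refineH2 A) a₂] at h
  have h0 : AddCommGroup.DirectLimit.of (fun 𝒰 : PointedCover X => 𝒰.H2 A)
      (PointedCover.refineH2 A) 𝒲₀ (PointedCover.refineH2 A 𝒰 𝒲₀ a₁ (QuotientAddGroup.mk z) -
        PointedCover.refineH2 A 𝒱 𝒲₀ a₂ (QuotientAddGroup.mk z')) = 0 := by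
    rw [sub_eq_add_neg, map_add, h, ← map_add, add_neg_cancel, map_zero]
  obtain ⟨𝒲, b, hb⟩ := AddCommGroup.DirectLimit.of.zero_exact _ _ h0
  rw [map_sub, sub_eq_zero] at hb
  have hb' : (QuotientAddGroup.mk (⟨PointedCover.refine A (a₁.trans b) 2 z.1, by
      rw [AddMonoidHom.mem_ker, PointedCover.coboundary_refine, AddMonoidHom.mem_ker.mp z.2,
        map_zero]⟩ : 𝒲.Cocycle A) : 𝒲.H2 A) =
      QuotientAddGroup.mk (⟨PointedCover.refine A (a₂.trans b) 2 z'.1, by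
      rw [AddMonoidHom.mem_ker, PointedCover.coboundary_refine, AddMonoidHom.mem_ker.mp z'.2,
        map_zero]⟩ : 𝒲.Cocycle A) := hb
  rw [eq_comm, QuotientAddGroup.eq, AddSubgroup.mem_addSubgroupOf] at hb'
  obtain ⟨k, hk⟩ := hb'
  refine ⟨𝒲, a₁.trans b, a₂.trans b, k, ?_⟩
  rw [hk]
  simp [neg_add_eq_sub]

theorem coeff_mk {A B : Type*} [AddCommGroup A] [AddCommGroup B] (f : A →+ B)
    (𝒰 : PointedCover X) (z : 𝒰.Cocycle A) :
    coeff f (mk 𝒰 z) = mk 𝒰 ⟨𝒰.coeff f 2 z.1, by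
      rw [AddMonoidHom.mem_ker, PointedCover.coboundary_coeff, AddMonoidHom.mem_ker.mp z.2,
        map_zero]⟩ := by
  classical
  unfold coeff mk
  rw [AddCommGroup.DirectLimit.map_apply_of]
  rfl

end CechH2

namespace PointedCover

variable {𝒰 : PointedCover X} {A : Type*} [AddCommGroup A]

open Classical in
/-- The values of a Čech `1`-cochain, extended by zero. -/
def Cochain.val (k : 𝒰.Cochain 1 A) (x y p : X) : A :=
  if h : p ∈ 𝒰.inter ![x, y] then k ![x, y] ⟨p, h⟩ else 0

theorem Cochain.apply_eq_val (k : 𝒰.Cochain 1 A) (σ : Fin 2 → X) (p : 𝒰.inter σ) :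
    k σ p = k.val (σ 0) (σ 1) p := by
  have hσ : σ = ![σ 0, σ 1] := by
    ext i
    fin_cases i <;> rfl
  unfold Cochain.val
  generalize σ 0 = x, σ 1 = y at hσ
  subst hσ
  rw [dif_pos p.2]

theorem mem_inter_pair {x y p : X} : p ∈ 𝒰.inter ![x, y] ↔ p ∈ 𝒰.U x ∩ 𝒰.U y := by
  simp [inter, Fin.forall_fin_two]

theorem Cochain.val_eventuallyEq (k : 𝒰.Cochain 1 A) {x y p : X} (hp : p ∈ 𝒰.U x ∩ 𝒰.U y) :
    ∀ᶠ q in 𝓝 p, k.val x y q = k.val x y p := by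
  have hp' := mem_inter_pair.2 hp
  have ho : IsOpen (𝒰.inter ![x, y]) := by
    have : 𝒰.inter ![x, y] = 𝒰.U x ∩ 𝒰.U y := by ext; exact mem_inter_pair
    rw [this]
    exact (𝒰.isOpen x).inter (𝒰.isOpen y)
  have h := (k ![x, y]).isLocallyConstant.eventually_eq ⟨p, hp'⟩
  rw [nhds_subtype_eq_comap, eventually_comap] at h
  filter_upwards [h, ho.mem_nhds hp'] with q hq hq'
  unfold Cochain.val
  rw [dif_pos hq', dif_pos hp']
  exact hq ⟨q, hq'⟩ rfl

theorem coboundary_one_apply (k : 𝒰.Cochain 1 A) (σ : Fin 3 → X) (p : 𝒰.inter σ) :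
    𝒰.coboundary 1 A k σ p
      = k.val (σ 1) (σ 2) p - k.val (σ 0) (σ 2) p + k.val (σ 0) (σ 1) p := by
  rw [coboundary_apply, Fin.sum_univ_three]
  simp only [Cochain.apply_eq_val, Function.comp_apply]
  have h1 : Fin.succAbove (1 : Fin 3) (0 : Fin 2) = 0 := rfl
  have h2 : Fin.succAbove (1 : Fin 3) (1 : Fin 2) = 2 := rfl
  have h3 : Fin.succAbove (2 : Fin 3) (0 : Fin 2) = 0 := rfl
  have h4 : Fin.succAbove (2 : Fin 3) (1 : Fin 2) = 1 := rfl
  have h5 : Fin.succAbove (0 : Fin 3) (0 : Fin 2) = 1 := rfl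
  have h6 : Fin.succAbove (0 : Fin 3) (1 : Fin 2) = 2 := rfl
  simp only [h1, h2, h3, h4, h5, h6, Fin.val_zero, Fin.val_one, Fin.val_two]
  simp [sub_eq_add_neg]

end PointedCover

variable {d : ℕ} {O : OrientedOrbifold X d}

/-- The restriction of an orbifold form to a smaller open subset. -/
def OrbiForm.restrict {U V : Set X} {k : ℕ} (β : OrbiForm O U k) (h : V ⊆ U) : OrbiForm O V k where
  form := β.form
  smooth c hc := (β.smooth c hc).mono fun _ hz => ⟨hz.1, h hz.2⟩
  invariant c hc γ hγ z hz hzV := β.invariant c hc γ hγ z hz (h hzV)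
  agree c hc c' hc' e z hz hzV := β.agree c hc c' hc' e z hz (h hzV)

variable {M : Type*} [TopologicalSpace M] [ChartedSpace (Euc (d + 1)) M] [MulAction Circle M]
  [ContMDiffSMul (𝓡 1) (𝓡 (d + 1)) ∞ Circle M] {o : ManifoldOrientation (d + 1) M}

/-- The data extracted from the equality of the class of `Ω` with the Chern class, on a fine enough
cover: primitives `β x` of `Ω`, smooth functions `h x y` with `β y - β x = d (h x y)`, fibre
coordinates `τ x` of `M / μ` with `τ x / τ y = exp (2πi f x y)`, such that the cocycles of `m h` and
`f` are equal (and not just cohomologous). -/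
structure CechData (S : SeifertBundle O o) (Ω : OrbiForm O univ 2) where
  𝒰 : PointedCover X
  β : ∀ x, OrbiForm O (𝒰.U x) 1
  h : X → X → X → ℝ
  f : X → X → X → ℝ
  τ : X → M → Circle
  extDeriv_β : ∀ x, ∀ c ∈ O.atlas, ∀ p ∈ c.dom, c.toFun p ∈ 𝒰.U x →
    extDeriv ((β x).form c) p = Ω.form c p
  h_smooth : ∀ x y, ∀ c ∈ O.atlas,
    ContDiffOn ℝ ∞ (h x y ∘ c.toFun) (c.dom ∩ c.toFun ⁻¹' (𝒰.U x ∩ 𝒰.U y))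
  h_deriv : ∀ x y, ∀ c ∈ O.atlas, ∀ p ∈ c.dom, c.toFun p ∈ 𝒰.U x ∩ 𝒰.U y → ∀ v : Euc d,
    fderiv ℝ (h x y ∘ c.toFun) p v = (β y).form c p ![v] - (β x).form c p ![v]
  f_cont : ∀ x y, ContinuousOn (f x y) (𝒰.U x ∩ 𝒰.U y)
  τ_cont : ∀ x, ContinuousOn (τ x) (S.π ⁻¹' 𝒰.U x)
  τ_smul : ∀ x q, S.π q ∈ 𝒰.U x → ∀ s : Circle, τ x (s • q) = s ^ O.isotropyLcm * τ x q
  τ_trans : ∀ x y q, S.π q ∈ 𝒰.U x ∩ 𝒰.U y →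
    τ x q = Circle.exp (2 * Real.pi * f x y (S.π q)) * τ y q
  cocycle_eq : ∀ x y z p, p ∈ 𝒰.U x → p ∈ 𝒰.U y → p ∈ 𝒰.U z →
    h y z p - h x z p + h x y p = (O.isotropyLcm : ℝ)⁻¹ * (f y z p - f x z p + f x y p)

theorem OrbifoldChart.tendsto_toFun (c : OrbifoldChart X d) {z : Euc d} (hz : z ∈ c.dom) :
    Tendsto c.toFun (𝓝 z) (𝓝 (c.toFun z)) :=
  c.continuousOn.continuousAt (c.isOpen_dom.mem_nhds hz)

/-- The classes of `Ω` and of the cocycle of `f` are equal, so on a refinement a locally constant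
cochain bounds the difference of their cocycles. Absorbed into `h`, it does not change the
derivative of `h`, and makes the cocycles equal. -/
theorem exists_cechData (S : SeifertBundle O o) (Ω : OrbiForm O univ 2) (a : CechH2 X ℚ)
    (hΩ : Ω.HasClass (CechH2.coeff (Rat.castHom ℝ).toAddMonoidHom a))
    (hc : S.HasChernClass a) : Nonempty (CechData S Ω) := by
  obtain ⟨b, ⟨𝒱, τ, f, ζ', hτ, hf, htr, hζ', rfl⟩, rfl⟩ := hc
  obtain ⟨𝒰, β, h, ζ, hβ, hh, hd, hζ, heq⟩ := hΩ
  simp only [CechH2.coeff_mk] at heq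
  obtain ⟨𝒲, h₁, h₂, k, hk⟩ := CechH2.exists_coboundary_of_mk_eq heq
  have hloc : ∀ x y, ∀ c ∈ O.atlas, ∀ p ∈ c.dom, c.toFun p ∈ 𝒲.U x ∩ 𝒲.U y →
      (fun q => h x y (c.toFun q) - k.val x y (c.toFun q)) =ᶠ[𝓝 p]
        fun q => h x y (c.toFun q) - k.val x y (c.toFun p) := by
    intro x y c _ p hp hpU
    filter_upwards [(c.tendsto_toFun hp).eventually (k.val_eventuallyEq hpU)] with q hq
    rw [hq]
  have hsm : ∀ x y, ∀ c ∈ O.atlas, ∀ p ∈ c.dom, c.toFun p ∈ 𝒲.U x ∩ 𝒲.U y →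
      ContDiffAt ℝ ∞ (h x y ∘ c.toFun) p := by
    intro x y c hc p hp hpU
    refine (hh x y c hc).contDiffAt ?_
    exact inter_mem (c.isOpen_dom.mem_nhds hp) ((c.tendsto_toFun hp).eventually_mem
      (((𝒰.isOpen x).inter (𝒰.isOpen y)).mem_nhds ⟨h₁ x hpU.1, h₁ y hpU.2⟩))
  -- `h - k` has the derivative of `h`, since `k` is locally constant
  refine ⟨⟨𝒲, fun x => (β x).restrict (h₁ x), fun x y p => h x y p - k.val x y p, f,
    fun x q => τ x (Quotient.mk _ q), ?_, ?_, ?_, ?_, ?_, ?_, ?_, ?_⟩⟩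
  · exact fun x c hc p hp hpU => hβ x c hc p hp (h₁ x hpU)
  · intro x y c hc p hp
    refine ContDiffAt.contDiffWithinAt ?_
    refine ContDiffAt.congr_of_eventuallyEq ?_ (hloc x y c hc p hp.1 hp.2)
    exact (hsm x y c hc p hp.1 hp.2).sub contDiffAt_const
  · intro x y c hc p hp hpU v
    rw [show (fun p => h x y p - k.val x y p) ∘ c.toFun
      = fun q => h x y (c.toFun q) - k.val x y (c.toFun q) from rfl,
      (hloc x y c hc p hp hpU).fderiv_eq, fderiv_sub_const]
    exact hd x y c hc p hp ⟨h₁ x hpU.1, h₁ y hpU.2⟩ v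
  · exact fun x y => (hf x y).mono (inter_subset_inter (h₂ x) (h₂ y))
  · intro x
    exact (hτ x).1.comp continuous_quotient_mk'.continuousOn fun q hq => h₂ x hq
  · exact fun x q hq s => (hτ x).2 q (h₂ x hq) s
  · exact fun x y q hq => htr x y (Quotient.mk _ q) ⟨h₂ x hq.1, h₂ y hq.2⟩
  · intro x y z p hx hy hz
    have hp : p ∈ 𝒲.inter ![x, y, z] := by
      intro i
      fin_cases i <;> assumption
    have e1 := congrArg (fun g : 𝒲.Cochain 2 ℝ => g ![x, y, z] ⟨p, hp⟩) hk
    have e2 := hζ ![x, y, z] ⟨p, fun i => h₁ _ (hp i)⟩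
    have e3 := hζ' ![x, y, z] ⟨p, fun i => h₂ _ (hp i)⟩
    simp only [PointedCover.coboundary_one_apply] at e1
    change _ = ζ.1 ![x, y, z] ⟨p, fun i => h₁ _ (hp i)⟩ -
      ((((O.isotropyLcm : ℚ)⁻¹ * ((ζ'.1 ![x, y, z] ⟨p, fun i => h₂ _ (hp i)⟩ : ℤ) : ℚ) : ℚ) : ℝ))
      at e1
    push_cast at e1
    rw [e2, e3] at e1
    simp at e1
    linarith

end Cech

/-! ### Circle-valued functions -/

section CircleValued

variable {N : ℕ} {M : Type*} [TopologicalSpace M] [ChartedSpace (Euc N) M]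

attribute [local instance] finrank_real_complex_fact' in
theorem contMDiffAt_circle_arg {u : Circle} (hu : (u : ℂ) ∈ Complex.slitPlane) :
    ContMDiffAt (𝓡 1) 𝓘(ℝ, ℝ) ∞ (fun v : Circle => Complex.arg v) u := by
  have h1 : ContMDiff (𝓡 1) 𝓘(ℝ, ℂ) ∞ (fun v : Circle => (v : ℂ)) := contMDiff_coe_sphere
  have h2 : ContDiffAt ℝ ∞ (fun w : ℂ => (Complex.log w).im) (u : ℂ) :=
    Complex.imCLM.contDiff.contDiffAt.comp _
      ((Complex.contDiffAt_log (n := ∞) hu).restrict_scalars ℝ)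
  have h3 := h2.contMDiffAt.comp u (h1 u)
  simp only [Complex.log_im] at h3
  exact h3

/-- A continuous function with `exp (i k G) = P` is locally `G q + arg (P / P q) / k`. -/
theorem eventually_eq_arg_of_exp_eq {α : Type*} [TopologicalSpace α] {k : ℝ} (hk : k ≠ 0)
    {G : α → ℝ} {P : α → Circle} {q : α} (hG : ContinuousAt G q)
    (h : ∀ᶠ p in 𝓝 q, Circle.exp (k * G p) = P p) :
    ∀ᶠ p in 𝓝 q, G p = G q + k⁻¹ * Complex.arg ((P p / P q : Circle) : ℂ) := by
  have h1 : Tendsto (fun p => k * (G p - G q)) (𝓝 q) (𝓝 0) := by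
    have : Tendsto (fun p => k * (G p - G q)) (𝓝 q) (𝓝 (k * (G q - G q))) :=
      ((hG.tendsto.sub_const _).const_mul _)
    simpa using this
  have hq := h.self_of_nhds
  filter_upwards [h, h1.eventually_mem (Ioo_mem_nhds (neg_lt_zero.2 Real.pi_pos) Real.pi_pos)]
    with p hp hp'
  rw [← hp, ← hq, ← Circle.exp_sub, ← mul_sub, Circle.arg_exp hp'.1 hp'.2.le]
  field_simp
  ring

/-- A continuous logarithm of a smooth circle-valued function is smooth. -/
theorem contMDiffAt_of_circle_exp_eq {k : ℝ} (hk : k ≠ 0) {G : M → ℝ} {P : M → Circle} {q : M}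
    (hG : ContinuousAt G q) (hP : ContMDiffAt (𝓡 N) (𝓡 1) ∞ P q)
    (h : ∀ᶠ p in 𝓝 q, Circle.exp (k * G p) = P p) : ContMDiffAt (𝓡 N) 𝓘(ℝ, ℝ) ∞ G q := by
  have h1 : ContMDiffAt (𝓡 N) (𝓡 1) ∞ (fun p => P p / P q) q :=
    ContMDiffAt.div hP contMDiffAt_const
  have h2 : ContMDiffAt (𝓡 N) 𝓘(ℝ, ℝ) ∞ (fun p => Complex.arg ((P p / P q : Circle) : ℂ)) q :=
    ContMDiffAt.comp q (contMDiffAt_circle_arg (by simp)) h1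
  have h3 : ContDiff ℝ ∞ (fun t : ℝ => G q + k⁻¹ * t) :=
    contDiff_const.add (contDiff_const.mul contDiff_id)
  exact (h3.contMDiff.contMDiffAt.comp q h2).congr_of_eventuallyEq
    (eventually_eq_arg_of_exp_eq hk hG h)

/-- A continuous function `G` with `exp (i k G)` locally constant is locally constant. -/
theorem eventually_const_of_circle_exp_eq {α : Type*} [TopologicalSpace α] {k : ℝ} (hk : k ≠ 0)
    {G : α → ℝ} {q : α} (hG : ContinuousAt G q)
    (h : ∀ᶠ p in 𝓝 q, Circle.exp (k * G p) = Circle.exp (k * G q)) : ∀ᶠ p in 𝓝 q, G p = G q := by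
  filter_upwards [eventually_eq_arg_of_exp_eq hk hG h] with p hp
  simpa using hp

/-- Smoothness can be tested after composition with a local diffeomorphism. -/
theorem contMDiffAt_of_comp_isLocalDiffeomorphAt
    {E₁ H₁ M₁ E₂ H₂ M₂ E₃ H₃ M₃ : Type*}
    [NormedAddCommGroup E₁] [NormedSpace ℝ E₁] [TopologicalSpace H₁] {I₁ : ModelWithCorners ℝ E₁ H₁}
    [TopologicalSpace M₁] [ChartedSpace H₁ M₁]
    [NormedAddCommGroup E₂] [NormedSpace ℝ E₂] [TopologicalSpace H₂] {I₂ : ModelWithCorners ℝ E₂ H₂}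
    [TopologicalSpace M₂] [ChartedSpace H₂ M₂]
    [NormedAddCommGroup E₃] [NormedSpace ℝ E₃] [TopologicalSpace H₃] {I₃ : ModelWithCorners ℝ E₃ H₃}
    [TopologicalSpace M₃] [ChartedSpace H₃ M₃] {k : WithTop ℕ∞} {f : M₁ → M₂} {x : M₁}
    (hf : IsLocalDiffeomorphAt I₁ I₂ k f x) {F : M₂ → M₃} (h : ContMDiffAt I₁ I₃ k (F ∘ f) x) :
    ContMDiffAt I₂ I₃ k F (f x) := by
  have hx : hf.localInverse (f x) = x := hf.localInverse_left_inv hf.localInverse_mem_target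
  have h1 : ContMDiffAt I₂ I₃ k ((F ∘ f) ∘ hf.localInverse) (f x) :=
    ContMDiffAt.comp (f x) (by rwa [hx]) hf.localInverse_contMDiffAt
  refine h1.congr_of_eventuallyEq ?_
  filter_upwards [hf.localInverse_eventuallyEq_right] with y hy
  simp only [Function.comp_apply, id] at hy ⊢
  rw [hy]

end CircleValued

/-! ### Smooth partitions of unity on an orbifold -/

section Bump

universe u

variable {X : Type u} [TopologicalSpace X] {d : ℕ}

namespace OrbifoldChart

variable (c : OrbifoldChart X d)

theorem toFun_group {γ : Euc d ≃L[ℝ] Euc d} (hγ : γ ∈ c.group) {z : Euc d} (hz : z ∈ c.dom) :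
    c.toFun (γ z) = c.toFun z :=
  ((c.eq_iff z hz _ (c.group_dom γ hγ z hz)).2 ⟨γ, hγ, rfl⟩).symm

theorem isOpen_dom_inter {s : Set X} (hs : IsOpen s) : IsOpen (c.dom ∩ c.toFun ⁻¹' s) :=
  c.continuousOn.isOpen_inter_preimage c.isOpen_dom hs

open Classical in
/-- The function on `X` induced by an invariant function on the chart, extended by zero. -/
def descend {E : Type*} [Zero E] (ψ : Euc d → E) (y : X) : E :=
  if h : y ∈ c.toFun '' c.dom then ψ h.choose else 0

theorem descend_apply {E : Type*} [Zero E] {ψ : Euc d → E} (hψ : ∀ γ ∈ c.group, ∀ z, ψ (γ z) = ψ z)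
    {z : Euc d} (hz : z ∈ c.dom) : c.descend ψ (c.toFun z) = ψ z := by
  have h : c.toFun z ∈ c.toFun '' c.dom := ⟨z, hz, rfl⟩
  unfold descend
  rw [dif_pos h]
  obtain ⟨γ, hγ, hγz⟩ := (c.eq_iff z hz _ h.choose_spec.1).1 h.choose_spec.2.symm
  rw [← hγz, hψ γ hγ]

end OrbifoldChart

variable {O : OrientedOrbifold X d}
  {M : Type*} [TopologicalSpace M] [ChartedSpace (Euc (d + 1)) M] [MulAction Circle M]
  [ContMDiffSMul (𝓡 1) (𝓡 (d + 1)) ∞ Circle M] {o : ManifoldOrientation (d + 1) M}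

/-- Every neighbourhood of a point `x` of the base of a Seifert bundle contains a compact
neighbourhood `C` of `x` and the support of a smooth bump function, which is nonzero near `x` and
vanishes outside of `C`. Smoothness on the base is smoothness of the composite with `π`. -/
theorem SeifertBundle.exists_bump [T2Space X] (S : SeifertBundle O o) {x : X} {A : Set X}
    (hA : A ∈ 𝓝 x) : ∃ (l : X → ℝ) (C : Set X), IsCompact C ∧ C ⊆ A ∧ C ∈ 𝓝 x ∧
      ContMDiff (𝓡 (d + 1)) 𝓘(ℝ, ℝ) ∞ (l ∘ S.π) ∧ (∀ y, 0 ≤ l y) ∧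
      (∀ y, y ∉ C → l y = 0) ∧ Function.support l ∈ 𝓝 x := by
  obtain ⟨c, -, h0, rfl, ⟨m⟩⟩ := S.model x
  have := c.finite_group
  have : Fintype c.group := Fintype.ofFinite _
  obtain ⟨B, hBA, hB, hxB⟩ := mem_nhds_iff.1 hA
  have hopen := c.isOpen_dom_inter hB
  obtain ⟨r, hr, hrsub⟩ := Metric.nhds_basis_closedBall.mem_iff.1 (hopen.mem_nhds ⟨h0, hxB⟩)
  let b : ContDiffBump (0 : Euc d) := ⟨r / 2, r, by positivity, by linarith⟩
  -- a bump function on the chart is made invariant by summing over the group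
  let ψ : Euc d → ℝ := fun z => ∑ γ : c.group, b (γ.1 z)
  have hψinv : ∀ γ ∈ c.group, ∀ z, ψ (γ z) = ψ z := by
    intro γ hγ z
    exact Fintype.sum_equiv (Equiv.mulRight (⟨γ, hγ⟩ : c.group)) _ _ fun _ => rfl
  have hψ0 : ∀ z, 0 ≤ ψ z := fun z => Finset.sum_nonneg fun γ _ => b.nonneg
  have hψs : ContDiff ℝ ∞ ψ :=
    ContDiff.sum fun γ _ => b.contDiff.comp γ.1.contDiff
  have hle : ∀ z, b z ≤ ψ z := fun z =>
    Finset.single_le_sum (f := fun γ : c.group => b (γ.1 z)) (fun γ _ => b.nonneg)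
      (Finset.mem_univ (1 : c.group))
  set C : Set X := c.toFun '' Metric.closedBall 0 r with hC
  have hCc : IsCompact C := (isCompact_closedBall _ _).image_of_continuousOn
    (c.continuousOn.mono fun z hz => (hrsub hz).1)
  have hzero : ∀ y, y ∉ C → c.descend ψ y = 0 := by
    intro y hy
    by_cases hyt : y ∈ c.toFun '' c.dom
    · obtain ⟨z, hz, rfl⟩ := hyt
      rw [c.descend_apply hψinv hz]
      refine Finset.sum_eq_zero fun γ _ => ?_
      by_contra hne
      have h1 : γ.1 z ∈ Function.support b := hne
      rw [b.support_eq] at h1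
      exact hy ⟨γ.1 z, Metric.ball_subset_closedBall h1, c.toFun_group γ.2 hz⟩
    · unfold OrbifoldChart.descend
      rw [dif_neg hyt]
  have hball : c.toFun '' Metric.ball 0 r ∈ 𝓝 (c.toFun 0) :=
    (c.isOpen_image _ (fun z hz => (hrsub (Metric.ball_subset_closedBall hz)).1)
      Metric.isOpen_ball).mem_nhds ⟨0, Metric.mem_ball_self hr, rfl⟩
  refine ⟨c.descend ψ, C, hCc, ?_, mem_of_superset hball (image_mono Metric.ball_subset_closedBall),
    ?_, ?_, hzero, ?_⟩
  · rintro _ ⟨z, hz, rfl⟩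
    exact hBA (hrsub hz).2
  · intro q
    by_cases hq : S.π q ∈ c.target
    · have hq' : q ∈ S.π ⁻¹' c.target := hq
      rw [← m.image] at hq'
      obtain ⟨⟨u, z⟩, ⟨-, hz⟩, rfl⟩ := hq'
      refine contMDiffAt_of_comp_isLocalDiffeomorphAt (m.localDiffeo ⟨(u, z), mem_univ _, hz⟩) ?_
      have h1 : ContMDiff ((𝓡 1).prod (𝓡 d)) 𝓘(ℝ, ℝ) ∞ (fun w : Circle × Euc d => ψ w.2) :=
        hψs.contMDiff.comp contMDiff_snd
      refine (h1 (u, z)).congr_of_eventuallyEq ?_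
      have h2 : ∀ᶠ w : Circle × Euc d in 𝓝 (u, z), w.2 ∈ c.dom :=
        continuous_snd.continuousAt.eventually_mem (c.isOpen_dom.mem_nhds hz)
      filter_upwards [h2] with w hw
      simp only [Function.comp_apply]
      rw [m.proj w.1 w.2 hw, c.descend_apply hψinv hw]
    · have h1 : ∀ᶠ p in 𝓝 q, c.descend ψ (S.π p) = 0 := by
        have h2 : S.π q ∈ Cᶜ := by
          rintro ⟨z, hz, hzq⟩
          exact hq ⟨z, (hrsub hz).1, hzq⟩
        filter_upwards [S.continuous_π.continuousAt.eventually_mem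
          (hCc.isClosed.isOpen_compl.mem_nhds h2)] with p hp using hzero _ hp
      exact contMDiffAt_const.congr_of_eventuallyEq h1
  · intro y
    by_cases hyt : y ∈ c.toFun '' c.dom
    · obtain ⟨z, hz, rfl⟩ := hyt
      rw [c.descend_apply hψinv hz]
      exact hψ0 z
    · unfold OrbifoldChart.descend
      rw [dif_neg hyt]
  · refine mem_of_superset hball ?_
    rintro _ ⟨z, hz, rfl⟩
    rw [Function.mem_support, c.descend_apply hψinv (hrsub (Metric.ball_subset_closedBall hz)).1]
    have h1 : z ∈ Function.support b := by rw [b.support_eq]; exact hz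
    exact (lt_of_lt_of_le (lt_of_le_of_ne b.nonneg (Ne.symm h1)) (hle z)).ne'

/-- Smooth partitions of unity on the base of a Seifert bundle, subordinate to a given family of
neighbourhoods. -/
theorem SeifertBundle.exists_partition [T2Space X] [SecondCountableTopology X]
    (S : SeifertBundle O o) (V : X → Set X) (hV : ∀ x, V x ∈ 𝓝 x) :
    ∃ (ι : Type u) (x : ι → X) (l : ι → X → ℝ),
      (∀ j, ContMDiff (𝓡 (d + 1)) 𝓘(ℝ, ℝ) ∞ (l j ∘ S.π)) ∧
      (∀ j, tsupport (l j) ⊆ V (x j)) ∧ LocallyFinite (fun j => Function.support (l j)) ∧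
      ∀ q, ∑ᶠ j, l j (S.π q) = 1 := by
  have : WeaklyLocallyCompactSpace X := ⟨fun x => by
    obtain ⟨-, C, hC, -, hCx, -⟩ := S.exists_bump (x := x) univ_mem
    exact ⟨C, hC, hCx⟩⟩
  let p : X → (X → ℝ) → Prop := fun x l =>
    ContMDiff (𝓡 (d + 1)) 𝓘(ℝ, ℝ) ∞ (l ∘ S.π) ∧ (∀ y, 0 ≤ l y) ∧ tsupport l ⊆ V x ∧
      Function.support l ∈ 𝓝 x
  have hB : ∀ x, (𝓝 x).HasBasis (p x) Function.support := by
    intro x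
    refine ⟨fun t => ⟨fun ht => ?_, fun ⟨l, hl, hlt⟩ => mem_of_superset hl.2.2.2 hlt⟩⟩
    obtain ⟨l, C, hC, hCA, -, h1, h2, h3, h4⟩ := S.exists_bump (inter_mem ht (hV x))
    have h5 : Function.support l ⊆ C := fun y hy => by
      by_contra h
      exact hy (h3 y h)
    exact ⟨l, ⟨h1, h2, (closure_minimal h5 hC.isClosed).trans (hCA.trans inter_subset_right), h4⟩,
      h5.trans (hCA.trans inter_subset_left)⟩
  obtain ⟨ι, x, l, hp, hun, hlf⟩ := refinement_of_locallyCompact_sigmaCompact_of_nhds_basis hB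
  have hlfM : LocallyFinite (fun j => Function.support (l j ∘ S.π)) :=
    hlf.preimage_continuous S.continuous_π
  have hfin : ∀ y, (Function.support fun j => l j y).Finite := fun y => hlf.point_finite y
  have hpos : ∀ y, 0 < ∑ᶠ j, l j y := by
    intro y
    obtain ⟨j, hj⟩ := mem_iUnion.1 (hun.symm ▸ mem_univ y : y ∈ ⋃ j, Function.support (l j))
    rw [finsum_eq_sum _ (hfin y)]
    exact Finset.sum_pos' (fun i _ => (hp i).2.1 y) ⟨j, by simpa using hj,
      lt_of_le_of_ne ((hp j).2.1 y) (Ne.symm hj)⟩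
  have hsum : ContMDiff (𝓡 (d + 1)) 𝓘(ℝ, ℝ) ∞ (fun q => ∑ᶠ j, l j (S.π q)) :=
    contMDiff_finsum (fun j => (hp j).1) hlfM
  have hsup : ∀ j, Function.support (fun y => l j y / ∑ᶠ i, l i y) ⊆ Function.support (l j) := by
    intro j y hy hy'
    exact hy (by simp [hy'])
  refine ⟨ι, x, fun j y => l j y / ∑ᶠ i, l i y, fun j => ?_, fun j => ?_, ?_, fun q => ?_⟩
  · exact fun q => ((hp j).1 q).div₀ (hsum q) (hpos _).ne'
  · exact (closure_mono (hsup j)).trans (hp j).2.2.1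
  · exact hlf.subset hsup
  · simp only [div_eq_mul_inv]
    rw [← finsum_mul, mul_inv_cancel₀ (hpos _).ne']

end Bump

/-! ### Smooth fibre coordinates with prescribed transition functions -/

section FibreCoordinates

section Derivative

variable {N : ℕ} {M : Type*} [TopologicalSpace M] [ChartedSpace (Euc N) M] {F F' : Type*}
  [NormedAddCommGroup F] [NormedSpace ℝ F] [NormedAddCommGroup F'] [NormedSpace ℝ F']
  {f g : M → F} {q : M}

theorem mvfderiv_congr (h : f =ᶠ[𝓝 q] g) : mvfderiv (𝓡 N) f q = mvfderiv (𝓡 N) g q :=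
  h.mfderiv_eq

theorem mvfderiv_comp_of_differentiableAt {φ : F → F'} (hφ : DifferentiableAt ℝ φ (f q))
    (hf : MDifferentiableAt (𝓡 N) 𝓘(ℝ, F) f q) :
    mvfderiv (𝓡 N) (φ ∘ f) q = (fderiv ℝ φ (f q)).comp (mvfderiv (𝓡 N) f q) := by
  have h := mfderiv_comp q hφ.mdifferentiableAt hf
  rw [mfderiv_eq_fderiv] at h
  exact h

end Derivative

variable {X : Type*} [TopologicalSpace X] {d : ℕ} {O : OrientedOrbifold X d}
  {M : Type*} [TopologicalSpace M] [ChartedSpace (Euc (d + 1)) M]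

/-- A smooth lift `f` of `π : M → X` to the orbifold chart `c` of the atlas, near the point `q`. -/
structure IsLiftAt (O : OrientedOrbifold X d) (π : M → X) (c : OrbifoldChart X d) (f : M → Euc d)
    (q : M) : Prop where
  mem_atlas : c ∈ O.atlas
  smooth : ContMDiffAt (𝓡 (d + 1)) (𝓡 d) ∞ f q
  lift : ∀ᶠ p in 𝓝 q, f p ∈ c.dom ∧ c.toFun (f p) = π p

namespace IsLiftAt

variable {π : M → X} {c c' : OrbifoldChart X d} {f f' : M → Euc d} {q : M}

theorem mem_dom (hf : IsLiftAt O π c f q) : f q ∈ c.dom := hf.lift.self_of_nhds.1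

theorem toFun_eq (hf : IsLiftAt O π c f q) : c.toFun (f q) = π q := hf.lift.self_of_nhds.2

theorem mdifferentiableAt (hf : IsLiftAt O π c f q) : MDifferentiableAt (𝓡 (d + 1)) (𝓡 d) f q :=
  hf.smooth.mdifferentiableAt (by simp)

/-- Any two smooth lifts of `π` at `q` have related derivatives, so that orbifold tensors pull back
to the same tensors of `M` under both. -/
theorem liftRel (hf : IsLiftAt O π c f q) (hf' : IsLiftAt O π c' f' q) :
    LiftRel O (V := TangentSpace (𝓡 (d + 1)) q) (π q) c (f q) (mvfderiv (𝓡 (d + 1)) f q)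
      c' (f' q) (mvfderiv (𝓡 (d + 1)) f' q) :=
  liftRel_of_manifold_lifts O hf.mem_atlas hf'.mem_atlas hf.smooth hf'.smooth hf.lift hf'.lift

/-- A smooth function on an open subset `U` of the orbifold pulls back to a smooth function. -/
theorem smooth_pullback (hf : IsLiftAt O π c f q) {h : X → ℝ} {U : Set X} (hU : IsOpen U)
    (hh : ContDiffOn ℝ ∞ (h ∘ c.toFun) (c.dom ∩ c.toFun ⁻¹' U)) (hq : π q ∈ U) :
    ContMDiffAt (𝓡 (d + 1)) 𝓘(ℝ, ℝ) ∞ (fun p => h (π p)) q ∧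
    ∀ v : TangentSpace (𝓡 (d + 1)) q, mvfderiv (𝓡 (d + 1)) (fun p => h (π p)) q v
      = fderiv ℝ (h ∘ c.toFun) (f q) (mvfderiv (𝓡 (d + 1)) f q v) := by
  have h1 : ContDiffAt ℝ ∞ (h ∘ c.toFun) (f q) :=
    hh.contDiffAt ((c.isOpen_dom_inter hU).mem_nhds
      ⟨hf.mem_dom, by rw [mem_preimage, hf.toFun_eq]; exact hq⟩)
  have h2 : ContMDiffAt (𝓡 (d + 1)) 𝓘(ℝ, ℝ) ∞ ((h ∘ c.toFun) ∘ f) q :=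
    h1.contMDiffAt.comp q hf.smooth
  have h3 : (fun p => h (π p)) =ᶠ[𝓝 q] (h ∘ c.toFun) ∘ f := by
    filter_upwards [hf.lift] with p hp
    simp only [Function.comp_apply, hp.2]
  refine ⟨h2.congr_of_eventuallyEq h3, fun v => ?_⟩
  rw [mvfderiv_congr h3, mvfderiv_comp_of_differentiableAt (h1.differentiableAt (by simp))
    hf.mdifferentiableAt]
  rfl

end IsLiftAt

variable [MulAction Circle M] {o : ManifoldOrientation (d + 1) M}

/-- A smooth local inverse of the parametrisation of a Seifert bundle. -/
theorem SeifertModel.exists_localInverse {π : M → X} {c : OrbifoldChart X d}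
    (m : SeifertModel o π c) (u : Circle) {z : Euc d} (hz : z ∈ c.dom) :
    ∃ g : M → Circle × Euc d,
      (∀ᶠ q in 𝓝 (m.Ψ (u, z)), ContMDiffAt (𝓡 (d + 1)) ((𝓡 1).prod (𝓡 d)) ∞ g q) ∧
      (∀ᶠ q in 𝓝 (m.Ψ (u, z)), (g q).2 ∈ c.dom ∧ m.Ψ (g q) = q) ∧
      ∀ᶠ w in 𝓝 (u, z), g (m.Ψ w) = w := by
  have hloc := m.localDiffeo ⟨(u, z), mem_univ _, hz⟩
  have hs := hloc.localInverse.open_source.mem_nhds hloc.localInverse_mem_source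
  refine ⟨hloc.localInverse, ?_, ?_, ?_⟩
  · filter_upwards [hloc.localInverse.open_source.eventually_mem hloc.localInverse_mem_source]
      with q hq
    exact hloc.localInverse_contMDiffOn.contMDiffAt (hloc.localInverse.open_source.mem_nhds hq)
  · have h1 : ContinuousAt hloc.localInverse (m.Ψ (u, z)) :=
      hloc.localInverse_contMDiffAt.continuousAt
    have h2 : ContinuousAt (fun q => (hloc.localInverse q).2) (m.Ψ (u, z)) :=
      continuous_snd.continuousAt.comp h1
    have h3 : (hloc.localInverse (m.Ψ (u, z))).2 = z := by
      rw [hloc.localInverse_left_inv hloc.localInverse_mem_target]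
    filter_upwards [h2.eventually_mem (by rw [h3]; exact c.isOpen_dom.mem_nhds hz),
      hloc.localInverse_eventuallyEq_right] with q h4 h5
    exact ⟨h4, h5⟩
  · exact hloc.localInverse_eventuallyEq_left

/-- A model over a chart `c`, which need not be in the atlas, gives lifts to the chart of the atlas
into which `c` embeds. -/
theorem ChartEmbedding.isLiftAt {π : M → X} {c c' : OrbifoldChart X d} (hc' : c' ∈ O.atlas)
    (m : SeifertModel o π c) (e : ChartEmbedding c c') {g : M → Circle × Euc d} {q : M}
    (hg : ContMDiffAt (𝓡 (d + 1)) ((𝓡 1).prod (𝓡 d)) ∞ g q)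
    (hgq : ∀ᶠ p in 𝓝 q, (g p).2 ∈ c.dom ∧ m.Ψ (g p) = p) :
    IsLiftAt O π c' (fun p => e.toFun (g p).2) q := by
  refine ⟨hc', ?_, ?_⟩
  · have h1 : ContDiffAt ℝ ∞ e.toFun (g q).2 :=
      e.contDiffOn.contDiffAt (c.isOpen_dom.mem_nhds hgq.self_of_nhds.1)
    exact h1.contMDiffAt.comp q (contMDiffAt_snd.comp q hg)
  · filter_upwards [hgq] with p hp
    refine ⟨e.mapsTo hp.1, ?_⟩
    rw [e.comm _ hp.1, ← m.proj (g p).1 _ hp.1]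
    exact congrArg π hp.2

variable [ContMDiffSMul (𝓡 1) (𝓡 (d + 1)) ∞ Circle M]

theorem SeifertBundle.exists_isLiftAt (S : SeifertBundle O o) (q : M) :
    ∃ c f, IsLiftAt O S.π c f q := by
  obtain ⟨c, ⟨c', hc', ⟨e⟩⟩, h0, hx, ⟨m⟩⟩ := S.model (S.π q)
  have hq : q ∈ S.π ⁻¹' c.target := ⟨0, h0, hx⟩
  rw [← m.image] at hq
  obtain ⟨⟨u, z⟩, ⟨-, hz⟩, rfl⟩ := hq
  obtain ⟨g, hg, hgq, -⟩ := m.exists_localInverse u hz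
  exact ⟨c', _, e.isLiftAt hc' m hg.self_of_nhds hgq⟩

omit [ContMDiffSMul (𝓡 1) (𝓡 (d + 1)) ∞ Circle M] in
theorem SeifertModel.smul_eq {π : M → X} {c : OrbifoldChart X d}
    (m : SeifertModel o π c) (u : Circle) {z : Euc d} (hz : z ∈ c.dom) :
    m.Ψ (u, z) = u • m.Ψ (1, z) := by
  rw [← m.equivariant u 1 z hz, mul_one]

theorem OrientedOrbifold.isotropyLcm_pos (hfin : ∃ N : ℕ, 0 < N ∧ O.IsIsotropyMultiple N) :
    0 < O.isotropyLcm :=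
  (Nat.sInf_mem (s := {N : ℕ | 0 < N ∧ O.IsIsotropyMultiple N}) hfin).1

/-- The group of a chart centred at a point is an isotropy group, so that its exponent divides the
least common multiple of the orders of these groups. -/
theorem OrientedOrbifold.pow_isotropyLcm (hfin : ∃ N : ℕ, 0 < N ∧ O.IsIsotropyMultiple N)
    {c : OrbifoldChart X d} (hc : O.IsChart c) (h0 : (0 : Euc d) ∈ c.dom) (γ : c.group) :
    γ ^ O.isotropyLcm = 1 := by
  obtain ⟨c', hc', ⟨e⟩⟩ := hc
  have hdvd : Nat.card (c'.isotropy (e.toFun 0)) ∣ O.isotropyLcm :=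
    (Nat.sInf_mem (s := {N : ℕ | 0 < N ∧ O.IsIsotropyMultiple N}) hfin).2 c' hc' _ (e.mapsTo h0)
  have hmem : (e.hom γ).1 ∈ c'.isotropy (e.toFun 0) := by
    refine ⟨(e.hom γ).2, ?_⟩
    rw [← e.equivariant γ 0 h0, map_zero]
  have h1 : (⟨(e.hom γ).1, hmem⟩ : c'.isotropy (e.toFun 0)) ^ O.isotropyLcm = 1 := by
    obtain ⟨k, hk⟩ := hdvd
    rw [hk, pow_mul, pow_card_eq_one', one_pow]
  have h2 : (e.hom γ) ^ O.isotropyLcm = 1 := by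
    have h3 := congrArg Subtype.val h1
    exact Subtype.ext h3
  rw [← map_pow] at h2
  exact e.hom_injective (h2.trans (map_one _).symm)

/-- Near each point of the base, `u ^ m(X)` is a smooth fibre coordinate on the model
`(S¹ × Ũ) / Γ`, and it differs from a given continuous fibre coordinate `τ` by the exponential of a
continuous function on the base. -/
theorem SeifertBundle.exists_smooth_fibre_coordinate (S : SeifertBundle O o)
    (hfin : ∃ N : ℕ, 0 < N ∧ O.IsIsotropyMultiple N) {x : X} {U : Set X} (hU : IsOpen U)
    (hx : x ∈ U) {τ : M → Circle} (hτ : ContinuousOn τ (S.π ⁻¹' U))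
    (hτs : ∀ q, S.π q ∈ U → ∀ s : Circle, τ (s • q) = s ^ O.isotropyLcm * τ q) :
    ∃ (V : Set X) (T : M → Circle) (r : M → ℝ), IsOpen V ∧ x ∈ V ∧ V ⊆ U ∧
      (∀ q, S.π q ∈ V → ContMDiffAt (𝓡 (d + 1)) (𝓡 1) ∞ T q) ∧
      (∀ q, S.π q ∈ V → ∀ s : Circle, T (s • q) = s ^ O.isotropyLcm * T q) ∧
      (∀ q, S.π q ∈ V → ContinuousAt r q) ∧
      (∀ q, S.π q ∈ V → ∀ s : Circle, r (s • q) = r q) ∧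
      ∀ q, S.π q ∈ V → T q = Circle.exp (2 * Real.pi * O.isotropyLcm * r q) * τ q := by
  classical
  set k := O.isotropyLcm with hk
  have hkpos : 0 < k := O.isotropyLcm_pos hfin
  obtain ⟨c, hc, h0, rfl, ⟨m⟩⟩ := S.model x
  -- `u ^ k` is well defined on the model, as `χ γ ^ k = χ (γ ^ k) = 1`
  have hT : ∃ T : M → Circle, ∀ u z, z ∈ c.dom → T (m.Ψ (u, z)) = u ^ k := by
    refine ⟨fun q => if h : ∃ w : Circle × Euc d, w.2 ∈ c.dom ∧ m.Ψ w = q then h.choose.1 ^ k else 1,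
      fun u z hz => ?_⟩
    have h : ∃ w : Circle × Euc d, w.2 ∈ c.dom ∧ m.Ψ w = m.Ψ (u, z) := ⟨(u, z), hz, rfl⟩
    simp only [dif_pos h]
    obtain ⟨γ, hγ, -⟩ := (m.eq_iff h.choose.1 u h.choose.2 h.choose_spec.1 z hz).1
      h.choose_spec.2
    have h2 : u ^ k = (m.χ γ * h.choose.1) ^ k := congrArg (· ^ k) hγ
    rw [h2, mul_pow, ← map_pow, O.pow_isotropyLcm hfin hc h0, map_one, one_mul]
  obtain ⟨T, hT⟩ := hT
  have hrep : ∀ q, S.π q ∈ c.target → ∃ u z, z ∈ c.dom ∧ c.toFun z = S.π q ∧ q = m.Ψ (u, z) := by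
    intro q hq
    have hq' : q ∈ S.π ⁻¹' c.target := hq
    rw [← m.image] at hq'
    obtain ⟨⟨u, z⟩, ⟨-, hz⟩, rfl⟩ := hq'
    exact ⟨u, z, hz, (m.proj u z hz).symm, rfl⟩
  have hTs : ∀ q, S.π q ∈ c.target → ContMDiffAt (𝓡 (d + 1)) (𝓡 1) ∞ T q := by
    intro q hq
    obtain ⟨u, z, hz, -, rfl⟩ := hrep q hq
    refine contMDiffAt_of_comp_isLocalDiffeomorphAt (m.localDiffeo ⟨(u, z), mem_univ _, hz⟩) ?_
    have h1 : ContMDiff ((𝓡 1).prod (𝓡 d)) (𝓡 1) ∞ (fun w : Circle × Euc d => w.1 ^ k) :=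
      contMDiff_fst.pow k
    refine (h1 (u, z)).congr_of_eventuallyEq ?_
    have h2 : ∀ᶠ w : Circle × Euc d in 𝓝 (u, z), w.2 ∈ c.dom :=
      continuous_snd.continuousAt.eventually_mem (c.isOpen_dom.mem_nhds hz)
    filter_upwards [h2] with w hw using hT w.1 w.2 hw
  have hTe : ∀ q, S.π q ∈ c.target → ∀ s : Circle, T (s • q) = s ^ k * T q := by
    intro q hq s
    obtain ⟨u, z, hz, -, rfl⟩ := hrep q hq
    rw [← m.equivariant s u z hz, hT _ _ hz, hT _ _ hz, mul_pow]
  -- the quotient of the two coordinates is a function on the base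
  let D : M → Circle := fun q => T q / τ q
  have hDs : ∀ q, S.π q ∈ c.target → S.π q ∈ U → ∀ s : Circle, D (s • q) = D q := by
    intro q hq hqU s
    simp only [D]
    rw [hTe q hq, hτs q hqU, mul_div_mul_left_eq_div]
  have hDc : ∀ q, S.π q ∈ c.target → S.π q ∈ U → ContinuousAt D q := by
    intro q hq hqU
    exact (hTs q hq).continuousAt.div' (hτ.continuousAt ((hU.preimage S.continuous_π).mem_nhds hqU))
  set D₀ : Circle := D (m.Ψ (1, 0)) with hD₀
  -- on the image of `A` this quotient has a logarithm
  let A : Set (Euc d) := {z | z ∈ c.dom ∩ c.toFun ⁻¹' U ∧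
    ((D (m.Ψ (1, z)) / D₀ : Circle) : ℂ) ∈ Complex.slitPlane}
  have hproj : ∀ z ∈ c.dom, S.π (m.Ψ (1, z)) = c.toFun z := fun z hz => m.proj 1 z hz
  have hA : IsOpen A := by
    refine isOpen_iff_mem_nhds.2 fun z hz => ?_
    have hz1 : z ∈ c.dom := hz.1.1
    have h1 : ContinuousAt (fun z => m.Ψ (1, z)) z :=
      ContinuousAt.comp (f := fun z : Euc d => ((1 : Circle), z)) (g := m.Ψ)
        (m.localDiffeo ⟨(1, z), mem_univ _, hz1⟩).contMDiffAt.continuousAt (by fun_prop)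
    have h2 : ContinuousAt (fun z => D (m.Ψ (1, z))) z :=
      ContinuousAt.comp (g := D) (hDc _ (by rw [hproj z hz1]; exact ⟨z, hz1, rfl⟩)
        (by rw [hproj z hz1]; exact hz.1.2)) h1
    have h3 : ContinuousAt (fun z => ((D (m.Ψ (1, z)) / D₀ : Circle) : ℂ)) z :=
      continuous_subtype_val.continuousAt.comp (h2.div_const' D₀)
    exact inter_mem ((c.isOpen_dom_inter hU).mem_nhds hz.1)
      (h3.eventually_mem (Complex.isOpen_slitPlane.mem_nhds hz.2))
  have hAd : ∀ z ∈ A, z ∈ c.dom := fun z hz => hz.1.1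
  have hAV : ∀ q, S.π q ∈ c.toFun '' A → S.π q ∈ c.target ∧ S.π q ∈ U ∧
      ((D q / D₀ : Circle) : ℂ) ∈ Complex.slitPlane := by
    rintro q ⟨z, hz, hzq⟩
    have h1 : S.π q ∈ c.target := ⟨z, hz.1.1, hzq⟩
    have h2 : S.π q ∈ U := hzq ▸ hz.1.2
    refine ⟨h1, h2, ?_⟩
    obtain ⟨u, w, hw, hwq, rfl⟩ := hrep q h1
    obtain ⟨γ, hγ, rfl⟩ := (c.eq_iff z hz.1.1 w hw).1 (hzq.trans hwq.symm)
    have h3 : m.Ψ (u, γ z) = (u * (m.χ ⟨γ, hγ⟩)⁻¹) • m.Ψ (1, z) := by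
      rw [← m.smul_eq _ hz.1.1, eq_comm]
      refine (m.eq_iff _ _ _ hz.1.1 _ hw).2 ⟨⟨γ, hγ⟩, ?_, rfl⟩
      rw [mul_comm u, mul_inv_cancel_left]
    rw [h3, hDs _ (by rw [hproj z hz.1.1]; exact ⟨z, hz.1.1, rfl⟩)
      (by rw [hproj z hz.1.1]; exact hz.1.2)]
    exact hz.2
  have hk2 : (2 * Real.pi * k : ℝ) ≠ 0 := by
    have := Real.pi_pos
    positivity
  refine ⟨c.toFun '' A, T, fun q => (Complex.arg ((D q / D₀ : Circle) : ℂ) +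
    Complex.arg (D₀ : ℂ)) / (2 * Real.pi * k), c.isOpen_image A hAd hA, ?_, ?_, ?_, ?_, ?_, ?_, ?_⟩
  · exact ⟨0, ⟨⟨h0, hx⟩, by simp [hD₀]⟩, rfl⟩
  · rintro _ ⟨z, hz, rfl⟩
    exact hz.1.2
  · exact fun q hq => hTs q (hAV q hq).1
  · exact fun q hq => hTe q (hAV q hq).1
  · intro q hq
    obtain ⟨h1, h2, h3⟩ := hAV q hq
    have h4 : ContinuousAt (fun q => ((D q / D₀ : Circle) : ℂ)) q :=
      continuous_subtype_val.continuousAt.comp ((hDc q h1 h2).div_const' D₀)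
    have h5 : ContinuousAt (fun q => Complex.arg ((D q / D₀ : Circle) : ℂ)) q :=
      ContinuousAt.comp (g := Complex.arg) (Complex.continuousAt_arg h3) h4
    exact (h5.add continuousAt_const).div_const _
  · intro q hq s
    obtain ⟨h1, h2, -⟩ := hAV q hq
    simp only [hDs q h1 h2 s]
  · intro q hq
    rw [mul_div_cancel₀ _ hk2, Circle.exp_add, Circle.exp_arg, Circle.exp_arg, div_mul_cancel,
      div_mul_cancel]

/-- Local primitives `β x` of `Ω`, with `β y - β x = d (h x y)`, and smooth fibre coordinates `τ x`
of `M / μ` with `τ x / τ y = exp (2πi m h x y)`. These are the local data of a connection with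
curvature form `Ω`. -/
structure ConnectionData (S : SeifertBundle O o) (Ω : OrbiForm O univ 2) where
  U : X → Set X
  isOpen : ∀ x, IsOpen (U x)
  mem : ∀ x, x ∈ U x
  β : ∀ x, OrbiForm O (U x) 1
  h : X → X → X → ℝ
  τ : X → M → Circle
  extDeriv_β : ∀ x, ∀ c ∈ O.atlas, ∀ p ∈ c.dom, c.toFun p ∈ U x →
    extDeriv ((β x).form c) p = Ω.form c p
  h_smooth : ∀ x y, ∀ c ∈ O.atlas,
    ContDiffOn ℝ ∞ (h x y ∘ c.toFun) (c.dom ∩ c.toFun ⁻¹' (U x ∩ U y))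
  h_deriv : ∀ x y, ∀ c ∈ O.atlas, ∀ p ∈ c.dom, c.toFun p ∈ U x ∩ U y → ∀ v : Euc d,
    fderiv ℝ (h x y ∘ c.toFun) p v = (β y).form c p ![v] - (β x).form c p ![v]
  τ_smooth : ∀ x q, S.π q ∈ U x → ContMDiffAt (𝓡 (d + 1)) (𝓡 1) ∞ (τ x) q
  τ_smul : ∀ x q, S.π q ∈ U x → ∀ s : Circle, τ x (s • q) = s ^ O.isotropyLcm * τ x q
  τ_trans : ∀ x y q, S.π q ∈ U x ∩ U y →
    τ x q = Circle.exp (2 * Real.pi * O.isotropyLcm * h x y (S.π q)) * τ y q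

/-- The transition functions of the smooth coordinates of the models and the functions `h x y`
differ by a smooth additive cocycle on the base, which a partition of unity splits. -/
theorem CechData.exists_connectionData [T2Space X] [SecondCountableTopology X]
    {S : SeifertBundle O o} {Ω : OrbiForm O univ 2} (C : CechData S Ω)
    (hfin : ∃ N : ℕ, 0 < N ∧ O.IsIsotropyMultiple N) : Nonempty (ConnectionData S Ω) := by
  have hkpos : 0 < O.isotropyLcm := O.isotropyLcm_pos hfin
  have hk0 : (O.isotropyLcm : ℝ) ≠ 0 := by positivity
  have hk2 : (2 * Real.pi * O.isotropyLcm : ℝ) ≠ 0 := by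
    have := Real.pi_pos
    positivity
  choose V T r hVo hxV hVU hTs hTe hrc hre hTr using fun x =>
    S.exists_smooth_fibre_coordinate hfin (C.𝒰.isOpen x) (C.𝒰.mem x) (C.τ_cont x) (C.τ_smul x)
  obtain ⟨ι, j, l, hls, hlV, hlf, hl1⟩ := S.exists_partition V fun x => (hVo x).mem_nhds (hxV x)
  -- `G` is the logarithm of the transition functions of the `T x`, smooth since it is continuous and
  -- the `T x` are smooth; `K` is an additive cocycle, because the cocycles of `h` and `m⁻¹ f` agree
  let G : X → X → M → ℝ := fun x y q => r x q - r y q + (O.isotropyLcm : ℝ)⁻¹ * C.f x y (S.π q)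
  let K : X → X → M → ℝ := fun x y q => G x y q - C.h x y (S.π q)
  have hGexp : ∀ x y q, S.π q ∈ V x → S.π q ∈ V y →
      Circle.exp (2 * Real.pi * O.isotropyLcm * G x y q) = T x q / T y q := by
    intro x y q hx hy
    rw [hTr x q hx, hTr y q hy, C.τ_trans x y q ⟨hVU x hx, hVU y hy⟩]
    have : 2 * Real.pi * O.isotropyLcm * G x y q = 2 * Real.pi * O.isotropyLcm * r x q -
        2 * Real.pi * O.isotropyLcm * r y q + 2 * Real.pi * C.f x y (S.π q) := by
      simp only [G]
      field_simp
    rw [this, Circle.exp_add, Circle.exp_sub]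
    rw [← mul_assoc, mul_div_mul_right_eq_div, div_mul_eq_mul_div]
  have hGs : ∀ x y q, S.π q ∈ V x → S.π q ∈ V y →
      ContMDiffAt (𝓡 (d + 1)) 𝓘(ℝ, ℝ) ∞ (G x y) q := by
    intro x y q hx hy
    have hf : ContinuousAt (fun q => C.f x y (S.π q)) q :=
      ContinuousAt.comp (g := C.f x y) ((C.f_cont x y).continuousAt
        (((C.𝒰.isOpen x).inter (C.𝒰.isOpen y)).mem_nhds ⟨hVU x hx, hVU y hy⟩))
        S.continuous_π.continuousAt
    refine contMDiffAt_of_circle_exp_eq hk2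
      (((hrc x q hx).sub (hrc y q hy)).add (continuousAt_const.mul hf))
      (ContMDiffAt.div (hTs x q hx) (hTs y q hy)) ?_
    filter_upwards [S.continuous_π.continuousAt.eventually_mem ((hVo x).mem_nhds hx),
      S.continuous_π.continuousAt.eventually_mem ((hVo y).mem_nhds hy)] with p hpx hpy
    exact hGexp x y p hpx hpy
  have hKs : ∀ x y q, S.π q ∈ V x → S.π q ∈ V y →
      ContMDiffAt (𝓡 (d + 1)) 𝓘(ℝ, ℝ) ∞ (K x y) q := by
    intro x y q hx hy
    obtain ⟨c, f, hcf⟩ := S.exists_isLiftAt q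
    exact (hGs x y q hx hy).sub (hcf.smooth_pullback ((C.𝒰.isOpen x).inter (C.𝒰.isOpen y))
      (C.h_smooth x y c hcf.mem_atlas) ⟨hVU x hx, hVU y hy⟩).1
  have hKc : ∀ x y z q, S.π q ∈ V x → S.π q ∈ V y → S.π q ∈ V z →
      K x z q - K y z q = K x y q := by
    intro x y z q hx hy hz
    have h1 := C.cocycle_eq x y z (S.π q) (hVU x hx) (hVU y hy) (hVU z hz)
    simp only [K, G]
    linarith
  have hKe : ∀ x y q, S.π q ∈ V x → S.π q ∈ V y → ∀ s : Circle, K x y (s • q) = K x y q := by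
    intro x y q hx hy s
    simp only [K, G, hre x q hx s, hre y q hy s, S.π_smul s q]
  -- the partition of unity writes `K x y` as `σ x - σ y`
  let σ : X → M → ℝ := fun x q => ∑ᶠ i, l i (S.π q) * K x (j i) q
  have hlV' : ∀ i q, l i (S.π q) ≠ 0 → S.π q ∈ V (j i) := fun i q h => hlV i (subset_tsupport _ h)
  have hlfM : LocallyFinite (fun i => Function.support (l i ∘ S.π)) :=
    hlf.preimage_continuous S.continuous_π
  have hfinsupp : ∀ x q, (Function.support fun i => l i (S.π q) * K x (j i) q).Finite :=
    fun x q => (hlf.point_finite (S.π q)).subset fun i hi => left_ne_zero_of_mul hi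
  have hσs : ∀ x q, S.π q ∈ V x → ContMDiffAt (𝓡 (d + 1)) 𝓘(ℝ, ℝ) ∞ (σ x) q := by
    intro x q hx
    refine contMDiffAt_finsum (hlfM.subset fun i p hp => left_ne_zero_of_mul hp) fun i => ?_
    by_cases hq : S.π q ∈ tsupport (l i)
    · exact ((hls i) q).mul (hKs x (j i) q hx (hlV i hq))
    · refine (contMDiffAt_const (c := (0 : ℝ))).congr_of_eventuallyEq ?_
      filter_upwards [S.continuous_π.continuousAt.eventually_mem
        ((isClosed_tsupport (l i)).isOpen_compl.mem_nhds hq)] with p hp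
      rw [image_eq_zero_of_notMem_tsupport hp, zero_mul]
  have hσc : ∀ x y q, S.π q ∈ V x → S.π q ∈ V y → σ x q - σ y q = K x y q := by
    intro x y q hx hy
    simp only [σ]
    rw [← finsum_sub_distrib (hfinsupp x q) (hfinsupp y q)]
    have h1 : ∀ i, l i (S.π q) * K x (j i) q - l i (S.π q) * K y (j i) q
        = l i (S.π q) * K x y q := by
      intro i
      by_cases hi : l i (S.π q) = 0
      · simp [hi]
      · rw [← mul_sub, hKc x y (j i) q hx hy (hlV' i q hi)]
    rw [finsum_congr h1, ← finsum_mul, hl1, one_mul]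
  have hσe : ∀ x q, S.π q ∈ V x → ∀ s : Circle, σ x (s • q) = σ x q := by
    intro x q hx s
    refine finsum_congr fun i => ?_
    rw [S.π_smul s q]
    by_cases hi : l i (S.π q) = 0
    · simp [hi]
    · rw [hKe x (j i) q hx (hlV' i q hi)]
  refine ⟨⟨V, hVo, hxV, fun x => (C.β x).restrict (hVU x), C.h,
    fun x q => Circle.exp (2 * Real.pi * O.isotropyLcm * (-σ x q)) * T x q,
    fun x c hc p hp hpV => C.extDeriv_β x c hc p hp (hVU x hpV),
    fun x y c hc => (C.h_smooth x y c hc).mono fun p hp => ⟨hp.1, hVU x hp.2.1, hVU y hp.2.2⟩,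
    fun x y c hc p hp hpV v => C.h_deriv x y c hc p hp ⟨hVU x hpV.1, hVU y hpV.2⟩ v, ?_, ?_, ?_⟩⟩
  · intro x q hx
    have h1 : ContDiff ℝ ∞ (fun t : ℝ => 2 * Real.pi * O.isotropyLcm * (-t)) := by fun_prop
    have h2 := contMDiff_circleExp.contMDiffAt.comp q (h1.contMDiff.contMDiffAt.comp q (hσs x q hx))
    exact ContMDiffAt.mul h2 (hTs x q hx)
  · intro x q hx s
    simp only [hσe x q hx s, hTe x q hx s]
    rw [mul_left_comm]
  · intro x y q hq
    have h1 : T x q = Circle.exp (2 * Real.pi * O.isotropyLcm * G x y q) * T y q := by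
      rw [hGexp x y q hq.1 hq.2, div_mul_cancel]
    have h2 := hσc x y q hq.1 hq.2
    simp only [h1, ← mul_assoc, ← Circle.exp_add]
    congr 2
    simp only [K] at h2
    rw [← mul_add, ← mul_add]
    congr 1
    linarith

end FibreCoordinates

/-! ### Adapted charts and the connection form -/

section AdaptedCharts

variable {X : Type*} [TopologicalSpace X] {d : ℕ} {O : OrientedOrbifold X d}
  {M : Type*} [TopologicalSpace M] [ChartedSpace (Euc (d + 1)) M] [MulAction Circle M]
  {o : ManifoldOrientation (d + 1) M} [ContMDiffSMul (𝓡 1) (𝓡 (d + 1)) ∞ Circle M]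
  {S : SeifertBundle O o} {Ω : OrbiForm O univ 2}

/-- An orbifold `1`-form in a chart, as a field of linear forms. -/
def OrbiForm.linear {U : Set X} (β : OrbiForm O U 1) (c : OrbifoldChart X d) (z : Euc d) :
    Euc d →L[ℝ] ℝ :=
  (ContinuousAlternatingMap.ofSubsingleton ℝ (Euc d) ℝ (0 : Fin 1)).symm (β.form c z)

theorem OrbiForm.linear_apply {U : Set X} (β : OrbiForm O U 1) (c : OrbifoldChart X d) (z v : Euc d) :
    β.linear c z v = β.form c z ![v] := by
  rw [OrbiForm.linear, ContinuousAlternatingMap.ofSubsingleton_symm_apply_apply]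
  congr 1
  ext i
  fin_cases i
  rfl

/-- Coordinates `(a, f)` of `M` near `p`, where `f` is a lift of `π` to an orbifold chart and `a`
is a coordinate along the circle with `exp (2πi m a) = τ / τ p`. In them the connection form is
`da + f^*β`. The field `injective` says that `(a, f)` is an immersion, hence a local diffeomorphism
since the dimensions agree; the field `orient` says that it preserves orientations at `p`, by means
of a positive basis adapted to the projection. -/
structure AdaptedChart (D : ConnectionData S Ω) (p : M) where
  W : Set M
  isOpen : IsOpen W
  mem : p ∈ W
  c : OrbifoldChart X d
  f : M → Euc d
  isLiftAt : ∀ q ∈ W, IsLiftAt O S.π c f q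
  mem_U : ∀ q ∈ W, S.π q ∈ D.U (S.π p)
  a : M → ℝ
  a_smooth : ∀ q ∈ W, ContMDiffAt (𝓡 (d + 1)) 𝓘(ℝ, ℝ) ∞ a q
  exp_a : ∀ q ∈ W, Circle.exp (2 * Real.pi * O.isotropyLcm * a q) =
    D.τ (S.π p) q / D.τ (S.π p) p
  injective : ∀ q ∈ W, ∀ v : TangentSpace (𝓡 (d + 1)) q,
    mvfderiv (𝓡 (d + 1)) a q v = 0 → mvfderiv (𝓡 (d + 1)) f q v = 0 → v = 0
  orient : ∃ (b : Module.Basis (Fin (d + 1)) ℝ (TangentSpace (𝓡 (d + 1)) p))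
    (A : Euc d →L[ℝ] Euc d), 0 < A.det ∧ b.orientation = o.orient p ∧
      0 < mvfderiv (𝓡 (d + 1)) a p (b 0) ∧
      mvfderiv (𝓡 (d + 1)) f p (b 0) = 0 ∧
      ∀ i : Fin d, mvfderiv (𝓡 (d + 1)) f p (b i.succ) = A (EuclideanSpace.basisFun (Fin d) ℝ i)

namespace AdaptedChart

variable {D : ConnectionData S Ω} {p r : M}

/-- The connection form `da + f^*β`. -/
def η (A : AdaptedChart D p) (q : M) : TangentSpace (𝓡 (d + 1)) q →L[ℝ] ℝ :=
  mvfderiv (𝓡 (d + 1)) A.a q + ((D.β (S.π p)).linear A.c (A.f q)).comp (mvfderiv (𝓡 (d + 1)) A.f q)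

theorem η_apply (A : AdaptedChart D p) (q : M) (v : TangentSpace (𝓡 (d + 1)) q) :
    A.η q v = mvfderiv (𝓡 (d + 1)) A.a q v +
      (D.β (S.π p)).form A.c (A.f q) ![mvfderiv (𝓡 (d + 1)) A.f q v] := by
  rw [← OrbiForm.linear_apply]
  rfl

/-- The connection form does not depend on the adapted chart: the difference of the coordinates
along the circle is `h (π p) (π r) ∘ π` up to a locally constant function. -/
theorem η_eq (hfin : ∃ N : ℕ, 0 < N ∧ O.IsIsotropyMultiple N) (A : AdaptedChart D p)
    (B : AdaptedChart D r) {q : M} (hA : q ∈ A.W) (hB : q ∈ B.W) : A.η q = B.η q := by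
  have hkpos : 0 < O.isotropyLcm := O.isotropyLcm_pos hfin
  have hk2 : (2 * Real.pi * O.isotropyLcm : ℝ) ≠ 0 := by
    have := Real.pi_pos
    positivity
  have hlA := A.isLiftAt q hA
  have hlB := B.isLiftAt q hB
  have hU : S.π q ∈ D.U (S.π p) ∩ D.U (S.π r) := ⟨A.mem_U q hA, B.mem_U q hB⟩
  obtain ⟨hs, hd⟩ := hlA.smooth_pullback ((D.isOpen (S.π p)).inter (D.isOpen (S.π r)))
    (D.h_smooth (S.π p) (S.π r) A.c hlA.mem_atlas) hU
  have hcont : ContinuousAt (fun q => A.a q - B.a q - D.h (S.π p) (S.π r) (S.π q)) q :=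
    ((A.a_smooth q hA).continuousAt.sub (B.a_smooth q hB).continuousAt).sub hs.continuousAt
  have hexp : ∀ q ∈ A.W ∩ B.W, Circle.exp (2 * Real.pi * O.isotropyLcm *
      (A.a q - B.a q - D.h (S.π p) (S.π r) (S.π q)))
        = D.τ (S.π r) r / D.τ (S.π p) p := by
    intro q hq
    rw [mul_sub, mul_sub, Circle.exp_sub, Circle.exp_sub, A.exp_a q hq.1, B.exp_a q hq.2,
      D.τ_trans (S.π p) (S.π r) q ⟨A.mem_U q hq.1, B.mem_U q hq.2⟩, div_eq_iff_eq_mul]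
    generalize Circle.exp (2 * Real.pi * O.isotropyLcm * D.h (S.π p) (S.π r) (S.π q)) = e₁
    generalize D.τ (S.π r) q = t₁, D.τ (S.π r) r = t₂, D.τ (S.π p) p = t₃
    simp only [div_eq_mul_inv]
    calc e₁ * t₁ * t₃⁻¹ * (t₁ * t₂⁻¹)⁻¹ = e₁ * t₁ * t₃⁻¹ * (t₁⁻¹ * t₂) := by
          rw [mul_inv, inv_inv]
      _ = (t₁ * t₁⁻¹) * (t₂ * t₃⁻¹ * e₁) := by
          ac_rfl
      _ = t₂ * t₃⁻¹ * e₁ := by rw [mul_inv_cancel, one_mul]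
  have hconst := eventually_const_of_circle_exp_eq hk2 hcont (by
    filter_upwards [(A.isOpen.inter B.isOpen).mem_nhds ⟨hA, hB⟩] with q' hq'
    rw [hexp q' hq', hexp q ⟨hA, hB⟩])
  have hsum : A.a =ᶠ[𝓝 q] (B.a + fun q => D.h (S.π p) (S.π r) (S.π q)) + fun _ =>
      (A.a q - B.a q - D.h (S.π p) (S.π r) (S.π q)) := by
    filter_upwards [hconst] with q' hq'
    simp only [Pi.add_apply]
    linarith
  ext v
  have h1 : mvfderiv (𝓡 (d + 1)) A.a q v = mvfderiv (𝓡 (d + 1)) B.a q v +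
      mvfderiv (𝓡 (d + 1)) (fun q => D.h (S.π p) (S.π r) (S.π q)) q v := by
    have hB' := (B.a_smooth q hB).mdifferentiableAt (by simp)
    have hh' := hs.mdifferentiableAt (by simp)
    rw [mvfderiv_congr hsum, mvfderiv_add (hB'.add hh') mdifferentiableAt_const,
      mvfderiv_add hB' hh', mvfderiv_const]
    simp
  rw [η_apply, η_apply, h1, hd v, D.h_deriv (S.π p) (S.π r) A.c hlA.mem_atlas (A.f q) hlA.mem_dom
    (by rw [hlA.toFun_eq]; exact hU)]
  have h2 := (hlA.liftRel hlB).form_eq (D.β (S.π r)) hU.2 ![v]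
  have h3 : ∀ L : TangentSpace (𝓡 (d + 1)) q → Euc d, L ∘ ![v] = ![L v] := by
    intro L
    ext i
    fin_cases i
    rfl
  rw [h3, h3] at h2
  rw [← h2]
  ring

end AdaptedChart

end AdaptedCharts

/-! ### Existence of adapted charts -/

section AdaptedChartsExist

variable {X : Type*} [TopologicalSpace X] {d : ℕ} {O : OrientedOrbifold X d}
  {M : Type*} [TopologicalSpace M] [ChartedSpace (Euc (d + 1)) M] [MulAction Circle M]
  {o : ManifoldOrientation (d + 1) M}

/-- Vectors whose coordinates are the standard basis of `ℝ × ℝᵈ` are linearly independent. -/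
theorem linearIndependent_of_coordinates {T : Type*} [AddCommGroup T] [Module ℝ T]
    (R : T →ₗ[ℝ] ℝ × Euc d) (v : Fin (d + 1) → T) (h0 : R (v 0) = (1, 0))
    (hs : ∀ i : Fin d, R (v i.succ) = (0, EuclideanSpace.basisFun (Fin d) ℝ i)) :
    LinearIndependent ℝ v := by
  refine LinearIndependent.of_comp R ?_
  rw [Fintype.linearIndependent_iff]
  intro g hg
  simp only [Function.comp_apply, Fin.sum_univ_succ, h0, hs] at hg
  have h1 := congrArg Prod.fst hg
  have h2 := congrArg Prod.snd hg
  simp [Prod.fst_sum] at h1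
  simp only [Prod.snd_sum, Prod.smul_snd, h1, zero_smul, Prod.snd_zero, zero_add] at h2
  have h3 := (Fintype.linearIndependent_iff.1
    (EuclideanSpace.basisFun (Fin d) ℝ).toBasis.linearIndependent) (fun i => g i.succ)
    (by simpa using h2)
  intro i
  refine Fin.cases h1 h3 i

/-- A parametrisation of a Seifert bundle with the circle unrolled to the line. -/
def SeifertModel.unroll {π : M → X} {c : OrbifoldChart X d} (m : SeifertModel o π c) (u : Circle)
    (q : ℝ × Euc d) : M :=
  m.Ψ (Circle.exp q.1 * u, q.2)

/-- Smooth local coordinates `(θ, z)` inverse to the unrolled parametrisation. -/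
theorem SeifertModel.exists_unrolled_coordinates {π : M → X} {c : OrbifoldChart X d}
    (m : SeifertModel o π c) (u : Circle) {z : Euc d} (hz : z ∈ c.dom) :
    (∀ w : ℝ × Euc d, w.2 ∈ c.dom →
      ContMDiffAt 𝓘(ℝ, ℝ × Euc d) (𝓡 (d + 1)) ∞ (m.unroll u) w) ∧
    ∃ (θ : M → ℝ) (g : M → Circle × Euc d),
      (∀ᶠ q in 𝓝 (m.Ψ (u, z)), ContMDiffAt (𝓡 (d + 1)) ((𝓡 1).prod (𝓡 d)) ∞ g q) ∧
      (∀ᶠ q in 𝓝 (m.Ψ (u, z)), ContMDiffAt (𝓡 (d + 1)) 𝓘(ℝ, ℝ) ∞ θ q) ∧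
      (∀ᶠ q in 𝓝 (m.Ψ (u, z)), (g q).2 ∈ c.dom ∧ m.Ψ (g q) = q ∧ m.unroll u (θ q, (g q).2) = q ∧
        (g q).1 = Circle.exp (θ q) * u) ∧
      ∀ᶠ w in 𝓝 ((0, z) : ℝ × Euc d), θ (m.unroll u w) = w.1 ∧ (g (m.unroll u w)).2 = w.2 := by
  have hκ : ContMDiff 𝓘(ℝ, ℝ × Euc d) ((𝓡 1).prod (𝓡 d)) ∞
      (fun w : ℝ × Euc d => (Circle.exp w.1 * u, w.2)) := by
    have h1 : ContMDiff 𝓘(ℝ, ℝ × Euc d) (𝓡 1) ∞ (fun w : ℝ × Euc d => Circle.exp w.1 * u) :=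
      (contMDiff_circleExp.comp contDiff_fst.contMDiff).mul contMDiff_const
    exact h1.prodMk contDiff_snd.contMDiff
  have hκ0 : (Circle.exp ((0, z) : ℝ × Euc d).1 * u, ((0, z) : ℝ × Euc d).2) = (u, z) := by simp
  obtain ⟨g, hg, hgq, hgw⟩ := m.exists_localInverse u hz
  have hg0 : g (m.Ψ (u, z)) = (u, z) := hgw.self_of_nhds
  have hslit : ∀ᶠ q in 𝓝 (m.Ψ (u, z)), (((g q).1 / u : Circle) : ℂ) ∈ Complex.slitPlane := by
    have h1 : ContinuousAt (fun q => (((g q).1 / u : Circle) : ℂ)) (m.Ψ (u, z)) :=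
      continuous_subtype_val.continuousAt.comp
        ((continuous_fst.continuousAt.comp hg.self_of_nhds.continuousAt).div_const' u)
    exact h1.eventually_mem (Complex.isOpen_slitPlane.mem_nhds (by simp [hg0]))
  have hθ : ∀ q, (g q).1 = Circle.exp (Complex.arg (((g q).1 / u : Circle) : ℂ)) * u := by
    intro q
    rw [Circle.exp_arg, div_mul_cancel]
  have hlim : Tendsto (fun w : ℝ × Euc d => (Circle.exp w.1 * u, w.2)) (𝓝 (0, z)) (𝓝 (u, z)) := by
    have := hκ.continuous.continuousAt (x := ((0, z) : ℝ × Euc d))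
    rwa [ContinuousAt, hκ0] at this
  refine ⟨?_, fun q => Complex.arg (((g q).1 / u : Circle) : ℂ), g, hg, ?_, ?_, ?_⟩
  · intro w hw
    exact ContMDiffAt.comp (I' := (𝓡 1).prod (𝓡 d)) (g := m.Ψ) w
      (m.localDiffeo ⟨(Circle.exp w.1 * u, w.2), mem_univ _, hw⟩).contMDiffAt (hκ _)
  · filter_upwards [hg, hslit] with q h1 h2
    have h3 : ContMDiffAt (𝓡 (d + 1)) (𝓡 1) ∞ (fun q => (g q).1 / u) q :=
      ContMDiffAt.div (contMDiffAt_fst.comp q h1) contMDiffAt_const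
    exact ContMDiffAt.comp q (contMDiffAt_circle_arg h2) h3
  · filter_upwards [hgq] with q h1
    refine ⟨h1.1, h1.2, ?_, hθ q⟩
    simp only [SeifertModel.unroll]
    rw [← hθ q]
    exact h1.2
  · have h1 : ∀ᶠ w : ℝ × Euc d in 𝓝 (0, z), w.1 ∈ Ioo (-Real.pi) Real.pi :=
      continuous_fst.continuousAt.eventually_mem
        (Ioo_mem_nhds (neg_lt_zero.2 Real.pi_pos) Real.pi_pos)
    filter_upwards [hlim.eventually hgw, h1] with w hw hw1
    simp only [SeifertModel.unroll, hw]
    rw [mul_div_cancel_right, Circle.arg_exp hw1.1 hw1.2.le]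
    simp

variable [ContMDiffSMul (𝓡 1) (𝓡 (d + 1)) ∞ Circle M] {S : SeifertBundle O o}
  {Ω : OrbiForm O univ 2}

/-- In a model centred at `π p`, with coordinates `(u exp (iθ), z)`, the fibre coordinate `τ` is
`exp (i m θ)` times its value on the slice `θ = 0`, so that `θ / 2π` plus a logarithm of `τ` on this
slice is a coordinate along the circle as required. -/
theorem ConnectionData.exists_adaptedChart (hfin : ∃ N : ℕ, 0 < N ∧ O.IsIsotropyMultiple N)
    (D : ConnectionData S Ω) (p : M) : Nonempty (AdaptedChart D p) := by
  have hkpos : 0 < O.isotropyLcm := O.isotropyLcm_pos hfin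
  have hk2 : (2 * Real.pi * O.isotropyLcm : ℝ) ≠ 0 := by
    have := Real.pi_pos
    positivity
  obtain ⟨c, ⟨c', hc', ⟨e⟩⟩, h0, hx, ⟨m⟩⟩ := S.model (S.π p)
  -- every point of the fibre over `π p` is over the centre of the model
  obtain ⟨u, rfl⟩ : ∃ u, p = m.Ψ (u, 0) := by
    have hq : p ∈ S.π ⁻¹' c.target := ⟨0, h0, hx⟩
    rw [← m.image] at hq
    obtain ⟨⟨u, z⟩, ⟨-, hz⟩, rfl⟩ := hq
    rw [m.proj u z hz] at hx
    obtain ⟨γ, hγ, hγz⟩ := (c.eq_iff z hz 0 h0).1 hx.symm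
    exact ⟨m.χ ⟨γ, hγ⟩ * u, (m.eq_iff _ _ _ hz _ h0).2 ⟨⟨γ, hγ⟩, rfl, hγz.symm⟩⟩
  obtain ⟨hΨ, θ, g, hg, hθ, hinv, hinv'⟩ := m.exists_unrolled_coordinates u h0
  set p : M := m.Ψ (u, 0) with hp
  set τ := D.τ (S.π p) with hτ
  have hp1 : m.unroll u (0, 0) = p := by simp [SeifertModel.unroll, hp]
  obtain ⟨hθ0, hg0⟩ := hinv'.self_of_nhds
  rw [hp1] at hθ0 hg0
  simp only at hθ0 hg0
  have hU : ∀ᶠ z in 𝓝 (0 : Euc d), c.toFun z ∈ D.U (S.π p) :=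
    (c.tendsto_toFun h0).eventually_mem ((D.isOpen _).mem_nhds (by rw [hx]; exact D.mem _))
  have hdom : ∀ᶠ z in 𝓝 (0 : Euc d), z ∈ c.dom := c.isOpen_dom.eventually_mem h0
  -- `τ` along the slice `u × Ũ`
  have hQ : ∀ᶠ z in 𝓝 (0 : Euc d),
      ContMDiffAt (𝓡 d) (𝓡 1) ∞ (fun z => τ (m.Ψ (u, z)) / τ p) z := by
    filter_upwards [hU, hdom] with z hzU hz
    have h1 : ContMDiffAt (𝓡 d) (𝓡 (d + 1)) ∞ (fun z => m.Ψ (u, z)) z :=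
      ContMDiffAt.comp (I' := (𝓡 1).prod (𝓡 d)) (g := m.Ψ) z
        (m.localDiffeo ⟨(u, z), mem_univ _, hz⟩).contMDiffAt
        (contMDiff_const.prodMk contMDiff_id).contMDiffAt
    have h2 : ContMDiffAt (𝓡 d) (𝓡 1) ∞ (fun z => τ (m.Ψ (u, z))) z :=
      ContMDiffAt.comp z (D.τ_smooth (S.π p) _ (by rw [m.proj u z hz]; exact hzU)) h1
    exact h2.div contMDiffAt_const
  have hslit : ∀ᶠ z in 𝓝 (0 : Euc d),
      ((τ (m.Ψ (u, z)) / τ p : Circle) : ℂ) ∈ Complex.slitPlane := by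
    have h1 : ContinuousAt (fun z => ((τ (m.Ψ (u, z)) / τ p : Circle) : ℂ)) 0 :=
      continuous_subtype_val.continuousAt.comp hQ.self_of_nhds.continuousAt
    exact h1.eventually_mem (Complex.isOpen_slitPlane.mem_nhds (by simp [hp]))
  let ρ : Euc d → ℝ := fun z =>
    (2 * Real.pi * O.isotropyLcm)⁻¹ * Complex.arg ((τ (m.Ψ (u, z)) / τ p : Circle) : ℂ)
  have hρ : ∀ᶠ z in 𝓝 (0 : Euc d), ContDiffAt ℝ ∞ ρ z := by
    filter_upwards [hQ, hslit] with z h1 h2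
    have h3 := ContMDiffAt.comp z (contMDiffAt_circle_arg h2) h1
    exact contDiffAt_const.mul (contMDiffAt_iff_contDiffAt.1 h3)
  have hgcont : Tendsto (fun q => (g q).2) (𝓝 p) (𝓝 0) := by
    have h1 : ContinuousAt (fun q => (g q).2) p :=
      continuous_snd.continuousAt.comp hg.self_of_nhds.continuousAt
    rwa [ContinuousAt, hg0] at h1
  let z₂ : M → Euc d := fun q => (g q).2
  let a : M → ℝ := fun q => (2 * Real.pi)⁻¹ * θ q + ρ (z₂ q)
  have hall := (((hg.and hθ).and (hinv.and (hgcont.eventually hρ))).and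
    (S.continuous_π.continuousAt.eventually_mem ((D.isOpen (S.π p)).mem_nhds (D.mem _))))
  obtain ⟨W, hWsub, hW, hpW⟩ := mem_nhds_iff.1 hall.eventually_nhds
  have hz₂s : ∀ q ∈ W, ContMDiffAt (𝓡 (d + 1)) (𝓡 d) ∞ z₂ q := fun q hq =>
    contMDiffAt_snd.comp q (hWsub hq).self_of_nhds.1.1.1
  have hρs : ∀ q ∈ W, ContDiffAt ℝ ∞ ρ (z₂ q) := fun q hq => (hWsub hq).self_of_nhds.1.2.2
  have hθs : ∀ q ∈ W, ContMDiffAt (𝓡 (d + 1)) 𝓘(ℝ, ℝ) ∞ θ q :=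
    fun q hq => (hWsub hq).self_of_nhds.1.1.2
  have hz₂d : ∀ q ∈ W, z₂ q ∈ c.dom := fun q hq => (hWsub hq).self_of_nhds.1.2.1.1
  have has : ∀ q ∈ W, ContMDiffAt (𝓡 (d + 1)) 𝓘(ℝ, ℝ) ∞ a q := by
    intro q hq
    have h1 : ContMDiffAt (𝓡 (d + 1)) 𝓘(ℝ, ℝ) ∞ (ρ ∘ z₂) q :=
      (hρs q hq).contMDiffAt.comp q (hz₂s q hq)
    exact (contMDiffAt_const.mul (hθs q hq)).add h1
  have hlift : ∀ q ∈ W, IsLiftAt O S.π c' (fun p => e.toFun (z₂ p)) q := fun q hq =>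
    e.isLiftAt hc' m (hWsub hq).self_of_nhds.1.1.1
      ((hWsub hq).mono fun q' hq' => ⟨hq'.1.2.1.1, hq'.1.2.1.2.1⟩)
  have hda : ∀ q ∈ W, ∀ v, mvfderiv (𝓡 (d + 1)) a q v =
      (2 * Real.pi)⁻¹ * mvfderiv (𝓡 (d + 1)) θ q v +
        fderiv ℝ ρ (z₂ q) (mvfderiv (𝓡 (d + 1)) z₂ q v) := by
    intro q hq v
    have e1 : a = (fun t : ℝ => (2 * Real.pi)⁻¹ * t) ∘ θ + ρ ∘ z₂ := rfl
    have hθ' := (hθs q hq).mdifferentiableAt (by simp)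
    have hz' := (hz₂s q hq).mdifferentiableAt (by simp)
    have hρ' := (hρs q hq).differentiableAt (by simp)
    have hl : HasFDerivAt (fun t : ℝ => (2 * Real.pi)⁻¹ * t)
        ((2 * Real.pi)⁻¹ • ContinuousLinearMap.id ℝ ℝ) (θ q) :=
      (hasFDerivAt_id (θ q)).const_mul _
    rw [e1, mvfderiv_add (hl.differentiableAt.mdifferentiableAt.comp q hθ')
      (hρ'.mdifferentiableAt.comp q hz'),
      mvfderiv_comp_of_differentiableAt hl.differentiableAt hθ',
      mvfderiv_comp_of_differentiableAt hρ' hz', hl.fderiv]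
    simp
  have hdf : ∀ q ∈ W, ∀ v, mvfderiv (𝓡 (d + 1)) (fun p => e.toFun (z₂ p)) q v =
      fderiv ℝ e.toFun (z₂ q) (mvfderiv (𝓡 (d + 1)) z₂ q v) := by
    intro q hq v
    have h1 : DifferentiableAt ℝ e.toFun (z₂ q) :=
      (e.contDiffOn.contDiffAt (c.isOpen_dom.mem_nhds (hz₂d q hq))).differentiableAt (by simp)
    exact congrArg (fun L => L v)
      (mvfderiv_comp_of_differentiableAt h1 ((hz₂s q hq).mdifferentiableAt (by simp)))
  let ψ : M → ℝ × Euc d := fun q => (θ q, z₂ q)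
  have hψs : ∀ q ∈ W, ContMDiffAt (𝓡 (d + 1)) 𝓘(ℝ, ℝ × Euc d) ∞ ψ q := fun q hq =>
    (hθs q hq).prodMk_space (hz₂s q hq)
  have hψ : ∀ q ∈ W, ∀ v, mvfderiv (𝓡 (d + 1)) ψ q v =
      (mvfderiv (𝓡 (d + 1)) θ q v, mvfderiv (𝓡 (d + 1)) z₂ q v) := by
    intro q hq v
    have h0 := (hψs q hq).mdifferentiableAt (by simp)
    have h1 := mvfderiv_comp_of_differentiableAt (φ := Prod.fst) differentiableAt_fst h0
    have h2 := mvfderiv_comp_of_differentiableAt (φ := Prod.snd) differentiableAt_snd h0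
    rw [fderiv_fst] at h1
    rw [fderiv_snd] at h2
    exact Prod.ext (congrArg (fun L => L v) h1).symm (congrArg (fun L => L v) h2).symm
  refine ⟨⟨W, hW, hpW, c', fun p => e.toFun (z₂ p), hlift,
    fun q hq => (hWsub hq).self_of_nhds.2, a, has, ?_, ?_, ?_⟩⟩
  · intro q hq
    obtain ⟨⟨-, ⟨hd, hq1, -, hq2⟩, -⟩, hqU⟩ := (hWsub hq).self_of_nhds
    have h1 : m.Ψ (g q) = Circle.exp (θ q) • m.Ψ (u, z₂ q) := by
      rw [← m.equivariant _ _ _ hd, ← hq2]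
    have h2 : S.π (m.Ψ (u, z₂ q)) ∈ D.U (S.π p) := by
      rw [← S.π_smul (Circle.exp (θ q)) (m.Ψ (u, z₂ q)), ← h1, hq1]
      exact hqU
    have h3 : τ q = Circle.exp (θ q) ^ O.isotropyLcm * τ (m.Ψ (u, z₂ q)) := by
      rw [← D.τ_smul _ _ h2, ← h1, hq1]
    have h4 : 2 * Real.pi * O.isotropyLcm * a q = O.isotropyLcm * θ q +
        Complex.arg ((τ (m.Ψ (u, z₂ q)) / τ p : Circle) : ℂ) := by
      have := Real.pi_pos
      simp only [a, ρ, mul_add, ← mul_assoc]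
      rw [mul_inv_cancel₀ hk2]
      field_simp
    rw [← hτ, h4, Circle.exp_add, Circle.exp_arg, h3, ← nsmul_eq_mul, Circle.exp_nsmul, mul_div_assoc]
  · intro q hq v hv1 hv2
    obtain ⟨⟨⟨hgq, hθq⟩, ⟨hd, -, hq1, -⟩, hρq⟩, -⟩ := (hWsub hq).self_of_nhds
    rw [hdf q hq] at hv2
    have hv3 : mvfderiv (𝓡 (d + 1)) z₂ q v = 0 :=
      LiftRel.fderiv_injective e hd (by rw [hv2, map_zero])
    rw [hda q hq, hv3, map_zero, add_zero] at hv1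
    have hv4 : mvfderiv (𝓡 (d + 1)) θ q v = 0 := by
      have := Real.pi_pos
      exact (mul_eq_zero.1 hv1).resolve_left (by positivity)
    have hψv : mvfderiv (𝓡 (d + 1)) ψ q v = 0 := by
      rw [hψ q hq v, hv4, hv3]
      rfl
    have hid : (m.unroll u ∘ ψ) =ᶠ[𝓝 q] id := by
      filter_upwards [hWsub hq] with q' hq'
      exact hq'.1.2.1.2.2.1
    have h1 := mfderiv_comp q ((hΨ (ψ q) hd).mdifferentiableAt (by simp))
      ((hψs q hq).mdifferentiableAt (by simp))
    rw [hid.mfderiv_eq, mfderiv_id] at h1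
    have h2 := congrArg (fun L => L v) h1
    refine h2.trans ?_
    change mfderiv 𝓘(ℝ, ℝ × Euc d) (𝓡 (d + 1)) (m.unroll u) (ψ q) (mvfderiv (𝓡 (d + 1)) ψ q v) = 0
    rw [hψv]
    exact map_zero (mfderiv 𝓘(ℝ, ℝ × Euc d) (𝓡 (d + 1)) (m.unroll u) (ψ q))
  · -- the frame of the parametrisation is positive, and its coordinates are the standard ones
    have hR : ∀ w : ℝ × Euc d, mvfderiv (𝓡 (d + 1)) ψ p
        (mfderiv 𝓘(ℝ, ℝ × Euc d) (𝓡 (d + 1)) (m.unroll u) (0, 0) w) = w := by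
      intro w
      have hid : (ψ ∘ m.unroll u) =ᶠ[𝓝 (0, 0)] id := by
        filter_upwards [hinv'] with w' hw'
        exact Prod.ext hw'.1 hw'.2
      have h1 := mfderiv_comp (I' := 𝓡 (d + 1)) (0, 0)
        (by rw [hp1]; exact (hψs p hpW).mdifferentiableAt (by simp))
        ((hΨ (0, 0) h0).mdifferentiableAt (by simp))
      rw [hid.mfderiv_eq, mfderiv_id, hp1] at h1
      exact (congrArg (fun L => L w) h1).symm
    let v : Fin (d + 1) → TangentSpace (𝓡 (d + 1)) p := Fin.cons
      (mfderiv 𝓘(ℝ, ℝ × Euc d) (𝓡 (d + 1)) (m.unroll u) (0, 0) ((1, 0) : ℝ × Euc d))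
      (fun i => mfderiv 𝓘(ℝ, ℝ × Euc d) (𝓡 (d + 1)) (m.unroll u) (0, 0)
        ((0, EuclideanSpace.basisFun (Fin d) ℝ i) : ℝ × Euc d))
    have hv0 : mvfderiv (𝓡 (d + 1)) ψ p (v 0) = (1, 0) := hR _
    have hvs : ∀ i : Fin d, mvfderiv (𝓡 (d + 1)) ψ p (v i.succ) =
        (0, EuclideanSpace.basisFun (Fin d) ℝ i) := fun i => hR _
    have hli : LinearIndependent ℝ v :=
      linearIndependent_of_coordinates (mvfderiv (𝓡 (d + 1)) ψ p).toLinearMap v hv0 hvs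
    have hcard : Fintype.card (Fin (d + 1)) =
        Module.finrank ℝ (TangentSpace (𝓡 (d + 1)) p) := by
      change _ = Module.finrank ℝ (Euc (d + 1))
      simp
    let b := basisOfLinearIndependentOfCardEqFinrank hli hcard
    have hb : ∀ i, b i = v i := fun i => by simp [b]
    rw [hψ p hpW] at hv0
    have hv0θ : mvfderiv (𝓡 (d + 1)) θ p (v 0) = 1 := congrArg Prod.fst hv0
    have hv0z : mvfderiv (𝓡 (d + 1)) z₂ p (v 0) = 0 := congrArg Prod.snd hv0
    have hvsz : ∀ i : Fin d, mvfderiv (𝓡 (d + 1)) z₂ p (v i.succ) =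
        EuclideanSpace.basisFun (Fin d) ℝ i := fun i => by
      have h1 := hvs i
      rw [hψ p hpW] at h1
      exact congrArg Prod.snd h1
    refine ⟨b, fderiv ℝ e.toFun 0, e.det_pos 0 h0, m.oriented u 0 h0 b (hb 0) fun i => hb i.succ,
      ?_, ?_, fun i => ?_⟩
    · rw [hb, hda p hpW, hv0θ, hv0z]
      have := Real.pi_pos
      simp only [mul_one, map_zero, add_zero]
      positivity
    · rw [hb, hdf p hpW, hv0z, map_zero]
    · rw [hb, hdf p hpW, hvsz, show z₂ p = 0 from hg0]

end AdaptedChartsExist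

/-! ### Tensor fields pulled back by local coordinates -/

section PulledBackTensors

variable {N : ℕ} {M : Type*} [TopologicalSpace M] [ChartedSpace (Euc N) M]
  [IsManifold (𝓡 N) ∞ M] {F : Type*} [NormedAddCommGroup F] [NormedSpace ℝ F] {ψ : M → F} {p : M}

/-- The inverse, on the fibre at `q`, of the trivialisation at `p` of the tangent bundle. -/
def tangentFrame (p q : M) : Euc N →L[ℝ] TangentSpace (𝓡 N) q :=
  (trivializationAt (Euc N) (TangentSpace (𝓡 N) : M → Type _) p).symmL ℝ q

/-- The trivialisation at `p` of the tangent bundle, on the fibre at `q`. -/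
def tangentCoordinates (p q : M) : TangentSpace (𝓡 N) q →L[ℝ] Euc N :=
  (trivializationAt (Euc N) (TangentSpace (𝓡 N) : M → Type _) p).continuousLinearMapAt ℝ q

theorem eventually_mem_baseSet (p : M) : ∀ᶠ q in 𝓝 p,
    q ∈ (trivializationAt (Euc N) (TangentSpace (𝓡 N) : M → Type _) p).baseSet :=
  (trivializationAt (Euc N) (TangentSpace (𝓡 N) : M → Type _) p).open_baseSet.eventually_mem
    (FiberBundle.mem_baseSet_trivializationAt' p)

theorem tangentCoordinates_comp_tangentFrame {q : M}
    (hq : q ∈ (trivializationAt (Euc N) (TangentSpace (𝓡 N) : M → Type _) p).baseSet) :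
    (tangentCoordinates p q).comp (tangentFrame p q) = ContinuousLinearMap.id ℝ (Euc N) := by
  ext1 v
  exact Bundle.Trivialization.continuousLinearMapAt_symmL _ hq v

theorem tangentFrame_comp_tangentCoordinates {q : M}
    (hq : q ∈ (trivializationAt (Euc N) (TangentSpace (𝓡 N) : M → Type _) p).baseSet) :
    (tangentFrame p q).comp (tangentCoordinates p q)
      = ContinuousLinearMap.id ℝ (TangentSpace (𝓡 N) q) := by
  ext1 v
  exact Bundle.Trivialization.symmL_continuousLinearMapAt _ hq v

/-- The derivative of a smooth map is smooth, when read in the trivialisation at `p`. -/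
theorem contMDiffAt_mvfderiv_comp_tangentFrame (hψ : ContMDiffAt (𝓡 N) 𝓘(ℝ, F) ∞ ψ p) :
    ContMDiffAt (𝓡 N) 𝓘(ℝ, Euc N →L[ℝ] F) ∞
      (fun q => (mvfderiv (𝓡 N) ψ q).comp (tangentFrame p q)) p := by
  have h := hψ.mfderiv_const (m := ∞) (by simp)
  refine h.congr_of_eventuallyEq (Eventually.of_forall fun q => ?_)
  simp only [inTangentCoordinates, ContinuousLinearMap.inCoordinates, id,
    TangentBundle.continuousLinearMapAt_model_space]
  rfl

theorem isInvertible_tangentFrame {q : M}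
    (hq : q ∈ (trivializationAt (Euc N) (TangentSpace (𝓡 N) : M → Type _) p).baseSet) :
    (tangentFrame (N := N) p q).IsInvertible := by
  have h1 := tangentFrame_comp_tangentCoordinates hq
  have h2 := tangentCoordinates_comp_tangentFrame hq
  exact ContinuousLinearMap.IsInvertible.of_inverse h1 h2

theorem inverse_mvfderiv_comp_tangentFrame {q : M}
    (hq : q ∈ (trivializationAt (Euc N) (TangentSpace (𝓡 N) : M → Type _) p).baseSet) :
    ((mvfderiv (𝓡 N) ψ q).comp (tangentFrame p q)).inverse
      = (tangentCoordinates p q).comp (mvfderiv (𝓡 N) ψ q).inverse := by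
  have h := isInvertible_tangentFrame hq
  have h1 := tangentFrame_comp_tangentCoordinates hq
  have h2 := tangentCoordinates_comp_tangentFrame hq
  rw [h.inverse_comp_of_right, ContinuousLinearMap.inverse_eq h1 h2]

theorem contMDiffAt_inverse_mvfderiv_comp_tangentFrame
    (hψ : ContMDiffAt (𝓡 N) 𝓘(ℝ, F) ∞ ψ p) (hinv : (mvfderiv (𝓡 N) ψ p).IsInvertible) :
    ContMDiffAt (𝓡 N) 𝓘(ℝ, F →L[ℝ] Euc N) ∞
      (fun q => ((mvfderiv (𝓡 N) ψ q).comp (tangentFrame p q)).inverse) p := by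
  have h := contMDiffAt_mvfderiv_comp_tangentFrame hψ
  have hb := isInvertible_tangentFrame (FiberBundle.mem_baseSet_trivializationAt' (F := Euc N)
    (E := (TangentSpace (𝓡 N) : M → Type _)) p)
  have hi : ((mvfderiv (𝓡 N) ψ p).comp (tangentFrame p p)).IsInvertible :=
    hinv.comp hb
  exact (hi.contDiffAt_map_inverse (n := ∞)).contMDiffAt.comp p h

/-- The pull-back by `ψ` of a smooth `1`-form is smooth. -/
theorem contMDiffAt_pullback_oneForm {α : F → F →L[ℝ] ℝ}
    (hψ : ContMDiffAt (𝓡 N) 𝓘(ℝ, F) ∞ ψ p) (hα : ContDiffAt ℝ ∞ α (ψ p)) :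
    ContMDiffAt (𝓡 N) ((𝓡 N).prod 𝓘(ℝ, Euc N →L[ℝ] ℝ)) ∞
      (fun q => Bundle.TotalSpace.mk' (Euc N →L[ℝ] ℝ)
        (E := fun q : M => TangentSpace (𝓡 N) q →L[ℝ] Bundle.Trivial M ℝ q) q
        ((α (ψ q)).comp (mvfderiv (𝓡 N) ψ q))) p := by
  rw [contMDiffAt_hom_bundle]
  refine ⟨contMDiffAt_id, ?_⟩
  have h1 : ContMDiffAt (𝓡 N) 𝓘(ℝ, F →L[ℝ] ℝ) ∞ (fun q => α (ψ q)) p := hα.contMDiffAt.comp p hψ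
  refine (h1.clm_comp (contMDiffAt_mvfderiv_comp_tangentFrame hψ)).congr_of_eventuallyEq
    (Eventually.of_forall fun q => ?_)
  ext v
  simp [ContinuousLinearMap.inCoordinates, tangentFrame]

/-- The pull-back by coordinates `ψ` of a smooth field of endomorphisms is smooth. -/
theorem contMDiffAt_pullback_endomorphism {P : F → F →L[ℝ] F}
    (hψ : ContMDiffAt (𝓡 N) 𝓘(ℝ, F) ∞ ψ p) (hinv : (mvfderiv (𝓡 N) ψ p).IsInvertible)
    (hP : ContDiffAt ℝ ∞ P (ψ p)) :
    ContMDiffAt (𝓡 N) ((𝓡 N).prod 𝓘(ℝ, Euc N →L[ℝ] Euc N)) ∞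
      (fun q => Bundle.TotalSpace.mk' (Euc N →L[ℝ] Euc N)
        (E := fun q : M => TangentSpace (𝓡 N) q →L[ℝ] TangentSpace (𝓡 N) q) q
        ((mvfderiv (𝓡 N) ψ q).inverse.comp ((P (ψ q)).comp (mvfderiv (𝓡 N) ψ q)))) p := by
  rw [contMDiffAt_hom_bundle]
  refine ⟨contMDiffAt_id, ?_⟩
  have h1 : ContMDiffAt (𝓡 N) 𝓘(ℝ, F →L[ℝ] F) ∞ (fun q => P (ψ q)) p := hP.contMDiffAt.comp p hψ
  refine ((contMDiffAt_inverse_mvfderiv_comp_tangentFrame hψ hinv).clm_comp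
    (h1.clm_comp (contMDiffAt_mvfderiv_comp_tangentFrame hψ))).congr_of_eventuallyEq ?_
  filter_upwards [eventually_mem_baseSet (N := N) p] with q hq
  rw [inverse_mvfderiv_comp_tangentFrame hq]
  rfl

/-- The pull-back of a bilinear form by a linear map. -/
def pullbackBilin {q : M} (B : F →L[ℝ] F →L[ℝ] ℝ) (D : TangentSpace (𝓡 N) q →L[ℝ] F) :
    TangentSpace (𝓡 N) q →L[ℝ] TangentSpace (𝓡 N) q →L[ℝ] ℝ :=
  (ContinuousLinearMap.precomp ℝ D).comp (B.comp D)

/-- The pull-back by `ψ` of a smooth field of bilinear forms is smooth. -/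
theorem contMDiffAt_pullback_bilinForm {G : F → F →L[ℝ] F →L[ℝ] ℝ}
    (hψ : ContMDiffAt (𝓡 N) 𝓘(ℝ, F) ∞ ψ p) (hG : ContDiffAt ℝ ∞ G (ψ p)) :
    ContMDiffAt (𝓡 N) ((𝓡 N).prod 𝓘(ℝ, Euc N →L[ℝ] Euc N →L[ℝ] ℝ)) ∞
      (fun q => Bundle.TotalSpace.mk' (Euc N →L[ℝ] Euc N →L[ℝ] ℝ)
        (E := fun q : M => TangentSpace (𝓡 N) q →L[ℝ] TangentSpace (𝓡 N) q →L[ℝ] ℝ) q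
        (pullbackBilin (G (ψ q)) (mvfderiv (𝓡 N) ψ q))) p := by
  refine (contMDiffAt_hom_bundle (E₂ := fun q : M => TangentSpace (𝓡 N) q →L[ℝ] Bundle.Trivial M ℝ q) _).2 ?_
  refine ⟨contMDiffAt_id, ?_⟩
  have h1 : ContMDiffAt (𝓡 N) 𝓘(ℝ, F →L[ℝ] F →L[ℝ] ℝ) ∞ (fun q => G (ψ q)) p :=
    hG.contMDiffAt.comp p hψ
  have hD := contMDiffAt_mvfderiv_comp_tangentFrame hψ
  have h2 := (hD.clm_precomp (F₃ := ℝ)).clm_comp (h1.clm_comp hD)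
  refine h2.congr_of_eventuallyEq ?_
  filter_upwards [eventually_mem_baseSet (N := N) p] with q hq
  ext v w
  rw [inCoordinates_apply_eq₂ hq hq (by simp)]
  have h3 : ∀ v, (trivializationAt (Euc N) (TangentSpace (𝓡 N) : M → Type _) p).symm q v
      = tangentFrame p q v := fun v =>
    (Bundle.Trivialization.symmL_apply (hb := hq) ..).symm
  rw [h3, h3]
  simp
  rfl

omit [IsManifold (𝓡 N) ∞ M] in
/-- A local inverse of coordinates `ψ` near `p`, written in the preferred chart at `p`. -/
theorem exists_localInverse_of_isInvertible [CompleteSpace F]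
    (hψ : ContMDiffAt (𝓡 N) 𝓘(ℝ, F) ∞ ψ p) (hinv : (mvfderiv (𝓡 N) ψ p).IsInvertible) :
    ∃ Ψ : F → Euc N, ContDiffAt ℝ ∞ Ψ (ψ p) ∧ Ψ (ψ p) = extChartAt (𝓡 N) p p ∧
      ∀ᶠ q in 𝓝 p, Ψ (ψ q) = extChartAt (𝓡 N) p q := by
  have hs := contDiffAt_comp_extChartAt_symm hψ
  obtain ⟨e', he⟩ := hinv
  let e : Euc N ≃L[ℝ] F := e'
  have hd : HasFDerivAt (ψ ∘ (extChartAt (𝓡 N) p).symm) (e : Euc N →L[ℝ] F)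
      (extChartAt (𝓡 N) p p) := by
    have h := (hs.differentiableAt (by simp)).hasFDerivAt
    rw [← mfderiv_eq_fderiv_extChartAt (hψ.mdifferentiableAt (by simp))] at h
    have he' : (e : Euc N →L[ℝ] F) = (mfderiv (𝓡 N) 𝓘(ℝ, F) ψ p : Euc N →L[ℝ] F) := he
    rw [he']
    exact h
  have hp : (ψ ∘ (extChartAt (𝓡 N) p).symm) (extChartAt (𝓡 N) p p) = ψ p := by
    simp
  refine ⟨hs.localInverse hd (by simp), hp ▸ hs.to_localInverse hd (by simp), ?_, ?_⟩
  · rw [← hp]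
    exact hs.localInverse_apply_image hd (by simp)
  · have h1 := (hs.toOpenPartialHomeomorph _ hd (by simp)).open_source.eventually_mem
      (hs.mem_toOpenPartialHomeomorph_source hd (by simp))
    filter_upwards [(continuousAt_extChartAt (I := 𝓡 N) p).eventually h1,
      extChartAt_source_mem_nhds (I := 𝓡 N) p] with q hq hq'
    have h2 := (hs.toOpenPartialHomeomorph _ hd (by simp)).left_inv hq
    rw [hs.toOpenPartialHomeomorph_coe hd (by simp), Function.comp_apply,
      (extChartAt (𝓡 N) p).left_inv hq'] at h2
    exact h2

/-- A smooth vector field, in coordinates `ψ`, is a smooth function. -/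
theorem contMDiffAt_mvfderiv_apply {Y : ∀ q : M, TangentSpace (𝓡 N) q}
    (hψ : ContMDiffAt (𝓡 N) 𝓘(ℝ, F) ∞ ψ p) (hY : IsSmoothField Y) :
    ContMDiffAt (𝓡 N) 𝓘(ℝ, F) ∞ (fun q => mvfderiv (𝓡 N) ψ q (Y q)) p := by
  have h1 := (Bundle.contMDiffAt_section p).1 (hY p)
  refine ((contMDiffAt_mvfderiv_comp_tangentFrame hψ).clm_apply h1).congr_of_eventuallyEq ?_
  filter_upwards [eventually_mem_baseSet (N := N) p] with q hq
  have h2 : tangentFrame p q (tangentCoordinates p q (Y q)) = Y q :=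
    Bundle.Trivialization.symmL_continuousLinearMapAt _ hq (Y q)
  have h3 : tangentCoordinates p q (Y q)
      = (trivializationAt (Euc N) (TangentSpace (𝓡 N) : M → Type _) p ⟨q, Y q⟩).2 :=
    by
    rw [tangentCoordinates, Bundle.Trivialization.continuousLinearMapAt_apply,
      Bundle.Trivialization.coe_linearMapAt_of_mem _ hq]
  rw [← h3, ContinuousLinearMap.comp_apply, h2]

/-- In coordinates in which the vector field `ξ` is the constant field `e`, the bracket with `ξ` is
the derivative along `ξ`. -/
theorem mvfderiv_mlieBracket_of_const [CompleteSpace F] {e : F}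
    {ξ Y : ∀ q : M, TangentSpace (𝓡 N) q}
    (hψ : ContMDiffAt (𝓡 N) 𝓘(ℝ, F) ∞ ψ p)
    (hinv : ∀ᶠ q in 𝓝 p, (mvfderiv (𝓡 N) ψ q).IsInvertible)
    (hξ : ∀ᶠ q in 𝓝 p, mvfderiv (𝓡 N) ψ q (ξ q) = e) (hY : IsSmoothField Y) :
    mvfderiv (𝓡 N) ψ p (VectorField.mlieBracket (𝓡 N) ξ Y p)
      = mvfderiv (𝓡 N) (fun q => mvfderiv (𝓡 N) ψ q (Y q)) p (ξ p) := by
  obtain ⟨Ψ, hΨ, hΨp, hΨψ⟩ := exists_localInverse_of_isInvertible hψ hinv.self_of_nhds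
  set y : M → F := fun q => mvfderiv (𝓡 N) ψ q (Y q) with hy
  have hys : ContMDiffAt (𝓡 N) 𝓘(ℝ, F) ∞ y p := contMDiffAt_mvfderiv_apply hψ hY
  let Y' : F → F := (y ∘ (extChartAt (𝓡 N) p).symm) ∘ Ψ
  have hY's : ContDiffAt ℝ ∞ Y' (ψ p) :=
    ContDiffAt.comp (ψ p) (hΨp ▸ contDiffAt_comp_extChartAt_symm hys) hΨ
  have hyY' : y =ᶠ[𝓝 p] Y' ∘ ψ := by
    filter_upwards [hΨψ, extChartAt_source_mem_nhds (I := 𝓡 N) p] with q hq hq'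
    simp only [Y', Function.comp_apply, hq, (extChartAt (𝓡 N) p).left_inv hq']
  have hY' : Y =ᶠ[𝓝 p] VectorField.mpullback (𝓡 N) 𝓘(ℝ, F) ψ Y' := by
    filter_upwards [hinv, hyY'] with q hq hq'
    have h1 := hq.inverse_apply_self (Y q)
    exact h1.symm.trans (congrArg (fun w => (mvfderiv (𝓡 N) ψ q).inverse w) hq')
  have hξ' : ξ =ᶠ[𝓝 p] VectorField.mpullback (𝓡 N) 𝓘(ℝ, F) ψ (fun _ => e) := by
    filter_upwards [hinv, hξ] with q hq hq'
    have h1 := hq.inverse_apply_self (ξ q)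
    rw [hq'] at h1
    exact h1.symm
  have hdiff : ∀ V : F → F, ContDiffAt ℝ ∞ V (ψ p) →
      MDifferentiableAt 𝓘(ℝ, F) 𝓘(ℝ, F).tangent
        (fun x => (⟨x, V x⟩ : TangentBundle 𝓘(ℝ, F) F)) (ψ p) := by
    intro V hV
    exact (contMDiffAt_vectorSpace_iff_contDiffAt.2 hV).mdifferentiableAt (by simp)
  have h2le : minSmoothness ℝ 2 ≤ (∞ : WithTop ℕ∞) := by
    rw [minSmoothness_of_isRCLikeNormedField]
    exact WithTop.coe_le_coe.2 (le_top : (2 : ℕ∞) ≤ ⊤)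
  have : IsManifold (𝓡 N) (minSmoothness ℝ 2) M := IsManifold.of_le h2le
  -- on a vector space the bracket of a constant field with `Y'` is a directional derivative
  have hlie : ∀ V W : F → F, (VectorField.mlieBracket 𝓘(ℝ, F) V W (ψ p) : F)
      = VectorField.lieBracket ℝ V W (ψ p) := by
    intro V W
    have h := VectorField.mlieBracketWithin_eq_lieBracketWithin (𝕜 := ℝ) (E := F) (V := V)
      (W := W) (s := univ)
    rw [VectorField.lieBracketWithin_univ] at h
    exact congrFun h (ψ p)
  have hbr := VectorField.mpullback_mlieBracket (I := 𝓡 N) (I' := 𝓘(ℝ, F)) (n := ∞) (f := ψ)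
    (V := fun _ => e) (W := Y') (x₀ := p) (hdiff _ contDiffAt_const) (hdiff _ hY's)
    hψ h2le
  have h3 := hinv.self_of_nhds.self_apply_inverse
    (VectorField.mlieBracket 𝓘(ℝ, F) (fun _ => e) Y' (ψ p))
  have h4 : VectorField.lieBracket ℝ (fun _ => e) Y' (ψ p) = fderiv ℝ Y' (ψ p) e := by
    simp [VectorField.lieBracket]
  rw [hξ'.mlieBracket_vectorField_eq hY', ← hbr]
  refine h3.trans ((hlie _ _).trans (h4.trans ?_))
  rw [mvfderiv_congr hyY', mvfderiv_comp_of_differentiableAt (hY's.differentiableAt (by simp))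
    (hψ.mdifferentiableAt (by simp)), ContinuousLinearMap.comp_apply, hξ.self_of_nhds]

omit [IsManifold (𝓡 N) ∞ M] in
/-- The derivative at `p` of a smooth map, in the preferred chart at `p`. -/
theorem exists_hasFDerivAt_comp_extChartAt_symm {F : Type*} [NormedAddCommGroup F] [NormedSpace ℝ F]
    {f : M → F} (hf : ContMDiffAt (𝓡 N) 𝓘(ℝ, F) ∞ f p) :
    ∃ D : Euc N →L[ℝ] F, (∀ v : TangentSpace (𝓡 N) p, D v = mvfderiv (𝓡 N) f p v) ∧
      HasFDerivAt (f ∘ (extChartAt (𝓡 N) p).symm) D (extChartAt (𝓡 N) p p) := by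
  have h := ((contDiffAt_comp_extChartAt_symm hf).differentiableAt (by simp)).hasFDerivAt
  rw [← mfderiv_eq_fderiv_extChartAt (hf.mdifferentiableAt (by simp))] at h
  exact ⟨_, fun _ => rfl, h⟩

/-- A vector field that is constant in coordinates in which the bilinear form does not depend on
its direction preserves the bilinear form. -/
theorem mvfderiv_pullbackBilin_apply [CompleteSpace F] {e : F} {G : F → F →L[ℝ] F →L[ℝ] ℝ}
    {ξ Y Z : ∀ q : M, TangentSpace (𝓡 N) q}
    (hψ : ContMDiffAt (𝓡 N) 𝓘(ℝ, F) ∞ ψ p)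
    (hinv : ∀ᶠ q in 𝓝 p, (mvfderiv (𝓡 N) ψ q).IsInvertible)
    (hξ : ∀ᶠ q in 𝓝 p, mvfderiv (𝓡 N) ψ q (ξ q) = e)
    (hG : ContDiffAt ℝ ∞ G (ψ p)) (hGe : fderiv ℝ G (ψ p) e = 0)
    (hY : IsSmoothField Y) (hZ : IsSmoothField Z) :
    mvfderiv (𝓡 N) (fun q => pullbackBilin (G (ψ q)) (mvfderiv (𝓡 N) ψ q) (Y q) (Z q)) p (ξ p)
      = pullbackBilin (G (ψ p)) (mvfderiv (𝓡 N) ψ p)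
          (VectorField.mlieBracket (𝓡 N) ξ Y p) (Z p)
        + pullbackBilin (G (ψ p)) (mvfderiv (𝓡 N) ψ p) (Y p)
          (VectorField.mlieBracket (𝓡 N) ξ Z p) := by
  set y : M → F := fun q => mvfderiv (𝓡 N) ψ q (Y q) with hy
  set z : M → F := fun q => mvfderiv (𝓡 N) ψ q (Z q) with hz
  have hys : ContMDiffAt (𝓡 N) 𝓘(ℝ, F) ∞ y p := contMDiffAt_mvfderiv_apply hψ hY
  have hzs : ContMDiffAt (𝓡 N) 𝓘(ℝ, F) ∞ z p := contMDiffAt_mvfderiv_apply hψ hZ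
  have hGψ : ContMDiffAt (𝓡 N) 𝓘(ℝ, F →L[ℝ] F →L[ℝ] ℝ) ∞ (fun q => G (ψ q)) p :=
    hG.contMDiffAt.comp p hψ
  have hk : ContMDiffAt (𝓡 N) 𝓘(ℝ, ℝ) ∞ (fun q => G (ψ q) (y q) (z q)) p :=
    (hGψ.clm_apply hys).clm_apply hzs
  have hat : ∀ (f : M → F), (f ∘ (extChartAt (𝓡 N) p).symm) (extChartAt (𝓡 N) p p) = f p := by
    intro f
    simp
  obtain ⟨Dψ, hDψ, hψ'⟩ := exists_hasFDerivAt_comp_extChartAt_symm hψ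
  obtain ⟨Dy, hDy, hy'⟩ := exists_hasFDerivAt_comp_extChartAt_symm hys
  obtain ⟨Dz, hDz, hz'⟩ := exists_hasFDerivAt_comp_extChartAt_symm hzs
  obtain ⟨Dk, hDk, hk'⟩ := exists_hasFDerivAt_comp_extChartAt_symm hk
  have hG' : HasFDerivAt G (fderiv ℝ G (ψ p)) ((ψ ∘ (extChartAt (𝓡 N) p).symm)
      (extChartAt (𝓡 N) p p)) := by
    rw [hat]
    exact (hG.differentiableAt (by simp)).hasFDerivAt
  have h1 := hk'.unique (((hG'.comp _ hψ').clm_apply hy').clm_apply hz')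
  have h2 : ∀ v : Euc N, Dk v = G (ψ p) (y p) (Dz v)
      + (G (ψ p) (Dy v) (z p) + fderiv ℝ G (ψ p) (Dψ v) (y p) (z p)) := by
    intro v
    rw [h1]
    simp
  have h3 := h2 (ξ p)
  rw [hDk, hDψ, hDy, hDz, hξ.self_of_nhds, hGe] at h3
  have h4 : ∀ u v : TangentSpace (𝓡 N) p, pullbackBilin (G (ψ p)) (mvfderiv (𝓡 N) ψ p) u v
      = G (ψ p) (mvfderiv (𝓡 N) ψ p u) (mvfderiv (𝓡 N) ψ p v) := fun _ _ => rfl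
  rw [h4, h4, mvfderiv_mlieBracket_of_const hψ hinv hξ hY,
    mvfderiv_mlieBracket_of_const hψ hinv hξ hZ]
  refine h3.trans ?_
  rw [zero_apply, zero_apply, add_zero, add_comm]

end PulledBackTensors

/-! ### The exterior derivative of the connection form -/

section Curvature

/-- `d² = 0` on functions. -/
theorem extDeriv_ofSubsingleton_fderiv {E : Type*} [NormedAddCommGroup E] [NormedSpace ℝ E]
    {a : E → ℝ} {x : E} (ha : ContDiffAt ℝ ∞ a x) :
    extDeriv (fun y => ContinuousAlternatingMap.ofSubsingleton ℝ E ℝ (0 : Fin 1) (fderiv ℝ a y)) x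
      = 0 := by
  have h : (fun y => ContinuousAlternatingMap.ofSubsingleton ℝ E ℝ (0 : Fin 1) (fderiv ℝ a y))
      = extDeriv (fun y => ContinuousAlternatingMap.constOfIsEmpty ℝ E (Fin 0) (a y)) :=
    funext fun y => (extDeriv_constOfIsEmpty a y).symm
  rw [h]
  have hs : ContDiffAt ℝ ∞ (fun y => ContinuousAlternatingMap.constOfIsEmpty ℝ E (Fin 0) (a y)) x :=
    (ContinuousAlternatingMap.constOfIsEmptyLIE ℝ E ℝ (Fin 0)).contDiff.contDiffAt.comp x ha
  refine extDeriv_extDeriv_apply hs ?_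
  rw [minSmoothness_of_isRCLikeNormedField]
  exact WithTop.coe_le_coe.2 (le_top : (2 : ℕ∞) ≤ ⊤)

variable {N : ℕ} {M : Type*} [TopologicalSpace M] [ChartedSpace (Euc N) M]
  [IsManifold (𝓡 N) ∞ M] {p : M}

/-- The chain rule for a function read in the preferred chart at `p`, at all points near `p`. -/
theorem eventually_mvfderiv_comp_mfderiv_extChartAt_symm {F : Type*} [NormedAddCommGroup F]
    [NormedSpace ℝ F] {f : M → F} (hf : ContMDiffAt (𝓡 N) 𝓘(ℝ, F) ∞ f p) :
    ∀ᶠ x in 𝓝 (extChartAt (𝓡 N) p p), ∀ v : Euc N,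
      mvfderiv (𝓡 N) f ((extChartAt (𝓡 N) p).symm x)
        (mfderiv 𝓘(ℝ, Euc N) (𝓡 N) (extChartAt (𝓡 N) p).symm x v)
      = fderiv ℝ (f ∘ (extChartAt (𝓡 N) p).symm) x v := by
  have h1 : ∀ᶠ q in 𝓝 p, ContMDiffAt (𝓡 N) 𝓘(ℝ, F) 1 f q :=
    (contMDiffAt_iff_contMDiffAt_nhds (by simp)).1 (hf.of_le (by norm_num))
  filter_upwards [eventually_extChartAt_symm h1,
    (isOpen_extChartAt_target (I := 𝓡 N) p).mem_nhds (mem_extChartAt_target p)] with x hx hxt v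
  have h2 : MDifferentiableAt 𝓘(ℝ, Euc N) (𝓡 N) (extChartAt (𝓡 N) p).symm x :=
    ((contMDiffOn_extChartAt_symm (n := ∞) p).contMDiffAt
      ((isOpen_extChartAt_target (I := 𝓡 N) p).mem_nhds hxt)).mdifferentiableAt (by simp)
  have h3 := mfderiv_comp x (hx.mdifferentiableAt (by simp)) h2
  rw [mfderiv_eq_fderiv] at h3
  exact (congrArg (fun L : Euc N →L[ℝ] F => L v) h3).symm

/-- The exterior derivative of `da + f^*β` is `f^*dβ`. -/
theorem oneFormDeriv_eq {d : ℕ} {η : ∀ q : M, TangentSpace (𝓡 N) q →L[ℝ] ℝ} {a : M → ℝ}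
    {f : M → Euc d} {β : Euc d → (Euc d) [⋀^Fin 1]→L[ℝ] ℝ}
    (ha : ContMDiffAt (𝓡 N) 𝓘(ℝ, ℝ) ∞ a p) (hf : ContMDiffAt (𝓡 N) (𝓡 d) ∞ f p)
    (hβ : DifferentiableAt ℝ β (f p))
    (hη : ∀ᶠ q in 𝓝 p, ∀ v : TangentSpace (𝓡 N) q,
      η q v = mvfderiv (𝓡 N) a q v + β (f q) ![mvfderiv (𝓡 N) f q v])
    (u v : TangentSpace (𝓡 N) p) :
    oneFormDeriv η p u v
      = extDeriv β (f p) ![mvfderiv (𝓡 N) f p u, mvfderiv (𝓡 N) f p v] := by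
  have has := contDiffAt_comp_extChartAt_symm ha
  have hfs := contDiffAt_comp_extChartAt_symm hf
  have h2le : minSmoothness ℝ 2 ≤ (∞ : WithTop ℕ∞) := by
    rw [minSmoothness_of_isRCLikeNormedField]
    exact WithTop.coe_le_coe.2 (le_top : (2 : ℕ∞) ≤ ⊤)
  have hp : (f ∘ (extChartAt (𝓡 N) p).symm) (extChartAt (𝓡 N) p p) = f p := by simp
  -- in the preferred chart at `p`, `η` is `da + f^*β` for the coordinate expressions of `a` and `f`
  have hev : (fun x : Euc N => ContinuousAlternatingMap.ofSubsingleton ℝ (Euc N) ℝ (0 : Fin 1)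
      ((η ((extChartAt (𝓡 N) p).symm x)).comp
        (mfderiv 𝓘(ℝ, Euc N) (𝓡 N) (extChartAt (𝓡 N) p).symm x)))
      =ᶠ[𝓝 (extChartAt (𝓡 N) p p)]
      (fun x => ContinuousAlternatingMap.ofSubsingleton ℝ (Euc N) ℝ (0 : Fin 1)
        (fderiv ℝ (a ∘ (extChartAt (𝓡 N) p).symm) x)) +
      (fun x => (β ((f ∘ (extChartAt (𝓡 N) p).symm) x)).compContinuousLinearMap
        (fderiv ℝ (f ∘ (extChartAt (𝓡 N) p).symm) x)) := by
    filter_upwards [eventually_extChartAt_symm hη,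
      eventually_mvfderiv_comp_mfderiv_extChartAt_symm ha,
      eventually_mvfderiv_comp_mfderiv_extChartAt_symm hf] with x h1 h2 h3
    ext w
    have h4 := h1 (mfderiv 𝓘(ℝ, Euc N) (𝓡 N) (extChartAt (𝓡 N) p).symm x (w 0))
    rw [h2, h3] at h4
    refine h4.trans ?_
    have h5 : (fderiv ℝ (f ∘ (extChartAt (𝓡 N) p).symm) x) ∘ w
        = ![fderiv ℝ (f ∘ (extChartAt (𝓡 N) p).symm) x (w 0)] := by
      ext i
      fin_cases i
      rfl
    rw [← h5]
    rfl
  have hd1 : DifferentiableAt ℝ (fun x => ContinuousAlternatingMap.ofSubsingleton ℝ (Euc N) ℝ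
      (0 : Fin 1) (fderiv ℝ (a ∘ (extChartAt (𝓡 N) p).symm) x)) (extChartAt (𝓡 N) p p) := by
    have h := (has.fderiv_right (m := 1) (WithTop.coe_le_coe.2 (le_top : (2 : ℕ∞) ≤ ⊤))).differentiableAt (by simp)
    exact (ContinuousAlternatingMap.ofSubsingletonLIE (𝕜 := ℝ) (E := Euc N) (F := ℝ)
      (0 : Fin 1)).toContinuousLinearEquiv.differentiableAt.comp _ h
  have hd2 : DifferentiableAt ℝ (fun x => (β ((f ∘ (extChartAt (𝓡 N) p).symm)
      x)).compContinuousLinearMap (fderiv ℝ (f ∘ (extChartAt (𝓡 N) p).symm) x))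
      (extChartAt (𝓡 N) p p) := by
    exact (DifferentiableAt.comp _ (hp ▸ hβ) (hfs.differentiableAt (by simp)))
      |>.continuousAlternatingMapCompContinuousLinearMap
      ((hfs.fderiv_right (m := 1) (WithTop.coe_le_coe.2
        (le_top : (2 : ℕ∞) ≤ ⊤))).differentiableAt (by simp))
  rw [oneFormDeriv, hev.extDeriv_eq, extDeriv_add hd1 hd2, extDeriv_ofSubsingleton_fderiv has,
    zero_add, extDeriv_pullback (hp ▸ hβ) hfs h2le, hp]
  have h6 : ∀ w : TangentSpace (𝓡 N) p, mvfderiv (𝓡 N) f p w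
      = fderiv ℝ (f ∘ (extChartAt (𝓡 N) p).symm) (extChartAt (𝓡 N) p p) w := fun w =>
    congrArg (fun L : Euc N →L[ℝ] Euc d => L w)
      (mfderiv_eq_fderiv_extChartAt (hf.mdifferentiableAt (by simp)))
  rw [h6, h6, ContinuousAlternatingMap.compContinuousLinearMap_apply]
  congr 1
  ext i
  fin_cases i <;> rfl

end Curvature

/-! ### The tensors of the K-contact structure in an adapted chart -/

section ContactTensors

variable {E : Type*} [NormedAddCommGroup E] [NormedSpace ℝ E]

/-- The contact form `ds + β` on `ℝ × E`, at a point. -/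
def contactForm (β : E →L[ℝ] ℝ) : ℝ × E →L[ℝ] ℝ :=
  ContinuousLinearMap.fst ℝ ℝ E + β.comp (ContinuousLinearMap.snd ℝ ℝ E)

/-- The endomorphism of `ℝ × E`, with values in the kernel of `ds + β`, that lifts `-J`. -/
def contactEndomorphism (β : E →L[ℝ] ℝ) (J : E →L[ℝ] E) : ℝ × E →L[ℝ] ℝ × E :=
  ((β.comp J).prod (-J)).comp (ContinuousLinearMap.snd ℝ ℝ E)

/-- The metric `g + (ds + β)²` on `ℝ × E`, at a point. -/
def contactMetric (β : E →L[ℝ] ℝ) (g : E →L[ℝ] E →L[ℝ] ℝ) : ℝ × E →L[ℝ] ℝ × E →L[ℝ] ℝ :=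
  (ContinuousLinearMap.precomp ℝ (ContinuousLinearMap.snd ℝ ℝ E)).comp
      (g.comp (ContinuousLinearMap.snd ℝ ℝ E))
    + (contactForm β).smulRight (contactForm β)

theorem contactForm_apply (β : E →L[ℝ] ℝ) (w : ℝ × E) : contactForm β w = w.1 + β w.2 := rfl

theorem contactEndomorphism_apply (β : E →L[ℝ] ℝ) (J : E →L[ℝ] E) (w : ℝ × E) :
    contactEndomorphism β J w = (β (J w.2), -J w.2) := rfl

theorem contactMetric_apply (β : E →L[ℝ] ℝ) (g : E →L[ℝ] E →L[ℝ] ℝ) (w w' : ℝ × E) :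
    contactMetric β g w w' = g w.2 w'.2 + contactForm β w * contactForm β w' := rfl

variable {F : Type*} [NormedAddCommGroup F] [NormedSpace ℝ F] {x : F}
  {β : F → E →L[ℝ] ℝ} {J : F → E →L[ℝ] E} {g : F → E →L[ℝ] E →L[ℝ] ℝ}

theorem contDiffAt_contactForm (hβ : ContDiffAt ℝ ∞ β x) :
    ContDiffAt ℝ ∞ (fun y => contactForm (β y)) x :=
  contDiffAt_const.add (hβ.clm_comp contDiffAt_const)

theorem contDiffAt_contactEndomorphism (hβ : ContDiffAt ℝ ∞ β x) (hJ : ContDiffAt ℝ ∞ J x) :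
    ContDiffAt ℝ ∞ (fun y => contactEndomorphism (β y) (J y)) x := by
  have h1 := (ContinuousLinearMap.prodₗᵢ (𝕜 := ℝ) (E := E) (F := ℝ) (G := E)
    ℝ).toContinuousLinearEquiv.contDiff.contDiffAt.comp x
    ((hβ.clm_comp hJ).prodMk hJ.neg)
  exact h1.clm_comp contDiffAt_const

theorem contDiffAt_contactMetric (hβ : ContDiffAt ℝ ∞ β x) (hg : ContDiffAt ℝ ∞ g x) :
    ContDiffAt ℝ ∞ (fun y => contactMetric (β y) (g y)) x := by
  have h := contDiffAt_contactForm hβ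
  exact (contDiffAt_const.clm_comp (hg.clm_comp contDiffAt_const)).add (h.smulRight h)

end ContactTensors

namespace AdaptedChart

variable {X : Type*} [TopologicalSpace X] {d : ℕ} {O : OrientedOrbifold X d}
  {M : Type*} [TopologicalSpace M] [ChartedSpace (Euc (d + 1)) M] [MulAction Circle M]
  {o : ManifoldOrientation (d + 1) M} [ContMDiffSMul (𝓡 1) (𝓡 (d + 1)) ∞ Circle M]
  {S : SeifertBundle O o} {Ω : OrbiForm O univ 2} {D : ConnectionData S Ω} {p r q : M}

/-- The coordinates `(a, f)`. -/
def ψ (A : AdaptedChart D p) (q : M) : ℝ × Euc d := (A.a q, A.f q)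

theorem contMDiffAt_ψ (A : AdaptedChart D p) (hq : q ∈ A.W) :
    ContMDiffAt (𝓡 (d + 1)) 𝓘(ℝ, ℝ × Euc d) ∞ A.ψ q :=
  (A.a_smooth q hq).prodMk_space (A.isLiftAt q hq).smooth

theorem mvfderiv_ψ (A : AdaptedChart D p) (hq : q ∈ A.W) (v : TangentSpace (𝓡 (d + 1)) q) :
    mvfderiv (𝓡 (d + 1)) A.ψ q v
      = (mvfderiv (𝓡 (d + 1)) A.a q v, mvfderiv (𝓡 (d + 1)) A.f q v) := by
  have hm := (A.contMDiffAt_ψ hq).mdifferentiableAt (by simp)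
  have h1 := mvfderiv_comp_of_differentiableAt (φ := (Prod.fst : ℝ × Euc d → ℝ))
    differentiableAt_fst hm
  have h2 := mvfderiv_comp_of_differentiableAt (φ := (Prod.snd : ℝ × Euc d → Euc d))
    differentiableAt_snd hm
  rw [fderiv_fst] at h1
  rw [fderiv_snd] at h2
  have h1' : mvfderiv (𝓡 (d + 1)) A.a q v = (mvfderiv (𝓡 (d + 1)) A.ψ q v).1 :=
    congrArg (fun L : TangentSpace (𝓡 (d + 1)) q →L[ℝ] ℝ => L v) h1
  have h2' : mvfderiv (𝓡 (d + 1)) A.f q v = (mvfderiv (𝓡 (d + 1)) A.ψ q v).2 :=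
    congrArg (fun L : TangentSpace (𝓡 (d + 1)) q →L[ℝ] Euc d => L v) h2
  rw [h1', h2']

theorem isInvertible_mvfderiv_ψ (A : AdaptedChart D p) (hq : q ∈ A.W) :
    (mvfderiv (𝓡 (d + 1)) A.ψ q).IsInvertible := by
  let L : Euc (d + 1) →L[ℝ] ℝ × Euc d := mvfderiv (𝓡 (d + 1)) A.ψ q
  have hinj : Function.Injective L := by
    refine (injective_iff_map_eq_zero L).2 fun v hv => ?_
    have h := (A.mvfderiv_ψ hq v).symm.trans hv
    rw [Prod.mk_eq_zero] at h
    exact A.injective q hq v h.1 h.2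
  have hdim : Module.finrank ℝ (Euc (d + 1)) = Module.finrank ℝ (ℝ × Euc d) := by
    simp [add_comm]
  exact ⟨(LinearEquiv.ofInjectiveOfFinrankEq (L : Euc (d + 1) →ₗ[ℝ] ℝ × Euc d) hinj
    hdim).toContinuousLinearEquiv, rfl⟩

/-- The primitive `β` in an adapted chart. -/
def β (A : AdaptedChart D p) (q : M) : Euc d →L[ℝ] ℝ := (D.β (S.π p)).linear A.c (A.f q)

theorem η_eq_contactForm (A : AdaptedChart D p) (hq : q ∈ A.W) (v : TangentSpace (𝓡 (d + 1)) q) :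
    A.η q v = contactForm (A.β q) (mvfderiv (𝓡 (d + 1)) A.ψ q v) := by
  rw [A.mvfderiv_ψ hq]
  rfl

/-- A tangent vector is determined by its value under the connection form and its projection. -/
theorem ext_of_η (A : AdaptedChart D p) (hq : q ∈ A.W) {u v : TangentSpace (𝓡 (d + 1)) q}
    (h : A.η q u = A.η q v)
    (h' : mvfderiv (𝓡 (d + 1)) A.f q u = mvfderiv (𝓡 (d + 1)) A.f q v) : u = v := by
  rw [η_apply, η_apply, h'] at h
  refine sub_eq_zero.1 (A.injective q hq _ ?_ ?_)
  · rw [map_sub, sub_eq_zero]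
    exact add_right_cancel h
  · rw [map_sub, h', sub_self]

/-- The Reeb field. -/
def ξ (A : AdaptedChart D p) (q : M) : TangentSpace (𝓡 (d + 1)) q :=
  (mvfderiv (𝓡 (d + 1)) A.ψ q).inverse (1, 0)

theorem mvfderiv_ψ_ξ (A : AdaptedChart D p) (hq : q ∈ A.W) :
    mvfderiv (𝓡 (d + 1)) A.ψ q (A.ξ q) = (1, 0) :=
  (A.isInvertible_mvfderiv_ψ hq).self_apply_inverse _

theorem mvfderiv_f_ξ (A : AdaptedChart D p) (hq : q ∈ A.W) :
    mvfderiv (𝓡 (d + 1)) A.f q (A.ξ q) = 0 := by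
  have h := A.mvfderiv_ψ_ξ hq
  rw [A.mvfderiv_ψ hq] at h
  exact congrArg Prod.snd h

theorem η_ξ (A : AdaptedChart D p) (hq : q ∈ A.W) : A.η q (A.ξ q) = 1 := by
  rw [A.η_eq_contactForm hq, A.mvfderiv_ψ_ξ hq, contactForm_apply]
  simp

theorem ξ_eq (hfin : ∃ N : ℕ, 0 < N ∧ O.IsIsotropyMultiple N) (A : AdaptedChart D p)
    (B : AdaptedChart D r) (hA : q ∈ A.W) (hB : q ∈ B.W) : A.ξ q = B.ξ q := by
  refine A.ext_of_η hA ?_ ?_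
  · rw [A.η_ξ hA, η_eq hfin A B hA hB, B.η_ξ hB]
  · have h := ((A.isLiftAt q hA).liftRel (B.isLiftAt q hB)).eq_iff 0 (B.ξ q)
    rw [map_zero, map_zero, B.mvfderiv_f_ξ hB] at h
    rw [A.mvfderiv_f_ξ hA, h.2 rfl]

theorem contDiffAt_β (A : AdaptedChart D p) (hq : q ∈ A.W) :
    ContDiffAt ℝ ∞ (fun x : ℝ × Euc d => (D.β (S.π p)).linear A.c x.2) (A.ψ q) := by
  have hl := A.isLiftAt q hq
  have h1 : ContDiffAt ℝ ∞ ((D.β (S.π p)).form A.c) (A.f q) :=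
    ((D.β (S.π p)).smooth A.c hl.mem_atlas).contDiffAt
      ((A.c.isOpen_dom_inter (D.isOpen _)).mem_nhds
        ⟨hl.mem_dom, by rw [mem_preimage, hl.toFun_eq]; exact A.mem_U q hq⟩)
  exact (ContinuousAlternatingMap.ofSubsingletonLIE (𝕜 := ℝ) (E := Euc d) (F := ℝ)
    (0 : Fin 1)).symm.toContinuousLinearEquiv.contDiff.contDiffAt.comp _
    (ContDiffAt.comp (A.ψ q) h1 contDiffAt_snd)

variable [IsManifold (𝓡 (d + 1)) ∞ M]

theorem contMDiffAt_η (A : AdaptedChart D p) :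
    ContMDiffAt (𝓡 (d + 1)) ((𝓡 (d + 1)).prod 𝓘(ℝ, Euc (d + 1) →L[ℝ] ℝ)) ∞
      (fun q => Bundle.TotalSpace.mk' (Euc (d + 1) →L[ℝ] ℝ)
        (E := fun q : M => TangentSpace (𝓡 (d + 1)) q →L[ℝ] Bundle.Trivial M ℝ q) q (A.η q)) p := by
  have hα : ContDiffAt ℝ ∞ (fun x : ℝ × Euc d =>
      contactForm ((D.β (S.π p)).linear A.c x.2)) (A.ψ p) :=
    contDiffAt_contactForm (A.contDiffAt_β A.mem)
  refine (contMDiffAt_pullback_oneForm (A.contMDiffAt_ψ A.mem) hα).congr_of_eventuallyEq ?_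
  filter_upwards [A.isOpen.mem_nhds A.mem] with q hq
  congr 1
  ext v
  exact A.η_eq_contactForm hq v

theorem contMDiffAt_ξ (A : AdaptedChart D p) :
    ContMDiffAt (𝓡 (d + 1)) (𝓡 (d + 1)).tangent ∞
      (fun q => (⟨q, A.ξ q⟩ : TangentBundle (𝓡 (d + 1)) M)) p := by
  have hV : ContMDiffAt 𝓘(ℝ, ℝ × Euc d) 𝓘(ℝ, ℝ × Euc d).tangent ∞
      (fun x => (⟨x, ((1, 0) : ℝ × Euc d)⟩ : TangentBundle 𝓘(ℝ, ℝ × Euc d) (ℝ × Euc d))) (A.ψ p) :=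
    contMDiffAt_vectorSpace_iff_contDiffAt.2 contDiffAt_const
  exact hV.mpullback_vectorField_preimage (A.contMDiffAt_ψ A.mem) (A.isInvertible_mvfderiv_ψ A.mem)
    (by simp)

/-- The exterior derivative of the connection form is the pull-back of the symplectic form. -/
theorem oneFormDeriv_eq_pullback (A : AdaptedChart D p)
    {η : ∀ q : M, TangentSpace (𝓡 (d + 1)) q →L[ℝ] ℝ} (hη : ∀ᶠ q in 𝓝 p, η q = A.η q)
    (u v : TangentSpace (𝓡 (d + 1)) p) :
    oneFormDeriv η p u v = Ω.form A.c (A.f p)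
      ![mvfderiv (𝓡 (d + 1)) A.f p u, mvfderiv (𝓡 (d + 1)) A.f p v] := by
  have hl := A.isLiftAt p A.mem
  have hU : A.c.toFun (A.f p) ∈ D.U (S.π p) := by
    rw [hl.toFun_eq]
    exact D.mem _
  have h1 : ContDiffAt ℝ ∞ ((D.β (S.π p)).form A.c) (A.f p) :=
    ((D.β (S.π p)).smooth A.c hl.mem_atlas).contDiffAt
      ((A.c.isOpen_dom_inter (D.isOpen _)).mem_nhds ⟨hl.mem_dom, hU⟩)
  rw [oneFormDeriv_eq (a := A.a) (f := A.f) (A.a_smooth p A.mem) hl.smooth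
    (h1.differentiableAt (by simp)) (by
      filter_upwards [hη] with q hq v
      rw [hq, η_apply]), D.extDeriv_β _ _ hl.mem_atlas _ hl.mem_dom hU]

end AdaptedChart

/-! ### Orientations and the contact condition -/

section Wedge

variable {T : Type*} [AddCommGroup T] [Module ℝ T]

/-- The product whose antisymmetrisation is `Bⁿ` is multilinear. -/
theorem exists_multilinear_prod (B : T →ₗ[ℝ] T →ₗ[ℝ] ℝ) (n : ℕ) :
    ∃ m : MultilinearMap ℝ (fun _ : Fin (2 * n) => T) ℝ, ∀ v,
      m v = ∏ i : Fin n, B (v ⟨2 * i, by omega⟩) (v ⟨2 * i + 1, by omega⟩) := by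
  induction n with
  | zero =>
    have : IsEmpty (Fin (2 * 0)) := Fin.isEmpty
    exact ⟨MultilinearMap.constOfIsEmpty ℝ _ 1, fun v => by simp⟩
  | succ n ih =>
    obtain ⟨m, hm⟩ := ih
    let L : T →ₗ[ℝ] MultilinearMap ℝ (fun _ : Fin (2 * n + 1) => T) ℝ :=
      { toFun := fun u => ((B u).smulRight m).uncurryLeft
        map_add' := fun u u' => by
          ext v
          simp [add_mul]
        map_smul' := fun r u => by
          ext v
          simp [mul_assoc] }
    refine ⟨L.uncurryLeft, fun v => ?_⟩
    rw [Fin.prod_univ_succ]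
    exact congrArg (fun x => B (v 0) (v 1) * x) (hm fun i => v i.succ.succ)

theorem exists_alternating_wedgePow (B : T →ₗ[ℝ] T →ₗ[ℝ] ℝ) (n : ℕ) :
    ∃ Θ : T [⋀^Fin (2 * n)]→ₗ[ℝ] ℝ, ∀ v, Θ v = wedgePow (fun u w => B u w) v := by
  obtain ⟨m, hm⟩ := exists_multilinear_prod B n
  refine ⟨MultilinearMap.alternatization m, fun v => ?_⟩
  rw [MultilinearMap.alternatization_apply, wedgePow]
  refine Finset.sum_congr rfl fun σ _ => ?_
  rw [MultilinearMap.domDomCongr_apply, hm, Units.smul_def, zsmul_eq_mul]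

theorem exists_alternating_wedgeContact (η : T →ₗ[ℝ] ℝ) (B : T →ₗ[ℝ] T →ₗ[ℝ] ℝ) (n : ℕ) :
    ∃ Θ : T [⋀^Fin (2 * n + 1)]→ₗ[ℝ] ℝ, ∀ v, Θ v = wedgeContact η (fun u w => B u w) v := by
  obtain ⟨m, hm⟩ := exists_multilinear_prod B n
  let m' : MultilinearMap ℝ (fun _ : Fin (2 * n + 1) => T) ℝ := (η.smulRight m).uncurryLeft
  refine ⟨MultilinearMap.alternatization m', fun v => ?_⟩
  rw [MultilinearMap.alternatization_apply, wedgeContact]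
  refine Finset.sum_congr rfl fun σ _ => ?_
  rw [MultilinearMap.domDomCongr_apply, Units.smul_def, zsmul_eq_mul, LinearMap.uncurryLeft_apply,
    LinearMap.smulRight_apply, smul_apply, smul_eq_mul, hm]
  rfl

/-- The sign of `η ∧ Bⁿ` on a basis depends only on the orientation of the basis. -/
theorem wedgeContact_pos_of_orientation_eq {n : ℕ} (η : T →ₗ[ℝ] ℝ) (B : T →ₗ[ℝ] T →ₗ[ℝ] ℝ)
    (b b' : Module.Basis (Fin (2 * n + 1)) ℝ T) (h : b.orientation = b'.orientation)
    (hb : 0 < wedgeContact η (fun u w => B u w) b) :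
    0 < wedgeContact η (fun u w => B u w) b' := by
  obtain ⟨Θ, hΘ⟩ := exists_alternating_wedgeContact η B n
  rw [← hΘ] at hb ⊢
  rw [Θ.eq_smul_basis_det b, AlternatingMap.smul_apply, smul_eq_mul]
  exact mul_pos hb ((b.orientation_eq_iff_det_pos b').1 h)

/-- A top form is multiplied by the determinant under a linear map. -/
theorem wedgePow_comp {n : ℕ} (B : T →ₗ[ℝ] T →ₗ[ℝ] ℝ) (b : Module.Basis (Fin (2 * n)) ℝ T)
    (A : T →ₗ[ℝ] T) :
    wedgePow (fun u w => B u w) (A ∘ b) = LinearMap.det A * wedgePow (fun u w => B u w) b := by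
  obtain ⟨Θ, hΘ⟩ := exists_alternating_wedgePow B n
  rw [← hΘ, ← hΘ, Θ.eq_smul_basis_det b, AlternatingMap.smul_apply, AlternatingMap.smul_apply,
    b.det_comp, smul_eq_mul, smul_eq_mul]
  ring

omit [AddCommGroup T] [Module ℝ T] in
/-- On a basis whose first vector is in the kernel of `B`, the value of `η ∧ Bⁿ` is that of `η`
on this vector, times that of `Bⁿ` on the other vectors. -/
theorem wedgeContact_eq_mul_wedgePow {n : ℕ} (η : T → ℝ) (B : T → T → ℝ)
    (v : Fin (2 * n + 1) → T) (h : ∀ u, B (v 0) u = 0) (h' : ∀ u, B u (v 0) = 0) :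
    wedgeContact η B v = η (v 0) * wedgePow B (fun i => v i.succ) := by
  rw [wedgeContact, ← Equiv.sum_comp (Equiv.Perm.decomposeFin (n := 2 * n)).symm,
    Fintype.sum_prod_type, Finset.sum_eq_single 0]
  · rw [wedgePow, Finset.mul_sum]
    refine Finset.sum_congr rfl fun e _ => ?_
    have h1 : ∀ (k : ℕ) (hk : k + 1 < 2 * n + 1),
        Equiv.Perm.decomposeFin.symm ((0 : Fin (2 * n + 1)), e) ⟨k + 1, hk⟩
          = (e ⟨k, by omega⟩).succ := by
      intro k hk
      have := Equiv.Perm.decomposeFin_symm_apply_succ e (0 : Fin (2 * n + 1)) ⟨k, by omega⟩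
      rw [Equiv.swap_self] at this
      exact this
    simp only [h1, Equiv.Perm.decomposeFin_symm_apply_zero, Equiv.Perm.decomposeFin.symm_sign,
      if_true, one_mul]
    ring
  · intro k _ hk
    refine Finset.sum_eq_zero fun e _ => ?_
    -- a permutation with `σ 0 ≠ 0` puts `v 0` into one of the factors `B`
    set σ := Equiv.Perm.decomposeFin.symm (k, e) with hσ
    have h0 : σ 0 = k := Equiv.Perm.decomposeFin_symm_apply_zero k e
    have hx : σ.symm 0 ≠ 0 := by
      intro hx
      rw [Equiv.symm_apply_eq, h0] at hx
      exact hk hx.symm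
    have hlt := (σ.symm 0).2
    have hne : (σ.symm 0 : ℕ) ≠ 0 := fun h => hx (Fin.ext h)
    have hprod : ∏ i : Fin n, B (v (σ ⟨2 * i + 1, by omega⟩)) (v (σ ⟨2 * i + 2, by omega⟩)) = 0 := by
      refine Finset.prod_eq_zero (i := ⟨((σ.symm 0 : ℕ) - 1) / 2, by omega⟩) (Finset.mem_univ _) ?_
      rcases Nat.even_or_odd' (σ.symm 0 : ℕ) with ⟨j, hj | hj⟩
      · have h2 : (⟨2 * (((σ.symm 0 : ℕ) - 1) / 2) + 2, by omega⟩ : Fin (2 * n + 1)) = σ.symm 0 :=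
          Fin.ext (by simp only; omega)
        simp only [h2, Equiv.apply_symm_apply, h']
      · have h2 : (⟨2 * (((σ.symm 0 : ℕ) - 1) / 2) + 1, by omega⟩ : Fin (2 * n + 1)) = σ.symm 0 :=
          Fin.ext (by simp only; omega)
        simp only [h2, Equiv.apply_symm_apply, h]
    rw [hprod, mul_zero, mul_zero]
  · simp

end Wedge

/-! ### The K-contact structure -/

namespace AlmostKahler

variable {X : Type*} [TopologicalSpace X] {n : ℕ} {O : OrientedOrbifold X (2 * n)}
  (K : AlmostKahler O) {c : OrbifoldChart X (2 * n)} {z : Euc (2 * n)}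

/-- The symplectic form in a chart, as a bilinear form. It is defined by `Ω (u, v) = g (u, -J v)`,
which is bilinear by construction. -/
def bilin (c : OrbifoldChart X (2 * n)) (z : Euc (2 * n)) :
    Euc (2 * n) →ₗ[ℝ] Euc (2 * n) →ₗ[ℝ] ℝ :=
  LinearMap.mk₂ ℝ (fun u v => K.g c z u (-K.J c z v)) (by simp) (by simp)
    (by intro u v w; simp only [map_add, neg_add]) (by intro r u v; simp)

theorem bilin_apply (hc : c ∈ O.atlas) (hz : z ∈ c.dom) (u v : Euc (2 * n)) :
    K.bilin c z u v = K.Ω.form c z ![u, v] := by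
  have h : K.bilin c z u v = K.g c z u (-K.J c z v) := rfl
  rw [h, K.g_eq c hc z hz, map_neg, K.J_sq c hc z hz, neg_neg]

theorem bilin_swap (hc : c ∈ O.atlas) (hz : z ∈ c.dom) (u v : Euc (2 * n)) :
    K.bilin c z u v = -K.bilin c z v u := by
  rw [K.bilin_apply hc hz, K.bilin_apply hc hz]
  have h := (K.Ω.form c z).toAlternatingMap.map_swap ![v, u] (zero_ne_one (α := Fin 2))
  have h' : ![v, u] ∘ Equiv.swap (0 : Fin 2) 1 = ![u, v] := by
    ext i
    fin_cases i <;> rfl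
  rw [h'] at h
  exact h

theorem bilin_neg_J_left (hc : c ∈ O.atlas) (hz : z ∈ c.dom) (u v : Euc (2 * n)) :
    K.bilin c z (-K.J c z u) v = K.g c z u v := by
  rw [map_neg, LinearMap.neg_apply, ← K.bilin_swap hc hz, K.bilin_apply hc hz,
    ← K.g_eq c hc z hz, K.g_symm c hc z hz]

theorem bilin_neg_J_neg_J (hc : c ∈ O.atlas) (hz : z ∈ c.dom) (u v : Euc (2 * n)) :
    K.bilin c z (-K.J c z u) (-K.J c z v) = K.bilin c z u v := by
  rw [K.bilin_neg_J_left hc hz]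
  rfl

end AlmostKahler

namespace AdaptedChart

variable {X : Type*} [TopologicalSpace X] {n : ℕ} {O : OrientedOrbifold X (2 * n)}
  {M : Type*} [TopologicalSpace M] [ChartedSpace (Euc (2 * n + 1)) M] [MulAction Circle M]
  {o : ManifoldOrientation (2 * n + 1) M} [ContMDiffSMul (𝓡 1) (𝓡 (2 * n + 1)) ∞ Circle M]
  {S : SeifertBundle O o} {K : AlmostKahler O} {D : ConnectionData S K.Ω} {p r q : M}

/-- The endomorphism `Φ`: it has values in the kernel of `η`, and lifts `-J`. -/
def Φ (A : AdaptedChart D p) (q : M) :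
    TangentSpace (𝓡 (2 * n + 1)) q →L[ℝ] TangentSpace (𝓡 (2 * n + 1)) q :=
  (mvfderiv (𝓡 (2 * n + 1)) A.ψ q).inverse.comp
    ((contactEndomorphism (A.β q) (K.J A.c (A.f q))).comp (mvfderiv (𝓡 (2 * n + 1)) A.ψ q))

theorem mvfderiv_ψ_Φ (A : AdaptedChart D p) (hq : q ∈ A.W)
    (v : TangentSpace (𝓡 (2 * n + 1)) q) :
    mvfderiv (𝓡 (2 * n + 1)) A.ψ q (A.Φ q v)
      = contactEndomorphism (A.β q) (K.J A.c (A.f q)) (mvfderiv (𝓡 (2 * n + 1)) A.ψ q v) :=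
  (A.isInvertible_mvfderiv_ψ hq).self_apply_inverse _

theorem mvfderiv_f_Φ (A : AdaptedChart D p) (hq : q ∈ A.W)
    (v : TangentSpace (𝓡 (2 * n + 1)) q) :
    mvfderiv (𝓡 (2 * n + 1)) A.f q (A.Φ q v)
      = -K.J A.c (A.f q) (mvfderiv (𝓡 (2 * n + 1)) A.f q v) := by
  have h := A.mvfderiv_ψ_Φ hq v
  rw [A.mvfderiv_ψ hq, A.mvfderiv_ψ hq, contactEndomorphism_apply] at h
  exact congrArg Prod.snd h

theorem η_Φ (A : AdaptedChart D p) (hq : q ∈ A.W) (v : TangentSpace (𝓡 (2 * n + 1)) q) :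
    A.η q (A.Φ q v) = 0 := by
  rw [A.η_eq_contactForm hq, A.mvfderiv_ψ_Φ hq, contactForm_apply, contactEndomorphism_apply,
    map_neg, add_neg_cancel]

theorem Φ_eq (hfin : ∃ N : ℕ, 0 < N ∧ O.IsIsotropyMultiple N) (A : AdaptedChart D p)
    (B : AdaptedChart D r) (hA : q ∈ A.W) (hB : q ∈ B.W) : A.Φ q = B.Φ q := by
  ext1 v
  refine A.ext_of_η hA ?_ ?_
  · rw [A.η_Φ hA, η_eq hfin A B hA hB, B.η_Φ hB]
  · have h := ((A.isLiftAt q hA).liftRel (B.isLiftAt q hB)).eq_neg_complex_iff K v (B.Φ q v)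
    rw [A.mvfderiv_f_Φ hA]
    exact (h.2 (B.mvfderiv_f_Φ hB v)).symm

/-- The metric `g + (ds + β)²` in the coordinates `(a, f)`. -/
def localMetric (A : AdaptedChart D p) (x : ℝ × Euc (2 * n)) :
    ℝ × Euc (2 * n) →L[ℝ] ℝ × Euc (2 * n) →L[ℝ] ℝ :=
  contactMetric ((D.β (S.π p)).linear A.c x.2) (K.g A.c x.2)

/-- The metric `f^*g + η ⊗ η`. -/
def metric (A : AdaptedChart D p) (q : M) :
    TangentSpace (𝓡 (2 * n + 1)) q →L[ℝ] TangentSpace (𝓡 (2 * n + 1)) q →L[ℝ] ℝ :=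
  pullbackBilin (A.localMetric (A.ψ q)) (mvfderiv (𝓡 (2 * n + 1)) A.ψ q)

theorem metric_apply (A : AdaptedChart D p) (hq : q ∈ A.W)
    (u v : TangentSpace (𝓡 (2 * n + 1)) q) :
    A.metric q u v = K.g A.c (A.f q) (mvfderiv (𝓡 (2 * n + 1)) A.f q u)
      (mvfderiv (𝓡 (2 * n + 1)) A.f q v) + A.η q u * A.η q v := by
  have h : A.metric q u v = contactMetric (A.β q) (K.g A.c (A.f q))
    (mvfderiv (𝓡 (2 * n + 1)) A.ψ q u) (mvfderiv (𝓡 (2 * n + 1)) A.ψ q v) := rfl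
  rw [h, contactMetric_apply, ← A.η_eq_contactForm hq, ← A.η_eq_contactForm hq,
    A.mvfderiv_ψ hq, A.mvfderiv_ψ hq]

theorem metric_eq (hfin : ∃ N : ℕ, 0 < N ∧ O.IsIsotropyMultiple N) (A : AdaptedChart D p)
    (B : AdaptedChart D r) (hA : q ∈ A.W) (hB : q ∈ B.W) : A.metric q = B.metric q := by
  ext u v
  rw [A.metric_apply hA, B.metric_apply hB, η_eq hfin A B hA hB,
    ((A.isLiftAt q hA).liftRel (B.isLiftAt q hB)).metric_eq K u v]

theorem metric_pos (A : AdaptedChart D p) (hq : q ∈ A.W) {u : TangentSpace (𝓡 (2 * n + 1)) q}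
    (hu : u ≠ 0) : 0 < A.metric q u u := by
  have hl := A.isLiftAt q hq
  rw [A.metric_apply hq]
  by_cases h : mvfderiv (𝓡 (2 * n + 1)) A.f q u = 0
  · have h' : A.η q u ≠ 0 := by
      intro h'
      exact hu (A.ext_of_η hq (by rw [h', map_zero]) (by rw [h, map_zero]))
    rw [h, map_zero, zero_add]
    exact mul_self_pos.2 h'
  · exact add_pos_of_pos_of_nonneg (K.g_pos _ hl.mem_atlas _ hl.mem_dom _ h) (mul_self_nonneg _)

/-- The form `η ∧ (dη)ⁿ` is positive. -/
theorem wedgeContact_pos (A : AdaptedChart D p)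
    (b : Module.Basis (Fin (2 * n + 1)) ℝ (TangentSpace (𝓡 (2 * n + 1)) p))
    (hb : b.orientation = o.orient p) :
    0 < wedgeContact (A.η p) (fun u v => K.Ω.form A.c (A.f p)
      ![mvfderiv (𝓡 (2 * n + 1)) A.f p u, mvfderiv (𝓡 (2 * n + 1)) A.f p v]) b := by
  have hl := A.isLiftAt p A.mem
  -- it suffices to evaluate on the basis given by the orientation of the model, whose first vector
  -- is vertical
  obtain ⟨b₀, L, hL, hb₀, ha, hf, hbf⟩ := A.orient
  let df : TangentSpace (𝓡 (2 * n + 1)) p →ₗ[ℝ] Euc (2 * n) :=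
    (mvfderiv (𝓡 (2 * n + 1)) A.f p : TangentSpace (𝓡 (2 * n + 1)) p →ₗ[ℝ] Euc (2 * n))
  let B := (K.bilin A.c (A.f p)).compl₁₂ df df
  have hB : ∀ u v, B u v = K.Ω.form A.c (A.f p)
      ![mvfderiv (𝓡 (2 * n + 1)) A.f p u, mvfderiv (𝓡 (2 * n + 1)) A.f p v] := fun u v =>
    K.bilin_apply hl.mem_atlas hl.mem_dom _ _
  simp only [← hB]
  refine wedgeContact_pos_of_orientation_eq (A.η p).toLinearMap B b₀ b (hb₀.trans hb.symm) ?_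
  have hB0 : ∀ u, B (b₀ 0) u = 0 := by
    intro u
    change K.bilin A.c (A.f p) (mvfderiv (𝓡 (2 * n + 1)) A.f p (b₀ 0)) (df u) = 0
    rw [hf, map_zero, LinearMap.zero_apply]
  have hB0' : ∀ u, B u (b₀ 0) = 0 := by
    intro u
    change K.bilin A.c (A.f p) (df u) (mvfderiv (𝓡 (2 * n + 1)) A.f p (b₀ 0)) = 0
    rw [hf, map_zero]
  rw [wedgeContact_eq_mul_wedgePow _ (fun u v => B u v) _ hB0 hB0']
  have hη : A.η p (b₀ 0) = mvfderiv (𝓡 (2 * n + 1)) A.a p (b₀ 0) := by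
    change mvfderiv (𝓡 (2 * n + 1)) A.a p (b₀ 0)
      + (D.β (S.π p)).linear A.c (A.f p) (mvfderiv (𝓡 (2 * n + 1)) A.f p (b₀ 0)) = _
    rw [hf, map_zero ((D.β (S.π p)).linear A.c (A.f p)), add_zero]
  have hw : wedgePow (fun u v => B u v) (fun i => b₀ i.succ)
      = wedgePow (fun u v => K.bilin A.c (A.f p) u v)
        ((L : Euc (2 * n) →ₗ[ℝ] Euc (2 * n)) ∘ (EuclideanSpace.basisFun (Fin (2 * n)) ℝ).toBasis)
        := by
    have h1 : ∀ i j, B (b₀ (Fin.succ i)) (b₀ (Fin.succ j)) = K.bilin A.c (A.f p)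
        (L (EuclideanSpace.basisFun (Fin (2 * n)) ℝ i))
        (L (EuclideanSpace.basisFun (Fin (2 * n)) ℝ j)) := by
      intro i j
      change K.bilin A.c (A.f p) (mvfderiv (𝓡 (2 * n + 1)) A.f p (b₀ i.succ))
        (mvfderiv (𝓡 (2 * n + 1)) A.f p (b₀ j.succ)) = _
      rw [hbf, hbf]
    simp only [wedgePow, h1, Function.comp_apply, OrthonormalBasis.coe_toBasis]
    rfl
  refine mul_pos (hη ▸ ha) ?_
  rw [hw, wedgePow_comp]
  refine mul_pos hL ?_
  have h2 := K.positive A.c hl.mem_atlas (A.f p) hl.mem_dom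
  simp only [← K.bilin_apply hl.mem_atlas hl.mem_dom] at h2
  rw [OrthonormalBasis.coe_toBasis]
  exact h2

theorem contDiffAt_localMetric (A : AdaptedChart D p) :
    ContDiffAt ℝ ∞ A.localMetric (A.ψ p) := by
  have hl := A.isLiftAt p A.mem
  have hg : ContDiffAt ℝ ∞ (fun x : ℝ × Euc (2 * n) => K.g A.c x.2) (A.ψ p) :=
    ContDiffAt.comp (A.ψ p) ((K.g_smooth A.c hl.mem_atlas).contDiffAt
      (A.c.isOpen_dom.mem_nhds hl.mem_dom)) contDiffAt_snd
  exact contDiffAt_contactMetric (A.contDiffAt_β A.mem) hg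

/-- The metric does not depend on the coordinate along the circle. -/
theorem fderiv_localMetric (A : AdaptedChart D p) :
    fderiv ℝ A.localMetric (A.ψ p) (1, 0) = 0 := by
  have h := (A.contDiffAt_localMetric.differentiableAt (by simp)).hasFDerivAt
  have h1 : HasDerivAt (fun t : ℝ => A.ψ p + t • ((1, 0) : ℝ × Euc (2 * n))) (1, 0) 0 := by
    simpa using ((hasDerivAt_id (0 : ℝ)).smul_const ((1, 0) : ℝ × Euc (2 * n))).const_add (A.ψ p)
  have h2 := HasFDerivAt.comp_hasDerivAt (x := (0 : ℝ))
    (f := fun t : ℝ => A.ψ p + t • ((1, 0) : ℝ × Euc (2 * n))) (by simpa using h) h1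
  have h3 := hasDerivAt_const (0 : ℝ)
    (contactMetric ((D.β (S.π p)).linear A.c (A.f p)) (K.g A.c (A.f p)))
  refine h2.unique (h3.congr_of_eventuallyEq (Eventually.of_forall fun t => ?_))
  simp [ψ, localMetric]

variable [IsManifold (𝓡 (2 * n + 1)) ∞ M]

theorem contMDiffAt_Φ (A : AdaptedChart D p) :
    ContMDiffAt (𝓡 (2 * n + 1))
      ((𝓡 (2 * n + 1)).prod 𝓘(ℝ, Euc (2 * n + 1) →L[ℝ] Euc (2 * n + 1))) ∞
      (fun q => Bundle.TotalSpace.mk' (Euc (2 * n + 1) →L[ℝ] Euc (2 * n + 1))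
        (E := fun q : M => TangentSpace (𝓡 (2 * n + 1)) q →L[ℝ] TangentSpace (𝓡 (2 * n + 1)) q) q
        (A.Φ q)) p := by
  have hl := A.isLiftAt p A.mem
  have hJ : ContDiffAt ℝ ∞ (fun x : ℝ × Euc (2 * n) => K.J A.c x.2) (A.ψ p) :=
    ContDiffAt.comp (A.ψ p) ((K.J_smooth A.c hl.mem_atlas).contDiffAt
      (A.c.isOpen_dom.mem_nhds hl.mem_dom)) contDiffAt_snd
  exact contMDiffAt_pullback_endomorphism (A.contMDiffAt_ψ A.mem) (A.isInvertible_mvfderiv_ψ A.mem)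
    (contDiffAt_contactEndomorphism (A.contDiffAt_β A.mem) hJ)

theorem contMDiffAt_metric (A : AdaptedChart D p) :
    ContMDiffAt (𝓡 (2 * n + 1))
      ((𝓡 (2 * n + 1)).prod 𝓘(ℝ, Euc (2 * n + 1) →L[ℝ] Euc (2 * n + 1) →L[ℝ] ℝ)) ∞
      (fun q => Bundle.TotalSpace.mk' (Euc (2 * n + 1) →L[ℝ] Euc (2 * n + 1) →L[ℝ] ℝ)
        (E := fun q : M => TangentSpace (𝓡 (2 * n + 1)) q →L[ℝ]
          TangentSpace (𝓡 (2 * n + 1)) q →L[ℝ] ℝ) q (A.metric q)) p :=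
  contMDiffAt_pullback_bilinForm (A.contMDiffAt_ψ A.mem) A.contDiffAt_localMetric

/-- The Reeb field is a Killing field. -/
theorem mvfderiv_metric_ξ (A : AdaptedChart D p)
    {ξ Y Z : ∀ q : M, TangentSpace (𝓡 (2 * n + 1)) q} (hξ : ∀ᶠ q in 𝓝 p, ξ q = A.ξ q)
    (hY : IsSmoothField Y) (hZ : IsSmoothField Z) :
    mvfderiv (𝓡 (2 * n + 1)) (fun q => A.metric q (Y q) (Z q)) p (ξ p)
      = A.metric p (VectorField.mlieBracket (𝓡 (2 * n + 1)) ξ Y p) (Z p)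
        + A.metric p (Y p) (VectorField.mlieBracket (𝓡 (2 * n + 1)) ξ Z p) := by
  have hW := A.isOpen.mem_nhds A.mem
  refine mvfderiv_pullbackBilin_apply (A.contMDiffAt_ψ A.mem) ?_ ?_ A.contDiffAt_localMetric
    A.fderiv_localMetric hY hZ
  · filter_upwards [hW] with q hq
    exact A.isInvertible_mvfderiv_ψ hq
  · filter_upwards [hW, hξ] with q hq hq'
    rw [hq', A.mvfderiv_ψ_ξ hq]

end AdaptedChart

section Assembly

variable {X : Type*} [TopologicalSpace X] {n : ℕ} {O : OrientedOrbifold X (2 * n)}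
  {M : Type*} [TopologicalSpace M] [ChartedSpace (Euc (2 * n + 1)) M] [MulAction Circle M]
  {o : ManifoldOrientation (2 * n + 1) M} [ContMDiffSMul (𝓡 1) (𝓡 (2 * n + 1)) ∞ Circle M]
  {S : SeifertBundle O o} {K : AlmostKahler O} {D : ConnectionData S K.Ω}
  [IsManifold (𝓡 (2 * n + 1)) ∞ M]

/-- The sublevel sets of a positive definite bilinear form on a finite-dimensional space are
bounded. -/
theorem isVonNBounded_of_pos {E : Type*} [NormedAddCommGroup E] [NormedSpace ℝ E]
    [FiniteDimensional ℝ E] (g : E →L[ℝ] E →L[ℝ] ℝ) (hg : ∀ v, v ≠ 0 → 0 < g v v) :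
    Bornology.IsVonNBounded ℝ {v : E | g v v < 1} := by
  have hcont : Continuous fun v => g v v := by fun_prop
  obtain ⟨C, hC, hCb⟩ : ∃ C : ℝ, 0 < C ∧ ∀ v ∈ Metric.sphere (0 : E) 1, C ≤ g v v := by
    rcases (Metric.sphere (0 : E) 1).eq_empty_or_nonempty with h | h
    · exact ⟨1, one_pos, by simp [h]⟩
    · obtain ⟨w, hw, hmin⟩ := (isCompact_sphere (0 : E) 1).exists_isMinOn h hcont.continuousOn
      refine ⟨g w w, hg w ?_, fun v hv => hmin hv⟩
      rintro rfl
      simp at hw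
  rw [NormedSpace.isVonNBounded_iff']
  refine ⟨Real.sqrt C⁻¹, fun v hv => ?_⟩
  by_cases h0 : v = 0
  · rw [h0, norm_zero]
    exact Real.sqrt_nonneg _
  have hn : 0 < ‖v‖ := norm_pos_iff.2 h0
  have h1 := hCb (‖v‖⁻¹ • v) (by simp [norm_smul, hn.ne'])
  have h2 : g (‖v‖⁻¹ • v) (‖v‖⁻¹ • v) = (‖v‖ ^ 2)⁻¹ * g v v := by
    simp only [map_smul, smul_apply, smul_eq_mul]
    ring
  refine Real.le_sqrt_of_sq_le ?_
  rw [h2, inv_mul_eq_div, le_div_iff₀ (by positivity)] at h1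
  have hv' : g v v < 1 := hv
  rw [← one_div, le_div_iff₀ hC]
  linarith

omit [IsManifold (𝓡 (2 * n + 1)) ∞ M] in
theorem ConnectionData.eventually_η_eq (hfin : ∃ N : ℕ, 0 < N ∧ O.IsIsotropyMultiple N)
    (𝒜 : ∀ p : M, AdaptedChart D p) (p : M) : ∀ᶠ q in 𝓝 p, (𝒜 q).η q = (𝒜 p).η q := by
  filter_upwards [(𝒜 p).isOpen.mem_nhds (𝒜 p).mem] with q hq
  exact AdaptedChart.η_eq hfin (𝒜 q) (𝒜 p) (𝒜 q).mem hq

/-- The K-contact structure defined by a connection form with curvature form `Ω`. The value of each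
tensor at `p` is taken in the chosen adapted chart at `p`; near `p` it agrees with the tensor of this
one chart, as the tensors do not depend on the chart. -/
def ConnectionData.kContactStructure (hfin : ∃ N : ℕ, 0 < N ∧ O.IsIsotropyMultiple N)
    (𝒜 : ∀ p : M, AdaptedChart D p) : KContactStructure o :=
  have hW : ∀ p, ∀ᶠ q in 𝓝 p, q ∈ (𝒜 p).W := fun p => (𝒜 p).isOpen.mem_nhds (𝒜 p).mem
  have hη := ConnectionData.eventually_η_eq hfin 𝒜
  have hξ : ∀ p, ∀ᶠ q in 𝓝 p, (𝒜 q).ξ q = (𝒜 p).ξ q := fun p => (hW p).mono fun q hq =>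
    AdaptedChart.ξ_eq hfin (𝒜 q) (𝒜 p) (𝒜 q).mem hq
  have hΦ : ∀ p, ∀ᶠ q in 𝓝 p, (𝒜 q).Φ q = (𝒜 p).Φ q := fun p => (hW p).mono fun q hq =>
    AdaptedChart.Φ_eq hfin (𝒜 q) (𝒜 p) (𝒜 q).mem hq
  have hg : ∀ p, ∀ᶠ q in 𝓝 p, (𝒜 q).metric q = (𝒜 p).metric q := fun p => (hW p).mono fun q hq =>
    AdaptedChart.metric_eq hfin (𝒜 q) (𝒜 p) (𝒜 q).mem hq
  have hl : ∀ p, IsLiftAt O S.π (𝒜 p).c (𝒜 p).f p := fun p => (𝒜 p).isLiftAt p (𝒜 p).mem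
  have hd : ∀ p u v, oneFormDeriv (fun q => (𝒜 q).η q) p u v
      = K.bilin (𝒜 p).c ((𝒜 p).f p) (mvfderiv (𝓡 (2 * n + 1)) (𝒜 p).f p u)
        (mvfderiv (𝓡 (2 * n + 1)) (𝒜 p).f p v) := fun p u v => by
    rw [K.bilin_apply (hl p).mem_atlas (hl p).mem_dom]
    exact (𝒜 p).oneFormDeriv_eq_pullback (hη p) u v
  { η := fun p => (𝒜 p).η p
    η_smooth := fun p => (𝒜 p).contMDiffAt_η.congr_of_eventuallyEq <| (hη p).mono fun q hq => by
      simp only [hq]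
    contact := fun p b hb => by
      have h := (𝒜 p).wedgeContact_pos b hb
      have h' : oneFormDeriv (fun q => (𝒜 q).η q) p = fun u v => K.Ω.form (𝒜 p).c ((𝒜 p).f p)
          ![mvfderiv (𝓡 (2 * n + 1)) (𝒜 p).f p u, mvfderiv (𝓡 (2 * n + 1)) (𝒜 p).f p v] := by
        funext u v
        exact (𝒜 p).oneFormDeriv_eq_pullback (hη p) u v
      rw [h']
      exact h
    ξ := fun p => (𝒜 p).ξ p
    ξ_smooth := fun p => (𝒜 p).contMDiffAt_ξ.congr_of_eventuallyEq <| (hξ p).mono fun q hq => by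
      simp only [hq]
    reeb := fun p => (𝒜 p).η_ξ (𝒜 p).mem
    reeb_deriv := fun p v => by
      rw [hd, (𝒜 p).mvfderiv_f_ξ (𝒜 p).mem, map_zero, LinearMap.zero_apply]
    Φ := fun p => (𝒜 p).Φ p
    Φ_smooth := fun p => (𝒜 p).contMDiffAt_Φ.congr_of_eventuallyEq <| (hΦ p).mono fun q hq => by
      simp only [hq]
    Φ_sq := fun p u => by
      refine (𝒜 p).ext_of_η (𝒜 p).mem ?_ ?_
      · rw [(𝒜 p).η_Φ (𝒜 p).mem, map_add, map_neg, map_smul, (𝒜 p).η_ξ (𝒜 p).mem]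
        simp
      · rw [(𝒜 p).mvfderiv_f_Φ (𝒜 p).mem, (𝒜 p).mvfderiv_f_Φ (𝒜 p).mem, map_neg, neg_neg,
          K.J_sq _ (hl p).mem_atlas _ (hl p).mem_dom, map_add, map_neg, map_smul,
          (𝒜 p).mvfderiv_f_ξ (𝒜 p).mem, smul_zero, add_zero]
    Φ_compatible := fun p u v => by
      rw [hd, hd, (𝒜 p).mvfderiv_f_Φ (𝒜 p).mem, (𝒜 p).mvfderiv_f_Φ (𝒜 p).mem,
        K.bilin_neg_J_neg_J (hl p).mem_atlas (hl p).mem_dom]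
    Φ_positive := fun p u hu hu' => by
      rw [hd, (𝒜 p).mvfderiv_f_Φ (𝒜 p).mem, K.bilin_neg_J_left (hl p).mem_atlas (hl p).mem_dom]
      refine K.g_pos _ (hl p).mem_atlas _ (hl p).mem_dom _ fun h => hu ?_
      exact (𝒜 p).ext_of_η (𝒜 p).mem (by rw [hu', map_zero]) (by rw [h, map_zero])
    g :=
      { inner := fun p => (𝒜 p).metric p
        symm := fun p u v => by
          rw [(𝒜 p).metric_apply (𝒜 p).mem, (𝒜 p).metric_apply (𝒜 p).mem,
            K.g_symm _ (hl p).mem_atlas _ (hl p).mem_dom, mul_comm ((𝒜 p).η p u)]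
        pos := fun p u hu => (𝒜 p).metric_pos (𝒜 p).mem hu
        isVonNBounded := fun p => isVonNBounded_of_pos (E := Euc (2 * n + 1)) ((𝒜 p).metric p)
          fun u hu => (𝒜 p).metric_pos (𝒜 p).mem hu
        contMDiff := fun p => (𝒜 p).contMDiffAt_metric.congr_of_eventuallyEq <|
          (hg p).mono fun q hq => by simp only [hq] }
    g_eq := fun p u v => by
      rw [hd, (𝒜 p).mvfderiv_f_Φ (𝒜 p).mem, K.bilin_neg_J_left (hl p).mem_atlas (hl p).mem_dom]
      exact (𝒜 p).metric_apply (𝒜 p).mem u v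
    killing := fun Y Z hY hZ p => by
      have h := (𝒜 p).mvfderiv_metric_ξ (hξ p) hY hZ
      have h' : (fun q => (𝒜 q).metric q (Y q) (Z q)) =ᶠ[𝓝 p]
          fun q => (𝒜 p).metric q (Y q) (Z q) := (hg p).mono fun q hq => by simp only [hq]
      rw [← mvfderiv_congr h'] at h
      exact h }

theorem ConnectionData.isPullbackForm_oneFormDeriv
    (hfin : ∃ N : ℕ, 0 < N ∧ O.IsIsotropyMultiple N) (𝒜 : ∀ p : M, AdaptedChart D p) :
    IsPullbackForm S.π K.Ω (oneFormDeriv (ConnectionData.kContactStructure hfin 𝒜).η) := by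
  intro c hc W f hW hf hlift q hq u v
  have hWq := hW.mem_nhds hq
  have hl : IsLiftAt O S.π c f q :=
    ⟨hc, hf.contMDiffAt hWq, by filter_upwards [hWq] with r hr using hlift r hr⟩
  have h := (𝒜 q).oneFormDeriv_eq_pullback (ConnectionData.eventually_η_eq hfin 𝒜 q) u v
  have h' := (((𝒜 q).isLiftAt q (𝒜 q).mem).liftRel hl).form_eq K.Ω (mem_univ _) ![u, v]
  have h2 : ∀ L : TangentSpace (𝓡 (2 * n + 1)) q → Euc (2 * n), L ∘ ![u, v] = ![L u, L v] := by
    intro L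
    ext i
    fin_cases i <;> rfl
  rw [h2, h2] at h'
  exact h.trans h'

end Assembly

end

theorem mainTheorem6 {n : ℕ}
    {X : Type*} [TopologicalSpace X] [T2Space X] [SecondCountableTopology X]
    (O : OrientedOrbifold X (2 * n)) (hcyc : O.IsCyclicOrbifold)
    (hfin : ∃ N : ℕ, 0 < N ∧ O.IsIsotropyMultiple N)
    (K : AlmostKahler O)
    {M : Type*} [TopologicalSpace M] [T2Space M] [SecondCountableTopology M]
    [ChartedSpace (Euc (2 * n + 1)) M] [IsManifold (𝓡 (2 * n + 1)) ∞ M]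
    [MulAction Circle M] [ContMDiffSMul (𝓡 1) (𝓡 (2 * n + 1)) ∞ Circle M]
    (o : ManifoldOrientation (2 * n + 1) M)
    (S : SeifertBundle O o)
    (a : CechH2 X ℚ)
    (hΩ : K.Ω.HasClass (CechH2.coeff (Rat.castHom ℝ).toAddMonoidHom a))
    (hc : S.HasChernClass a) :
    ∃ C : KContactStructure o, IsPullbackForm S.π K.Ω (oneFormDeriv C.η) := by
  obtain ⟨C⟩ := exists_cechData S K.Ω a hΩ hc
  obtain ⟨D⟩ := C.exists_connectionData hfin
  exact ⟨_, ConnectionData.isPullbackForm_oneFormDeriv hfin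
    fun p => (D.exists_adaptedChart hfin p).some⟩
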